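/- **Setting.** Let $n\ge 4$, $p\ge 3$, let $X_1,\dots,X_n$ be independent centered random vectors in $\mathbb R^p$ with $E[X_{ij}^2]<\infty$ for all $i,j$, let $Y_1,\dots,Y_n$ be independent with $Y_i\sim N(0,E[X_iX_i'])$, and let $e_1,\dots,e_n$ be i.i.d. $N(0,1)$ random variables independent of $X_1^n=(X_1,\dots,X_n)$. Put $\bar X=n^{-1}\sum_{i=1}^n X_i$, $S_n^{eX}=n^{-1/2}\sum_{i=1}^n e_i(X_i-\bar X)$, $S_n^Y=n^{-1/2}\sum_{i=1}^n Y_i$, and for a class $\mathcal A$ of Borel subsets of $\mathbb R^p$ $$\rho_n^{MB}(\mathcal A)=\sup_{A\in\mathcal A}\bigl|\Pr(S_n^{eX}\in A\mid X_1^n)-\Pr(S_n^Y\in A)\bigr| ,$$ the conditional probability being taken through the regular conditional distribution of $S_n^{eX}$ given $X_1^n$. **Simple convex sets.** For $P\subset\mathbb R^p$ let $\mathcal S_P(v)=\sup\{w'v:w\in P\}\in[-\infty,\infty]$. A set $P$ is $m$-generated with set of normal vectors $\mathcal V(P)$ if $\mathcal V(P)$ consists of $m$ unit vectors and $P=\bigcap_{v\in\mathcal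 V(P)}\{w:w'v\le \mathcal S_P(v)\}$. For $a\ge 0$ and $d>0$, $\mathcal A^{\rm si}(a,d)$ is the class of convex Borel sets $A\subset\mathbb R^p$ such that for some $m\le (pn)^d$ there is an $m$-generated set $A^m=A^m(A)$ with $$A^m\subset A\subset \bigcap_{v\in\mathcal V(A^m)}\{w:w'v\le \mathcal S_{A^m}(v)+a/n\}.$$ **Conditions.** Let $b,q>0$, $B_n\ge 1$, and let $s$ be a nonnegative integer. * (S) every $v\in\mathcal V(A^m(A))$ has at most $s$ nonzero coordinates; * (M.1′) $n^{-1}\sum_{i=1}^n E[(v'X_i)^2]\ge b$ for all $v\in\mathcal V(A^m(A))$; * (M.2) $n^{-1}\sum_{i=1}^n E[|X_{ij}|^{2+k}]\le B_n^k$ for all $j=1,\dots,p$ and $k=1,2$; * (E.1) $E[\exp(|X_{ij}|/B_n)]\le 2$ for all $i,j$; * (E.2) $E[(\max_{1\le j\le p}|X_{ij}|/B_n)^q]\le 2$ for all $i$. For $\alpha\in(0,e^{-1})$ put $$D_n^{(1)}(\alpha)=\Bigl(\frac{B_n^2\log^5(pn)\log^2(1/\alpha)}{n}\Bigr)^{1/6},\qquad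 D_{n,q}^{(2)}(\alpha)=\Bigl(\frac{B_n^2\log^3(pn)}{\alpha^{2/q}n^{1-2/q}}\Bigr)^{1/3}.$$ **Proposition (Multiplier Bootstrap for Simple Convex Sets).** Let $\alpha\in(0,e^{-1})$, let $\mathcal A\subset\mathcal A^{\rm si}(a,d)$ be such that (S) and (M.1′) hold for every $A\in\mathcal A$, with a fixed choice of $A^m(A)$ and $\mathcal V(A^m(A))$ for each $A\in\mathcal A$, and suppose that (M.2) holds. 1. Under (E.1), with probability at least $1-\alpha$, $$\rho_n^{MB}(\mathcal A)\le C\,D_n^{(1)}(\alpha),$$ where $C$ depends only on $a,b,d$ and $s$. 2. Under (E.2), with probability at least $1-\alpha$, $$\rho_n^{MB}(\mathcal A)\le C\{D_n^{(1)}(\alpha)+D_{n,q}^{(2)}(\alpha)\},$$ where $C$ depends only on $a,b,d,q$ and $s$. Here "with probability at least $1-\alpha$" means that the inequality holds on a measurable event of probability at least $1-\alpha$. -/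

import Mathlib

open MeasureTheory ProbabilityTheory

noncomputable section

namespace HighDimBootstrap

/-- `ℝ^p` with its Euclidean structure. -/
abbrev Vec (p : ℕ) : Type := EuclideanSpace ℝ (Fin p)

/-! ### Simple convex sets -/

/-- The support function `v ↦ sup {w'v : w ∈ A}`, with values in the extended reals. -/
def supportFun {p : ℕ} (A : Set (Vec p)) (v : Vec p) : EReal :=
  ⨆ w ∈ A, ((inner ℝ w v : ℝ) : EReal)

/-- The set `⋂_{v ∈ V} {w : w'v ≤ S_P(v) + ε}`, where `S_P` is the support function of `P`. -/
def enlarge {p : ℕ} (P : Set (Vec p)) (V : Finset (Vec p)) (ε : ℝ) : Set (Vec p) :=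
  {w | ∀ v ∈ V, ((inner ℝ w v : ℝ) : EReal) ≤ supportFun P v + (ε : EReal)}

/-- `P` is the convex polytope generated by half-spaces whose outward unit normal vectors are the
elements of the finite set `V`, that is, `P = ⋂_{v ∈ V} {w : w'v ≤ S_P(v)}`. -/
structure IsGeneratedBy {p : ℕ} (P : Set (Vec p)) (V : Finset (Vec p)) : Prop where
  norm_eq_one : ∀ v ∈ V, ‖v‖ = 1
  eq_inter : P = {w | ∀ v ∈ V, ((inner ℝ w v : ℝ) : EReal) ≤ supportFun P v}

/-- Condition (C): `A` admits an approximation with precision `a / n` by the `m`-generated convex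
set `P` with normal vectors `V`, where `m = #V ≤ (p n)^d`. -/
structure CondC {p : ℕ} (n : ℕ) (a d : ℝ) (A P : Set (Vec p)) (V : Finset (Vec p)) : Prop where
  generated : IsGeneratedBy P V
  card_le : (V.card : ℝ) ≤ ((p : ℝ) * (n : ℝ)) ^ d
  subset : P ⊆ A
  subset_enlarge : A ⊆ enlarge P V (a / (n : ℝ))

/-- The class of simple convex sets: Borel convex sets that satisfy (C) for some `m`-generated
convex set. -/
def simpleConvexSets (p n : ℕ) (a d : ℝ) : Set (Set (Vec p)) :=
  {A | MeasurableSet A ∧ Convex ℝ A ∧ ∃ P V, CondC n a d A P V}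

/-- The number of nonzero coordinates of `v`. -/
def l0norm {p : ℕ} (v : Vec p) : ℕ := (Finset.univ.filter fun j => v j ≠ 0).card

/-- Condition (S): all normal vectors in `V` have at most `s` nonzero coordinates. -/
def CondS {p : ℕ} (s : ℕ) (V : Finset (Vec p)) : Prop := ∀ v ∈ V, l0norm v ≤ s

/-! ### The sample, its Gaussian analogue and the multipliers -/

section Probability

variable {Ω : Type*} [MeasurableSpace Ω]

/-- `X_1, …, X_n` are independent centered random vectors in `ℝ^p` with finite second moments. -/
structure IsCenteredSample {n p : ℕ} (X : Fin n → Ω → Vec p) (μ : Measure Ω) : Prop where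
  measurable : ∀ i, Measurable (X i)
  indep : iIndepFun X μ
  memLp : ∀ i j, MemLp (fun ω => X i ω j) 2 μ
  centered : ∀ i j, ∫ ω, X i ω j ∂μ = 0

/-- The matrix `E[ξ ξ']`. -/
def secondMoment {p : ℕ} (ξ : Ω → Vec p) (μ : Measure Ω) : Matrix (Fin p) (Fin p) ℝ :=
  Matrix.of fun j k => ∫ ω, ξ ω j * ξ ω k ∂μ

/-- `Y_1, …, Y_n` are independent with `Y_i ∼ N(0, E[X_i X_i'])`; they may live on another
probability space. -/
structure IsGaussianAnalogue {Ω' : Type*} [MeasurableSpace Ω'] {n p : ℕ}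
    (X : Fin n → Ω → Vec p) (μ : Measure Ω) (Y : Fin n → Ω' → Vec p) (ν : Measure Ω') : Prop where
  indep : iIndepFun Y ν
  law : ∀ i, HasLaw (Y i) (multivariateGaussian 0 (secondMoment (X i) μ)) ν

/-- `e_1, …, e_n` are i.i.d. `N(0,1)` and independent of `X_1, …, X_n`. -/
structure IsMultiplier {n p : ℕ} (e : Fin n → Ω → ℝ) (X : Fin n → Ω → Vec p)
    (μ : Measure Ω) : Prop where
  measurable : ∀ i, Measurable (e i)
  indep : iIndepFun e μ
  law : ∀ i, HasLaw (e i) (gaussianReal 0 1) μ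
  indep_sample : IndepFun (fun ω i => e i ω) (fun ω i => X i ω) μ

/-- `n^{-1/2} ∑ Y_i`. -/
def normalizedSum {n p : ℕ} (Y : Fin n → Ω → Vec p) (ω : Ω) : Vec p :=
  (Real.sqrt (n : ℝ))⁻¹ • ∑ i, Y i ω

/-- The sample mean `n^{-1} ∑ X_i`. -/
def sampleMean {n p : ℕ} (X : Fin n → Ω → Vec p) (ω : Ω) : Vec p :=
  ((n : ℝ))⁻¹ • ∑ i, X i ω

/-- The multiplier bootstrap sum `n^{-1/2} ∑ e_i (X_i - X̄)`. -/
def bootstrapSum {n p : ℕ} (e : Fin n → Ω → ℝ) (X : Fin n → Ω → Vec p) (ω : Ω) : Vec p :=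
  (Real.sqrt (n : ℝ))⁻¹ • ∑ i, e i ω • (X i ω - sampleMean X ω)

/-- The (random) multiplier bootstrap error
`sup_{A ∈ 𝒜} |Pr(S_n^{eX} ∈ A | X_1, …, X_n) - Pr(S_n^Y ∈ A)|`, where the conditional probability
is taken through the regular conditional distribution of `S_n^{eX}` given `(X_1, …, X_n)`. -/
def bootstrapError {Ω' : Type*} [MeasurableSpace Ω'] {n p : ℕ} (e : Fin n → Ω → ℝ)
    (X : Fin n → Ω → Vec p) (μ : Measure Ω) [IsFiniteMeasure μ] (Y : Fin n → Ω' → Vec p)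
    (ν : Measure Ω') (𝒜 : Set (Set (Vec p))) (ω : Ω) : ℝ :=
  ⨆ A : 𝒜, |(condDistrib (bootstrapSum e X) (fun ω i => X i ω) μ (fun i => X i ω)).real A.1
    - (ν.map (normalizedSum Y)).real A.1|

/-! ### Moment conditions -/

/-- (M.1'): `n^{-1} ∑ E[(v'X_i)^2] ≥ b` for every normal vector `v ∈ V`. -/
def CondM1' {n p : ℕ} (b : ℝ) (X : Fin n → Ω → Vec p) (μ : Measure Ω)
    (V : Finset (Vec p)) : Prop :=
  ∀ v ∈ V, b ≤ ((n : ℝ))⁻¹ * ∑ i, ∫ ω, (inner ℝ v (X i ω) : ℝ) ^ 2 ∂μ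

/-- (M.2): `n^{-1} ∑ E[|X_ij|^{2+k}] ≤ B^k` for all `j` and `k = 1, 2`. The expectations are
`[0, ∞]`-valued, so that the bound includes their finiteness. -/
def CondM2 {n p : ℕ} (B : ℝ) (X : Fin n → Ω → Vec p) (μ : Measure Ω) : Prop :=
  ∀ j : Fin p, ∀ k ∈ ({1, 2} : Set ℕ),
    ((n : ENNReal))⁻¹ * ∑ i, ∫⁻ ω, ENNReal.ofReal (|X i ω j| ^ (2 + k)) ∂μ
      ≤ ENNReal.ofReal (B ^ k)

/-- (E.1): `E[exp(|X_ij| / B)] ≤ 2` for all `i` and `j`. -/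
def CondE1 {n p : ℕ} (B : ℝ) (X : Fin n → Ω → Vec p) (μ : Measure Ω) : Prop :=
  ∀ i j, ∫⁻ ω, ENNReal.ofReal (Real.exp (|X i ω j| / B)) ∂μ ≤ 2

/-- (E.2): `E[(max_j |X_ij| / B)^q] ≤ 2` for all `i`. -/
def CondE2 {n p : ℕ} (B q : ℝ) (X : Fin n → Ω → Vec p) (μ : Measure Ω) : Prop :=
  ∀ i, ∫⁻ ω, ENNReal.ofReal (((⨆ j, |X i ω j|) / B) ^ q) ∂μ ≤ 2

end Probability

/-! ### Rates -/

/-- `D_n^{(1)}(α) = (B² log⁵(pn) log²(1/α) / n)^{1/6}`. -/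
def rateD1 (n p : ℕ) (B α : ℝ) : ℝ :=
  (B ^ 2 * Real.log ((p : ℝ) * n) ^ 5 * Real.log (1 / α) ^ 2 / n) ^ (1 / 6 : ℝ)

/-- `D_{n,q}^{(2)}(α) = (B² log³(pn) / (α^{2/q} n^{1-2/q}))^{1/3}`. -/
def rateD2 (n p : ℕ) (B q α : ℝ) : ℝ :=
  (B ^ 2 * Real.log ((p : ℝ) * n) ^ 3 / (α ^ (2 / q) * (n : ℝ) ^ (1 - 2 / q))) ^ (1 / 3 : ℝ)

end HighDimBootstrap

end

open HighDimBootstrap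

namespace HighDimBootstrap

open scoped Matrix RealInnerProductSpace ENNReal NNReal

/-! ### Centered Gaussian measures on `ℝ^p` -/

/-! Conditionally on the sample, the bootstrap sum is exactly centered Gaussian with the empirical
covariance matrix (`condDistrib_bootstrapSum`), and `normalizedSum Y` is centered Gaussian with the
averaged covariance matrix (`map_normalizedSum`). Only two questions remain: how far two centered
Gaussian laws differ on simple convex sets, in terms of their covariances, and how far the empirical
covariance is from its mean.

Comparison. A simple convex set lies between two intersections of half-spaces with the same normals
whose bounds differ by `a / n`. With `L = log (p n)`, there are at most `exp (d * L)` normals. The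
indicator of such an intersection is smoothed by a step function of a log-sum-exp, with transition
width of order `ε`. The coefficients of the second order Taylor polynomial of this function along
the normals have absolute sum of order `L / ε ^ 2`, independently of the number of normals
(`taylor_softmax`). Moving from one covariance to the other in `N` equal steps, each step costs its
second order term and a remainder of order `N ^ (-3/2)`; the remainders vanish as `N → ∞`, and the
expectations differ by order `Δ * L / ε ^ 2`, with `Δ` the covariance difference along the normals
(`gauss_comparison`). The shifts by `ε` and `a / n` are paid for by Nazarov's inequality
(`nazarov`), at a price of order `√L` per unit of shift. It is needed only for the law of the
Gaussian analogue, whose variances along the normals are at least `b`; the empirical covariance may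
be degenerate.

The total is of order `(a / n) * √L + ε * √L + s² * u * L / ε ^ 2`, where `u` bounds the entrywise
covariance error and `s²` comes from sparsity of the normals. Taking `ε = D / √L` makes it of order
`D` as soon as `u * L ^ 2` is of order `D ^ 3` (`exists_bootstrapError_le`); this is where the cube
root in the rates comes from.

Concentration. Coordinates are truncated at a level exceeded with probability at most `α / 2` in
total, and an exponential moment bound is applied to each product of truncated coordinates
(`sampleCov_concentration`). Exponential moments give `u` of order `B log(1/α) √L / √n`; `q`-th
moments add a term of order `B² L / (α ^ (2/q) n ^ (1 - 2/q))`. Multiplied by `L ^ 2` these are the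
cubes of the two rates. The smallness conditions used on the way hold when the claimed rate is at
most 1; otherwise the bound is trivial, the error being at most 1. -/

/-- The bilinear form `(x, y) ↦ x' S y`. -/
def bil {p : ℕ} (S : Matrix (Fin p) (Fin p) ℝ) (x y : Vec p) : ℝ := x.ofLp ⬝ᵥ S *ᵥ y.ofLp

lemma bil_eq_sum {p : ℕ} (S : Matrix (Fin p) (Fin p) ℝ) (x y : Vec p) :
    bil S x y = ∑ j, ∑ k, x j * (S j k * y k) := by
  simp [bil, dotProduct, Matrix.mulVec, Finset.mul_sum]

/-- The centered Gaussian measure with covariance matrix `S`. -/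
noncomputable abbrev gauss {p : ℕ} (S : Matrix (Fin p) (Fin p) ℝ) : Measure (Vec p) :=
  multivariateGaussian 0 S

section Gauss

variable {p : ℕ} {S T : Matrix (Fin p) (Fin p) ℝ}

lemma charFun_gauss (hS : S.PosSemidef) (t : Vec p) :
    charFun (gauss S) t = Complex.exp (-(bil S t t : ℂ) / 2) := by
  rw [gauss, charFun_multivariateGaussian hS]
  simp [bil, neg_div]

lemma gauss_conv (hS : S.PosSemidef) (hT : T.PosSemidef) :
    Measure.conv (gauss S) (gauss T) = gauss (S + T) := by
  apply Measure.ext_of_charFun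
  ext t
  rw [charFun_conv, charFun_gauss hS, charFun_gauss hT, charFun_gauss (hS.add hT),
    ← Complex.exp_add]
  congr 1
  simp only [bil, Matrix.add_mulVec, dotProduct_add]
  push_cast
  ring

lemma gauss_map_smul (hS : S.PosSemidef) (c : ℝ) :
    (gauss S).map (fun x => c • x) = gauss (c ^ 2 • S) := by
  apply Measure.ext_of_charFun
  ext t
  rw [charFun_map_smul, charFun_gauss hS, charFun_gauss (hS.smul (sq_nonneg c))]
  congr 2
  simp only [bil, Matrix.smul_mulVec, dotProduct_smul, WithLp.ofLp_smul, Matrix.mulVec_smul,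
    smul_dotProduct, smul_eq_mul]
  push_cast
  ring

lemma memLp_inner_gauss (v : Vec p) : MemLp (fun x => ⟪v, x⟫) 2 (gauss S) := by
  have := (IsGaussian.memLp_two_id (μ := gauss S)).continuousLinearMap_comp (innerSL ℝ v)
  simpa using this

lemma integral_inner_gauss (v : Vec p) : ∫ x, ⟪v, x⟫ ∂gauss S = 0 := by
  rw [integral_inner (IsGaussian.integrable_fun_id)]
  simp [gauss]

lemma integral_inner_mul_inner_gauss (hS : S.PosSemidef) (v u : Vec p) :
    ∫ x, ⟪v, x⟫ * ⟪u, x⟫ ∂gauss S = bil S v u := by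
  have h := covarianceBilin_multivariateGaussian (μ := 0) hS v u
  rw [covarianceBilin_apply_eq_cov IsGaussian.memLp_two_id, covariance_eq_sub
    (memLp_inner_gauss v) (memLp_inner_gauss u)] at h
  rw [integral_inner_gauss] at h
  simpa [bil] using h

lemma bil_nonneg (hS : S.PosSemidef) (v : Vec p) : 0 ≤ bil S v v := by
  rw [← integral_inner_mul_inner_gauss hS]
  exact integral_nonneg fun x => mul_self_nonneg _

/-- The matrix `∑ i, a i (a i)'`. -/
def gram {n p : ℕ} (a : Fin n → Vec p) : Matrix (Fin p) (Fin p) ℝ :=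
  Matrix.of fun j k => ∑ i, a i j * a i k

lemma bil_gram {n : ℕ} (a : Fin n → Vec p) (x y : Vec p) :
    bil (gram a) x y = ∑ i, ⟪a i, x⟫ * ⟪a i, y⟫ := by
  have e : ∀ i, ⟪a i, x⟫ * ⟪a i, y⟫ = ∑ j, ∑ k, x j * (a i j * a i k * y k) := by
    intro i
    simp only [PiLp.inner_apply, RCLike.inner_apply, conj_trivial, Finset.sum_mul_sum]
    exact Finset.sum_congr rfl fun j _ => Finset.sum_congr rfl fun k _ => by ring
  simp_rw [e]
  rw [bil_eq_sum]
  symm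
  rw [Finset.sum_comm]
  refine Finset.sum_congr rfl fun j _ => ?_
  rw [Finset.sum_comm]
  refine Finset.sum_congr rfl fun k _ => ?_
  simp [gram, Finset.mul_sum, Finset.sum_mul]

lemma posSemidef_of_bil (hs : S.IsHermitian) (h : ∀ x : Vec p, 0 ≤ bil S x x) :
    S.PosSemidef := by
  refine Matrix.PosSemidef.of_dotProduct_mulVec_nonneg hs fun x => ?_
  simpa [bil] using h (WithLp.toLp 2 x)

lemma posSemidef_gram {n : ℕ} (a : Fin n → Vec p) : (gram a).PosSemidef := by
  refine posSemidef_of_bil ?_ fun x => ?_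
  · ext j k
    simp [gram, mul_comm]
  · rw [bil_gram]
    exact Finset.sum_nonneg fun i _ => mul_self_nonneg _

lemma bil_smul (c : ℝ) (x y : Vec p) : bil (c • S) x y = c * bil S x y := by
  simp [bil, Matrix.smul_mulVec]

lemma bil_sub (x y : Vec p) : bil (S - T) x y = bil S x y - bil T x y := by
  simp [bil, Matrix.sub_mulVec]

end Gauss

/-! ### Laws of the normalized Gaussian sum and of the bootstrap sum -/

section Laws

variable {Ω : Type*} [MeasurableSpace Ω] {Ω' : Type*} [MeasurableSpace Ω'] {n p : ℕ}

lemma map_sum_smul_gaussian (a : Fin n → Vec p) :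
    (Measure.pi fun _ : Fin n => gaussianReal 0 1).map (fun t => ∑ i, t i • a i)
      = gauss (gram a) := by
  apply Measure.ext_of_charFun
  ext t
  rw [charFun_gauss (posSemidef_gram a), charFun_apply,
    integral_map (Measurable.aemeasurable (by fun_prop)) (by fun_prop)]
  simp_rw [sum_inner, Complex.ofReal_sum, Finset.sum_mul, Complex.exp_sum]
  rw [integral_fintype_prod_eq_prod
    (f := fun i x => Complex.exp ((⟪x • a i, t⟫ : ℝ) * Complex.I))]
  simp_rw [real_inner_smul_left, mul_comm _ (⟪_, _⟫), Complex.ofReal_mul, ← charFun_apply_real,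
    charFun_gaussianReal]
  rw [← Complex.exp_sum, bil_gram]
  congr 1
  push_cast
  rw [← Finset.sum_neg_distrib, Finset.sum_div]
  refine Finset.sum_congr rfl fun i _ => ?_
  simp
  ring

lemma secondMoment_bil {μ : Measure Ω} {ξ : Ω → Vec p}
    (h : ∀ j, MemLp (fun ω => ξ ω j) 2 μ) (x y : Vec p) :
    bil (secondMoment ξ μ) x y = ∫ ω, ⟪x, ξ ω⟫ * ⟪y, ξ ω⟫ ∂μ := by
  rw [bil_eq_sum]
  have hi : ∀ j k, Integrable (fun ω => ξ ω j * ξ ω k) μ := fun j k =>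
    (h j).integrable_mul (h k)
  have e : ∀ ω, ⟪x, ξ ω⟫ * ⟪y, ξ ω⟫ = ∑ j, ∑ k, x j * y k * (ξ ω j * ξ ω k) := by
    intro ω
    simp only [PiLp.inner_apply, RCLike.inner_apply, conj_trivial, Finset.sum_mul_sum]
    exact Finset.sum_congr rfl fun i _ => Finset.sum_congr rfl fun k _ => by ring
  simp_rw [e]
  rw [integral_finsetSum _ fun j _ => integrable_finsetSum _ fun k _ => (hi j k).const_mul _]
  refine Finset.sum_congr rfl fun j _ => ?_
  rw [integral_finsetSum _ fun k _ => (hi j k).const_mul _]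
  refine Finset.sum_congr rfl fun k _ => ?_
  rw [integral_const_mul]
  simp [secondMoment]
  ring

lemma posSemidef_secondMoment {μ : Measure Ω} {ξ : Ω → Vec p}
    (h : ∀ j, MemLp (fun ω => ξ ω j) 2 μ) : (secondMoment ξ μ).PosSemidef := by
  refine posSemidef_of_bil ?_ fun x => ?_
  · ext j k
    simp [secondMoment, mul_comm]
  · rw [secondMoment_bil h]
    exact integral_nonneg fun ω => mul_self_nonneg _

/-- The averaged covariance matrix `n⁻¹ ∑ E[X_i X_i']`. -/
noncomputable def avgCov (X : Fin n → Ω → Vec p) (μ : Measure Ω) : Matrix (Fin p) (Fin p) ℝ :=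
  ((n : ℝ))⁻¹ • ∑ i, secondMoment (X i) μ

lemma bil_finsetSum {ι : Type*} (s : Finset ι) (S : ι → Matrix (Fin p) (Fin p) ℝ) (x y : Vec p) :
    bil (∑ i ∈ s, S i) x y = ∑ i ∈ s, bil (S i) x y := by
  simp [bil, Matrix.sum_mulVec, dotProduct_sum]

lemma posSemidef_avgCov {μ : Measure Ω} {X : Fin n → Ω → Vec p}
    (h : ∀ i j, MemLp (fun ω => X i ω j) 2 μ) : (avgCov X μ).PosSemidef :=
  (Matrix.posSemidef_sum _ fun i _ => posSemidef_secondMoment (h i)).smul (by positivity)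

lemma map_normalizedSum {μ : Measure Ω} {ν : Measure Ω'} [IsProbabilityMeasure ν]
    {X : Fin n → Ω → Vec p} {Y : Fin n → Ω' → Vec p}
    (h : ∀ i j, MemLp (fun ω => X i ω j) 2 μ) (hY : IsGaussianAnalogue X μ Y ν) :
    ν.map (normalizedSum Y) = gauss (avgCov X μ) := by
  have hm : ∀ i, AEMeasurable (Y i) ν := fun i => (hY.law i).aemeasurable
  have hs : AEMeasurable (fun ω => ∑ i, Y i ω) ν := by fun_prop
  have e : ν.map (normalizedSum Y) =
      (ν.map (fun ω => ∑ i, Y i ω)).map (fun x => (Real.sqrt (n : ℝ))⁻¹ • x) := by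
    rw [AEMeasurable.map_map_of_aemeasurable (by fun_prop) hs]
    rfl
  rw [e]
  have e2 : ν.map (fun ω => ∑ i, Y i ω) = gauss (∑ i, secondMoment (X i) μ) := by
    apply Measure.ext_of_charFun
    rw [hY.indep.charFun_map_fun_sum_eq_prod hm]
    ext t
    rw [charFun_gauss (Matrix.posSemidef_sum _ fun i _ => posSemidef_secondMoment (h i)),
      Finset.prod_apply]
    simp_rw [(hY.law _).map_eq]
    rw [Finset.prod_congr rfl fun i _ => charFun_gauss (posSemidef_secondMoment (h i)) t,
      ← Complex.exp_sum, bil_finsetSum]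
    congr 1
    push_cast
    rw [← Finset.sum_neg_distrib, Finset.sum_div]
  rw [e2, gauss_map_smul (Matrix.posSemidef_sum _ fun i _ => posSemidef_secondMoment (h i)),
    avgCov, inv_pow, Real.sq_sqrt (by positivity)]

/-- The empirical covariance matrix of the sample `x`. -/
noncomputable def sampleCov (x : Fin n → Vec p) : Matrix (Fin p) (Fin p) ℝ :=
  gram fun i => (Real.sqrt (n : ℝ))⁻¹ • (x i - ((n : ℝ))⁻¹ • ∑ k, x k)

/-- Freezing the sample and integrating out the multipliers defines an explicit kernel `κ` with
Gaussian values. Independence factors the joint law of sample and bootstrap sum through `κ`, and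
almost everywhere uniqueness of regular conditional distributions identifies the two. -/
lemma condDistrib_bootstrapSum {μ : Measure Ω} [IsProbabilityMeasure μ]
    {X : Fin n → Ω → Vec p} {e : Fin n → Ω → ℝ} (hX : ∀ i, Measurable (X i))
    (he : IsMultiplier e X μ) :
    ∀ᵐ ω ∂μ, condDistrib (bootstrapSum e X) (fun ω i => X i ω) μ (fun i => X i ω)
      = gauss (sampleCov fun i => X i ω) := by
  have hXm : Measurable (fun ω i => X i ω) := measurable_pi_lambda _ hX
  have hem : Measurable (fun ω i => e i ω) := measurable_pi_lambda _ he.measurable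
  let f : (Fin n → Vec p) × (Fin n → ℝ) → Vec p := fun z =>
    ∑ i, z.2 i • ((Real.sqrt (n : ℝ))⁻¹ • (z.1 i - ((n : ℝ))⁻¹ • ∑ k, z.1 k))
  have hf : Measurable f := by fun_prop
  have hb : bootstrapSum e X = fun ω => f (fun i => X i ω, fun i => e i ω) := by
    ext1 ω
    simp only [bootstrapSum, f, sampleMean, Finset.smul_sum]
    exact Finset.sum_congr rfl fun i _ => smul_comm _ _ _
  have hbm : Measurable (bootstrapSum e X) := by
    rw [hb]; exact hf.comp (hXm.prodMk hem)
  let γ : Measure (Fin n → ℝ) := Measure.pi fun _ : Fin n => gaussianReal 0 1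
  have hlaw : μ.map (fun ω i => e i ω) = γ := by
    rw [(iIndepFun_iff_map_fun_eq_pi_map (fun i => (he.measurable i).aemeasurable)).1 he.indep]
    simp_rw [(he.law _).map_eq]
    rfl
  let κ : Kernel (Fin n → Vec p) (Vec p) :=
    (Kernel.id ×ₖ Kernel.const _ γ).map f
  have hκ : ∀ x, κ x = gauss (sampleCov x) := by
    intro x
    rw [Kernel.map_apply _ hf, Kernel.prod_apply, Kernel.id_apply, Kernel.const_apply,
      Measure.dirac_prod, Measure.map_map hf (by fun_prop)]
    exact map_sum_smul_gaussian (fun i => (Real.sqrt (n : ℝ))⁻¹ • (x i - ((n : ℝ))⁻¹ • ∑ k, x k))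
  have key : μ.map (fun ω => ((fun i => X i ω), bootstrapSum e X ω))
      = μ.map (fun ω i => X i ω) ⊗ₘ κ := by
    have h1 : μ.map (fun ω => ((fun i => X i ω), (fun i => e i ω)))
        = (μ.map (fun ω i => X i ω)).prod γ := by
      rw [← hlaw]
      exact (indepFun_iff_map_prod_eq_prod_map_map hXm.aemeasurable hem.aemeasurable).1
        he.indep_sample.symm
    have h2 : (fun ω => ((fun i => X i ω), bootstrapSum e X ω))
        = (fun z => (z.1, f z)) ∘ fun ω => ((fun i => X i ω), (fun i => e i ω)) := by
      rw [hb]; rfl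
    rw [h2, ← Measure.map_map (by fun_prop) (hXm.prodMk hem), h1]
    ext s hs
    rw [Measure.map_apply (by fun_prop) hs, Measure.prod_apply (by measurability),
      Measure.compProd_apply hs]
    refine lintegral_congr fun x => ?_
    rw [hκ, ← hκ, Kernel.map_apply' _ hf _ (by measurability), Kernel.prod_apply,
      Kernel.id_apply, Kernel.const_apply, Measure.dirac_prod,
      Measure.map_apply (by fun_prop) (hf (measurable_prodMk_left hs))]
    rfl
  have h := condDistrib_ae_eq_of_measure_eq_compProd (fun ω i => X i ω) hbm.aemeasurable key
  filter_upwards [ae_of_ae_map hXm.aemeasurable h] with ω hω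
  rw [hω, hκ]

end Laws

/-! ### Nazarov's inequality -/

lemma gaussianPDFReal_std (x : ℝ) :
    gaussianPDFReal 0 1 x = (Real.sqrt (2 * Real.pi))⁻¹ * Real.exp (-(x ^ 2 / 2)) := by
  simp [gaussianPDFReal, neg_div]

lemma gaussianReal_real_apply (s : Set ℝ) :
    (gaussianReal 0 1).real s = ∫ x in s, gaussianPDFReal 0 1 x := by
  rw [measureReal_def, gaussianReal_apply_eq_integral 0 one_ne_zero,
    ENNReal.toReal_ofReal (integral_nonneg fun x => gaussianPDFReal_nonneg _ _ _)]

/-- A hazard rate bound. If `x ≤ T`, the density loses at most a factor `exp (3/2)` on `[x, x +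
T⁻¹]`, an interval contained in `s`, so the mass of `s` controls the density at `x`. If `x > T`, the
density itself is below `exp (-T²/2)`. -/
lemma gaussianPDFReal_le_of_upper {s : Set ℝ} (hs : IsUpperSet s) {T : ℝ} (hT : 1 ≤ T)
    {x : ℝ} (hx : x ∈ s) :
    gaussianPDFReal 0 1 x ≤
      Real.exp (3 / 2) * T * (gaussianReal 0 1).real s + Real.exp (-(T ^ 2 / 2)) := by
  have hT0 : 0 < T := by linarith
  rcases le_or_gt x T with hxT | hxT
  · have h1 : Real.exp (-(3 / 2)) * gaussianPDFReal 0 1 x * T⁻¹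
        ≤ (gaussianReal 0 1).real s := by
      calc Real.exp (-(3 / 2)) * gaussianPDFReal 0 1 x * T⁻¹
          = ∫ y in Set.Icc x (x + T⁻¹), Real.exp (-(3 / 2)) * gaussianPDFReal 0 1 x := by
            simp [hT0.le, mul_comm]
        _ ≤ ∫ y in Set.Icc x (x + T⁻¹), gaussianPDFReal 0 1 y := by
            refine setIntegral_mono_on (integrableOn_const (by simp)) (integrable_gaussianPDFReal 0 1).integrableOn
              measurableSet_Icc fun y hy => ?_
            rw [gaussianPDFReal_std, gaussianPDFReal_std, mul_left_comm, ← Real.exp_add]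
            refine mul_le_mul_of_nonneg_left (Real.exp_le_exp.2 ?_) (by positivity)
            obtain ⟨hy1, hy2⟩ := hy
            have hi : T⁻¹ ≤ 1 := inv_le_one_of_one_le₀ hT
            have ht : 0 ≤ y - x := by linarith
            have ht1 : y - x ≤ T⁻¹ := by linarith
            have hxt : x * (y - x) ≤ 1 := by
              calc x * (y - x) ≤ T * (y - x) := mul_le_mul_of_nonneg_right hxT ht
                _ ≤ T * T⁻¹ := mul_le_mul_of_nonneg_left ht1 hT0.le
                _ = 1 := mul_inv_cancel₀ hT0.ne'
            nlinarith
        _ = (gaussianReal 0 1).real (Set.Icc x (x + T⁻¹)) := (gaussianReal_real_apply _).symm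
        _ ≤ (gaussianReal 0 1).real s := by
            refine measureReal_mono fun y hy => hs hy.1 hx
    have h2 : gaussianPDFReal 0 1 x = Real.exp (3 / 2) * T *
        (Real.exp (-(3 / 2)) * gaussianPDFReal 0 1 x * T⁻¹) := by
      rw [Real.exp_neg]
      field_simp
    rw [h2]
    have := mul_le_mul_of_nonneg_left h1 (show 0 ≤ Real.exp (3 / 2) * T by positivity)
    linarith [Real.exp_pos (-(T ^ 2 / 2))]
  · rw [gaussianPDFReal_std]
    have h1 : (Real.sqrt (2 * Real.pi))⁻¹ ≤ 1 := by
      refine inv_le_one_of_one_le₀ (Real.one_le_sqrt.2 ?_)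
      linarith [Real.pi_gt_three]
    have h2 : Real.exp (-(x ^ 2 / 2)) ≤ Real.exp (-(T ^ 2 / 2)) := by
      refine Real.exp_le_exp.2 ?_
      nlinarith
    have h3 : 0 ≤ Real.exp (3 / 2) * T * (gaussianReal 0 1).real s := by positivity
    have := mul_le_mul h1 h2 (Real.exp_pos _).le zero_le_one
    linarith

lemma gaussianReal_upper_inter_Ioc_le {s : Set ℝ} (hs : IsUpperSet s) (hm : MeasurableSet s)
    {T : ℝ} (hT : 1 ≤ T) (c : ℝ) {ε : ℝ} (hε : 0 ≤ ε) :
    gaussianReal 0 1 (s ∩ Set.Ioc c (c + ε)) ≤ ENNReal.ofReal ε *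
      (ENNReal.ofReal (Real.exp (3 / 2) * T) * gaussianReal 0 1 s
        + ENNReal.ofReal (Real.exp (-(T ^ 2 / 2)))) := by
  set K := Real.exp (3 / 2) * T * (gaussianReal 0 1).real s + Real.exp (-(T ^ 2 / 2)) with hK
  have hK0 : 0 ≤ K := by positivity
  have e : ENNReal.ofReal (Real.exp (3 / 2) * T) * gaussianReal 0 1 s
        + ENNReal.ofReal (Real.exp (-(T ^ 2 / 2))) = ENNReal.ofReal K := by
    rw [hK, ENNReal.ofReal_add (by positivity) (by positivity),
      ENNReal.ofReal_mul (p := Real.exp (3 / 2) * T) (by positivity),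
      ofReal_measureReal (measure_ne_top _ _)]
  rw [e, ← ENNReal.ofReal_mul hε, ← ofReal_measureReal (measure_ne_top _ _)]
  refine ENNReal.ofReal_le_ofReal ?_
  rw [gaussianReal_real_apply]
  calc ∫ x in s ∩ Set.Ioc c (c + ε), gaussianPDFReal 0 1 x
      ≤ ∫ x in s ∩ Set.Ioc c (c + ε), K := by
        refine setIntegral_mono_on (integrable_gaussianPDFReal 0 1).integrableOn ?_
          (hm.inter measurableSet_Ioc) fun x hx => gaussianPDFReal_le_of_upper hs hT hx.1
        refine integrableOn_const ?_
        exact ((measure_mono Set.inter_subset_right).trans_lt (by simp)).ne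
    _ = volume.real (s ∩ Set.Ioc c (c + ε)) * K := by simp
    _ ≤ ε * K := by
        refine mul_le_mul_of_nonneg_right ?_ hK0
        calc volume.real (s ∩ Set.Ioc c (c + ε)) ≤ volume.real (Set.Ioc c (c + ε)) :=
              measureReal_mono Set.inter_subset_right (by simp)
          _ = ε := by simp [hε]

/-! ### Splitting off one direction and integrating over strips -/

section

variable {p : ℕ} {S : Matrix (Fin p) (Fin p) ℝ}

lemma bil_comm (hS : S.PosSemidef) (x y : Vec p) : bil S x y = bil S y x := by
  rw [← integral_inner_mul_inner_gauss hS, ← integral_inner_mul_inner_gauss hS]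
  simp_rw [mul_comm]

lemma bil_sub_left (x y z : Vec p) : bil S (x - y) z = bil S x z - bil S y z := by
  simp [bil]

lemma bil_sub_right (x y z : Vec p) : bil S z (x - y) = bil S z x - bil S z y := by
  simp [bil, Matrix.mulVec_sub]

lemma bil_smul_left (c : ℝ) (x y : Vec p) : bil S (c • x) y = c * bil S x y := by
  simp [bil]

lemma bil_smul_right (c : ℝ) (x y : Vec p) : bil S x (c • y) = c * bil S x y := by
  simp [bil, Matrix.mulVec_smul]

/-- Cauchy–Schwarz for the form of `S`, from its nonnegativity at the residual of `x` after
projection on `w`. -/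
lemma sq_bil_le (hS : S.PosSemidef) {w : Vec p} (hw : bil S w w = 1) (x : Vec p) :
    bil S x w ^ 2 ≤ bil S x x := by
  have h := bil_nonneg hS (x - bil S x w • w)
  simp only [bil_sub_left, bil_sub_right, bil_smul_left, bil_smul_right, hw, bil_comm hS w x] at h
  nlinarith

/-- The vector `S w`. -/
def dirVec (S : Matrix (Fin p) (Fin p) ℝ) (w : Vec p) : Vec p := WithLp.toLp 2 (S *ᵥ w.ofLp)

lemma inner_dirVec (x w : Vec p) : ⟪x, dirVec S w⟫ = bil S x w := by
  simp [dirVec, bil, PiLp.inner_apply, dotProduct, mul_comm]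

/-- Splitting off the component of a Gaussian vector in a direction of unit variance. -/
lemma gauss_eq_conv (hS : S.PosSemidef) {w : Vec p} (hw : bil S w w = 1) :
    ∃ ρ : Measure (Vec p), IsProbabilityMeasure ρ ∧
      gauss S = Measure.conv ρ ((gaussianReal 0 1).map fun t => t • dirVec S w) := by
  -- Subtracting the rank one matrix `(S w)(S w)'` from `S` leaves a positive semidefinite matrix by
  -- Cauchy–Schwarz; it is the covariance of the independent remainder.
  let k : Fin 1 → Vec p := fun _ => dirVec S w
  have hk : ∀ x y, bil (gram k) x y = bil S x w * bil S y w := fun x y => by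
    rw [bil_gram]
    simp [k, real_inner_comm, ← inner_dirVec]
  have hR : (S - gram k).PosSemidef := by
    refine posSemidef_of_bil (hS.isHermitian.sub (posSemidef_gram k).isHermitian) fun x => ?_
    rw [bil_sub, hk]
    nlinarith [sq_bil_le hS hw x]
  refine ⟨gauss (S - gram k), inferInstance, ?_⟩
  have h2 : ((gaussianReal 0 1).map fun t => t • dirVec S w) = gauss (gram k) := by
    apply Measure.ext_of_charFun
    ext t
    rw [charFun_gauss (posSemidef_gram k), charFun_apply,
      integral_map (by fun_prop) (by fun_prop), hk]
    simp_rw [real_inner_smul_left, mul_comm _ (⟪_, _⟫), Complex.ofReal_mul, ← charFun_apply_real,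
      charFun_gaussianReal, real_inner_comm t, inner_dirVec]
    congr 1
    push_cast
    simp
    ring
  rw [h2, gauss_conv hR (posSemidef_gram k), sub_add_cancel]

/-- On each line in direction `S w` the set `D` is an upper set by `hup`, and the strip is an
interval of length `ε` because `⟪w, S w⟫ = 1`. The one-dimensional bound is then integrated over the
lines. -/
lemma gauss_inter_strip_le (hS : S.PosSemidef) {w : Vec p} (hw : bil S w w = 1)
    {D : Set (Vec p)} (hD : MeasurableSet D)
    (hup : ∀ x ∈ D, ∀ t : ℝ, 0 ≤ t → x + t • dirVec S w ∈ D)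
    {T : ℝ} (hT : 1 ≤ T) (c : ℝ) {ε : ℝ} (hε : 0 ≤ ε) :
    gauss S (D ∩ {x | c < ⟪w, x⟫ ∧ ⟪w, x⟫ ≤ c + ε}) ≤ ENNReal.ofReal ε *
      (ENNReal.ofReal (Real.exp (3 / 2) * T) * gauss S D
        + ENNReal.ofReal (Real.exp (-(T ^ 2 / 2)))) := by
  obtain ⟨ρ, hρ, h⟩ := gauss_eq_conv hS hw
  have hk : Measurable fun t : ℝ => t • dirVec S w := by fun_prop
  have happ : ∀ B : Set (Vec p), MeasurableSet B →
      gauss S B = ∫⁻ r, gaussianReal 0 1 ((fun t => r + t • dirVec S w) ⁻¹' B) ∂ρ := by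
    intro B hB
    rw [h, Measure.conv, Measure.map_apply (by fun_prop) hB,
      Measure.prod_apply (measurable_add hB)]
    refine lintegral_congr fun r => ?_
    rw [Measure.map_apply hk (measurable_prodMk_left (measurable_add hB))]
    rfl
  have hstrip : MeasurableSet {x : Vec p | c < ⟪w, x⟫ ∧ ⟪w, x⟫ ≤ c + ε} :=
    (measurableSet_lt (f := fun _ => c) (g := fun x : Vec p => (⟪w, x⟫ : ℝ)) (by fun_prop)
      (by fun_prop)).inter (measurableSet_le (f := fun x : Vec p => (⟪w, x⟫ : ℝ))
      (g := fun _ => c + ε) (by fun_prop) (by fun_prop))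
  have hwk : ⟪w, dirVec S w⟫ = 1 := by rw [inner_dirVec, hw]
  have hDm : Measurable fun r => gaussianReal 0 1 ((fun t => r + t • dirVec S w) ⁻¹' D) := by
    have : Measurable fun z : Vec p × ℝ => z.1 + z.2 • dirVec S w := by fun_prop
    exact measurable_measure_prodMk_left (this hD)
  rw [happ _ (hD.inter hstrip), happ D hD, ← lintegral_const_mul _ hDm]
  calc _ ≤ ∫⁻ r, ENNReal.ofReal ε * (ENNReal.ofReal (Real.exp (3 / 2) * T) *
          gaussianReal 0 1 ((fun t => r + t • dirVec S w) ⁻¹' D)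
          + ENNReal.ofReal (Real.exp (-(T ^ 2 / 2)))) ∂ρ := by
        refine lintegral_mono fun r => ?_
        refine le_trans (measure_mono ?_) (gaussianReal_upper_inter_Ioc_le
          (s := (fun t => r + t • dirVec S w) ⁻¹' D) ?_ ?_ hT (c - ⟪w, r⟫) hε)
        · rintro t ⟨h1, h2, h3⟩
          simp only [inner_add_right, real_inner_smul_right, hwk] at h2 h3
          exact ⟨h1, by linarith, by linarith⟩
        · intro t t' htt ht
          have := hup _ ht (t' - t) (by linarith)
          simp only [Set.mem_preimage]
          convert this using 1
          rw [add_assoc, ← add_smul]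
          congr 2
          ring
        · have : Measurable fun t : ℝ => r + t • dirVec S w := by fun_prop
          exact this hD
    _ = _ := by
        rw [lintegral_const_mul _ (by fun_prop), lintegral_add_right _ measurable_const]
        simp

/-- Nazarov's inequality for unit variances. -/
lemma nazarov_unit (hS : S.PosSemidef) {m : ℕ} (w : Fin m → Vec p) (c : Fin m → ℝ)
    (hw : ∀ j, bil S (w j) (w j) = 1) {L : ℝ} (hL : 1 ≤ L) (hm : (m : ℝ) ≤ Real.exp L)
    {ε : ℝ} (hε : 0 ≤ ε) :
    (gauss S).real {x | ∀ j, ⟪w j, x⟫ ≤ c j + ε} ≤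
      (gauss S).real {x | ∀ j, ⟪w j, x⟫ ≤ c j} + 8 * ε * Real.sqrt L := by
  -- `D j` is where constraint `j` has the largest excess, ties going to the smallest index. These
  -- sets are disjoint, so their masses sum to at most 1; this avoids a factor `m` in the main term.
  let D : Fin m → Set (Vec p) := fun j => {x | (∀ i, ⟪w i, x⟫ - c i ≤ ⟪w j, x⟫ - c j) ∧
    ∀ i, i < j → ⟪w i, x⟫ - c i < ⟪w j, x⟫ - c j}
  have hDm : ∀ j, MeasurableSet (D j) := fun j => by
    refine MeasurableSet.inter ?_ ?_
    · change MeasurableSet {x : Vec p | ∀ i, ⟪w i, x⟫ - c i ≤ ⟪w j, x⟫ - c j}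
      rw [Set.ofPred_forall]
      exact MeasurableSet.iInter fun i => measurableSet_le (by fun_prop) (by fun_prop)
    · change MeasurableSet {x : Vec p | ∀ i, i < j → ⟪w i, x⟫ - c i < ⟪w j, x⟫ - c j}
      rw [Set.ofPred_forall]
      refine MeasurableSet.iInter fun i => ?_
      rw [Set.ofPred_forall]
      exact MeasurableSet.iInter fun _ => measurableSet_lt (by fun_prop) (by fun_prop)
  have hDd : Pairwise fun i j => Disjoint (D i) (D j) := by
    intro i j hij
    rw [Set.disjoint_left]
    rintro x ⟨h1, h2⟩ ⟨h3, h4⟩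
    rcases lt_or_gt_of_ne hij with h | h
    · exact absurd (h4 i h) (not_lt.2 (h1 j))
    · exact absurd (h2 j h) (not_lt.2 (h3 i))
  have hDsum : ∑ j, gauss S (D j) ≤ 1 := by
    have := sum_measure_le_measure_univ (μ := gauss S) (s := Finset.univ) (t := D)
      (fun j _ => (hDm j).nullMeasurableSet) (fun i _ j _ hij => (hDd hij).aedisjoint)
    simpa using this
  -- With this `T` the tail terms add up to `m * exp (-L) ≤ 1`.
  set T := Real.sqrt (2 * L) with hT
  have hT1 : 1 ≤ T := Real.one_le_sqrt.2 (by linarith)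
  have hTsq : T ^ 2 = 2 * L := Real.sq_sqrt (by linarith)
  let strip : Fin m → Set (Vec p) := fun j => {x | c j < ⟪w j, x⟫ ∧ ⟪w j, x⟫ ≤ c j + ε}
  have hcover : {x | ∀ j, ⟪w j, x⟫ ≤ c j + ε} ⊆
      {x | ∀ j, ⟪w j, x⟫ ≤ c j} ∪ ⋃ j, D j ∩ strip j := by
    intro x hx
    by_cases h : ∀ j, ⟪w j, x⟫ ≤ c j
    · exact Or.inl h
    right
    push Not at h
    obtain ⟨j0, hj0⟩ := h
    let A := Finset.univ.filter fun j => ∀ i, ⟪w i, x⟫ - c i ≤ ⟪w j, x⟫ - c j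
    have hA : A.Nonempty := by
      obtain ⟨j, -, hj⟩ := Finset.exists_max_image Finset.univ (fun j => ⟪w j, x⟫ - c j)
        ⟨j0, Finset.mem_univ _⟩
      exact ⟨j, by simpa [A] using hj⟩
    have hj := A.min'_mem hA
    set j := A.min' hA with hjd
    have hj1 : ∀ i, ⟪w i, x⟫ - c i ≤ ⟪w j, x⟫ - c j := by
      simpa only [A, Finset.mem_filter, Finset.mem_univ, true_and] using hj
    refine Set.mem_iUnion.2 ⟨j, ⟨hj1, fun i hi => ?_⟩, ?_, hx j⟩
    · by_contra hcon
      push Not at hcon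
      have : i ∈ A := by
        simp only [A, Finset.mem_filter, Finset.mem_univ, true_and]
        exact fun k => (hj1 k).trans hcon
      exact absurd (A.min'_le i this) (not_le.2 hi)
    · linarith [hj1 j0]
  have hbound : ∀ j, gauss S (D j ∩ strip j) ≤ ENNReal.ofReal ε *
      (ENNReal.ofReal (Real.exp (3 / 2) * T) * gauss S (D j)
        + ENNReal.ofReal (Real.exp (-(T ^ 2 / 2)))) := by
    intro j
    refine gauss_inter_strip_le hS (hw j) (hDm j) ?_ hT1 (c j) hε
    rintro x ⟨h1, h2⟩ t ht
    -- Moving along `S (w j)` raises the `j`-th form at least as fast as any other, covariances of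
    -- unit variance forms being at most 1. Hence `D j` is stable under the move.
    have hb : ∀ i, t * bil S (w i) (w j) ≤ t * bil S (w j) (w j) := by
      intro i
      refine mul_le_mul_of_nonneg_left ?_ ht
      have := sq_bil_le hS (hw j) (w i)
      rw [hw i] at this
      rw [hw j]
      nlinarith
    refine ⟨fun i => ?_, fun i hi => ?_⟩
    · simp only [inner_add_right, real_inner_smul_right, inner_dirVec]
      linarith [h1 i, hb i]
    · simp only [inner_add_right, real_inner_smul_right, inner_dirVec]
      linarith [h2 i hi, hb i]
  have hfin : gauss S {x | ∀ j, ⟪w j, x⟫ ≤ c j + ε} ≤ gauss S {x | ∀ j, ⟪w j, x⟫ ≤ c j}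
      + ENNReal.ofReal (8 * ε * Real.sqrt L) := by
    calc gauss S {x | ∀ j, ⟪w j, x⟫ ≤ c j + ε}
        ≤ gauss S {x | ∀ j, ⟪w j, x⟫ ≤ c j} + ∑ j, gauss S (D j ∩ strip j) := by
          refine (measure_mono hcover).trans ((measure_union_le _ _).trans ?_)
          gcongr
          exact measure_iUnion_fintype_le _ _
      _ ≤ _ := by
          gcongr
          calc ∑ j, gauss S (D j ∩ strip j) ≤ ∑ j, ENNReal.ofReal ε *
                (ENNReal.ofReal (Real.exp (3 / 2) * T) * gauss S (D j)
                + ENNReal.ofReal (Real.exp (-(T ^ 2 / 2)))) := Finset.sum_le_sum fun j _ => hbound j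
            _ = ENNReal.ofReal ε * (ENNReal.ofReal (Real.exp (3 / 2) * T) * ∑ j, gauss S (D j)
                + m * ENNReal.ofReal (Real.exp (-(T ^ 2 / 2)))) := by
                rw [← Finset.mul_sum, Finset.sum_add_distrib, ← Finset.mul_sum]
                simp
            _ ≤ ENNReal.ofReal ε * (ENNReal.ofReal (Real.exp (3 / 2) * T) * 1
                + m * ENNReal.ofReal (Real.exp (-(T ^ 2 / 2)))) := by gcongr
            _ = ENNReal.ofReal (ε * (Real.exp (3 / 2) * T + m * Real.exp (-(T ^ 2 / 2)))) := by
                rw [ENNReal.ofReal_mul hε, ENNReal.ofReal_add (by positivity) (by positivity),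
                  ENNReal.ofReal_mul (p := (m : ℝ)) (by positivity), ENNReal.ofReal_natCast,
                  mul_one]
            _ ≤ _ := by
                refine ENNReal.ofReal_le_ofReal ?_
                have h1 : (m : ℝ) * Real.exp (-(T ^ 2 / 2)) ≤ 1 := by
                  rw [hTsq, mul_div_cancel_left₀ _ two_ne_zero]
                  calc (m : ℝ) * Real.exp (-L) ≤ Real.exp L * Real.exp (-L) := by gcongr
                    _ = 1 := by rw [← Real.exp_add]; simp
                have h2 : Real.exp (3 / 2) ≤ 4.5 := by
                  have : Real.exp (3 / 2) ^ 2 = Real.exp 1 ^ 3 := by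
                    rw [← Real.exp_nat_mul, ← Real.exp_nat_mul]; norm_num
                  have h3 : Real.exp 1 ^ 3 ≤ 2.7182818286 ^ 3 := by
                    gcongr
                    exact Real.exp_one_lt_d9.le
                  refine le_of_sq_le_sq ?_ (by norm_num)
                  rw [this]
                  refine h3.trans (by norm_num)
                have h4 : T = Real.sqrt 2 * Real.sqrt L := by
                  rw [hT, Real.sqrt_mul (by norm_num)]
                have h5 : Real.sqrt 2 ≤ 1.5 := by
                  rw [Real.sqrt_le_left (by norm_num)]; norm_num
                have h6 : 1 ≤ Real.sqrt L := Real.one_le_sqrt.2 hL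
                have h7 : Real.exp (3 / 2) * T ≤ 4.5 * (1.5 * Real.sqrt L) := by
                  rw [h4]; gcongr
                have h8 : Real.exp (3 / 2) * T + m * Real.exp (-(T ^ 2 / 2))
                    ≤ 8 * Real.sqrt L := by linarith
                calc _ ≤ ε * (8 * Real.sqrt L) := by gcongr
                  _ = _ := by ring
  have := ENNReal.toReal_mono (by finiteness) hfin
  rw [ENNReal.toReal_add (by finiteness) (by finiteness),
    ENNReal.toReal_ofReal (by positivity)] at this
  exact this

/-- Nazarov's inequality. -/
lemma nazarov (hS : S.PosSemidef) (V : Finset (Vec p)) (c : Vec p → ℝ) {b : ℝ} (hb : 0 < b)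
    (hV : ∀ v ∈ V, b ≤ bil S v v) {L : ℝ} (hL : 1 ≤ L) (hm : (V.card : ℝ) ≤ Real.exp L)
    {ε : ℝ} (hε : 0 ≤ ε) :
    (gauss S).real {x | ∀ v ∈ V, ⟪v, x⟫ ≤ c v + ε} ≤
      (gauss S).real {x | ∀ v ∈ V, ⟪v, x⟫ ≤ c v} + 8 * ε * Real.sqrt L / Real.sqrt b := by
  let v : Fin V.card → Vec p := fun j => (V.equivFin.symm j : Vec p)
  have hv : ∀ j, v j ∈ V := fun j => (V.equivFin.symm j).2
  have hσ : ∀ j, 0 < Real.sqrt (bil S (v j) (v j)) := fun j =>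
    Real.sqrt_pos.2 (hb.trans_le (hV _ (hv j)))
  let σ : Fin V.card → ℝ := fun j => Real.sqrt (bil S (v j) (v j))
  have hall : ∀ P : Vec p → Prop, (∀ u ∈ V, P u) ↔ ∀ j, P (v j) := by
    intro P
    refine ⟨fun h j => h _ (hv j), fun h u hu => ?_⟩
    have := h (V.equivFin ⟨u, hu⟩)
    simpa [v] using this
  have h := nazarov_unit hS (fun j => (σ j)⁻¹ • v j) (fun j => (σ j)⁻¹ * c (v j))
    (fun j => by
      rw [bil_smul_left, bil_smul_right, ← mul_assoc, ← mul_inv, Real.mul_self_sqrt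
        (hb.trans_le (hV _ (hv j))).le, inv_mul_cancel₀ (hb.trans_le (hV _ (hv j))).ne'])
    hL hm (ε := ε / Real.sqrt b) (by positivity)
  have e2 : {x : Vec p | ∀ j, ⟪(σ j)⁻¹ • v j, x⟫ ≤ (σ j)⁻¹ * c (v j)}
      = {x | ∀ v ∈ V, ⟪v, x⟫ ≤ c v} := by
    ext x
    simp only [Set.mem_ofPred_eq]
    rw [hall]
    refine forall_congr' fun j => ?_
    rw [real_inner_smul_left]
    exact mul_le_mul_iff_right₀ (inv_pos.2 (hσ j))
  have e1 : {x : Vec p | ∀ v ∈ V, ⟪v, x⟫ ≤ c v + ε} ⊆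
      {x | ∀ j, ⟪(σ j)⁻¹ • v j, x⟫ ≤ (σ j)⁻¹ * c (v j) + ε / Real.sqrt b} := by
    intro x hx j
    have h1 := hx _ (hv j)
    rw [real_inner_smul_left]
    have h2 : (σ j)⁻¹ * ε ≤ ε / Real.sqrt b := by
      rw [div_eq_inv_mul]
      gcongr
      exact Real.sqrt_le_sqrt (hV _ (hv j))
    calc (σ j)⁻¹ * ⟪v j, x⟫ ≤ (σ j)⁻¹ * (c (v j) + ε) := by
          have := hσ j
          gcongr
      _ ≤ _ := by rw [mul_add]; linarith
  rw [e2] at h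
  refine (measureReal_mono e1).trans (h.trans (le_of_eq ?_))
  ring

end

/-! ### Comparison of Gaussian expectations -/

section

variable {p : ℕ} {S T : Matrix (Fin p) (Fin p) ℝ}

lemma integrable_inner_mul_inner_gauss (v u : Vec p) :
    Integrable (fun x => ⟪v, x⟫ * ⟪u, x⟫) (gauss S) :=
  (memLp_inner_gauss v).integrable_mul (memLp_inner_gauss u)

lemma integrable_norm_cube_gauss : Integrable (fun x => ‖x‖ ^ 3) (gauss S) := by
  have h : MemLp id 3 (gauss S) := IsGaussian.memLp_id _ _ (by simp)
  exact h.integrable_norm_pow (by norm_num)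

/-- After scaling by `r`, the linear terms integrate to zero and the quadratic terms to covariances;
only the cubic remainder is left as error. -/
lemma integral_taylor_gauss (hS : S.PosSemidef) (V : Finset (Vec p)) {h : Vec p → ℝ}
    (hm : Measurable h) (hb : ∀ x, |h x| ≤ 1) {w : Vec p} {d : Vec p → ℝ}
    {Q : Vec p → Vec p → ℝ} {K : ℝ}
    (hT : ∀ x, |h (w + x) - h w - ∑ v ∈ V, d v * ⟪v, x⟫
      - 1 / 2 * ∑ v ∈ V, ∑ u ∈ V, Q v u * (⟪v, x⟫ * ⟪u, x⟫)| ≤ K * ‖x‖ ^ 3)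
    {r : ℝ} (hr : 0 ≤ r) :
    |∫ x, h (w + x) ∂gauss (r ^ 2 • S) - h w - r ^ 2 * (1 / 2 * ∑ v ∈ V, ∑ u ∈ V,
      Q v u * bil S v u)| ≤ K * r ^ 3 * ∫ x, ‖x‖ ^ 3 ∂gauss S := by
  have i1 : Integrable (fun x => h (w + r • x)) (gauss S) := by
    refine Integrable.of_bound (C := 1) (hm.comp (by fun_prop)).aestronglyMeasurable ?_
    exact ae_of_all _ fun x => hb _
  have i2 : ∀ v, Integrable (fun x => d v * ⟪v, r • x⟫) (gauss S) := fun v => by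
    simp_rw [real_inner_smul_right]
    exact (((memLp_inner_gauss v).integrable (by norm_num)).const_mul _).const_mul _
  have i3 : ∀ v u, Integrable (fun x => Q v u * (⟪v, r • x⟫ * ⟪u, r • x⟫)) (gauss S) :=
    fun v u => by
      simp_rw [real_inner_smul_right]
      have := (integrable_inner_mul_inner_gauss (S := S) v u).const_mul (Q v u * (r * r))
      refine this.congr (ae_of_all _ fun x => ?_)
      simp only
      ring
  have j2 : ∀ v, ∫ x, d v * ⟪v, r • x⟫ ∂gauss S = 0 := fun v => by
    simp_rw [real_inner_smul_right]
    rw [integral_const_mul, integral_const_mul, integral_inner_gauss]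
    simp
  have j3 : ∀ v u, ∫ x, Q v u * (⟪v, r • x⟫ * ⟪u, r • x⟫) ∂gauss S
      = r ^ 2 * (Q v u * bil S v u) := fun v u => by
    rw [← integral_inner_mul_inner_gauss hS, ← integral_const_mul, ← integral_const_mul]
    refine integral_congr_ae (ae_of_all _ fun x => ?_)
    simp only [real_inner_smul_right]
    ring
  have e : ∫ x, (h (w + r • x) - h w - ∑ v ∈ V, d v * ⟪v, r • x⟫
      - 1 / 2 * ∑ v ∈ V, ∑ u ∈ V, Q v u * (⟪v, r • x⟫ * ⟪u, r • x⟫)) ∂gauss S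
      = ∫ x, h (w + x) ∂gauss (r ^ 2 • S) - h w - r ^ 2 * (1 / 2 * ∑ v ∈ V, ∑ u ∈ V,
      Q v u * bil S v u) := by
    have i4 : Integrable (fun x => h (w + r • x) - h w) (gauss S) := i1.sub (integrable_const _)
    have i5 : Integrable (fun x => ∑ v ∈ V, d v * ⟪v, r • x⟫) (gauss S) :=
      integrable_finsetSum _ fun v _ => i2 v
    have i6 : Integrable (fun x => h (w + r • x) - h w - ∑ v ∈ V, d v * ⟪v, r • x⟫) (gauss S) :=
      i4.sub i5
    have i7 : Integrable (fun x => 1 / 2 * ∑ v ∈ V, ∑ u ∈ V,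
        Q v u * (⟪v, r • x⟫ * ⟪u, r • x⟫)) (gauss S) :=
      (integrable_finsetSum _ fun v _ => integrable_finsetSum _ fun u _ => i3 v u).const_mul _
    rw [integral_sub i6 i7, integral_sub i4 i5,
      integral_sub i1 (integrable_const _), integral_finsetSum _ fun v _ => i2 v,
      integral_const_mul,
      integral_finsetSum _ fun v _ => integrable_finsetSum _ fun u _ => i3 v u,
      ← gauss_map_smul hS, integral_map (f := fun x => h (w + x)) (by fun_prop)
        (hm.comp (measurable_const_add w)).aestronglyMeasurable]
    rw [Finset.sum_congr rfl fun v _ => integral_finsetSum _ fun u _ => i3 v u]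
    simp only [j2, j3, ← Finset.mul_sum]
    simp
    ring
  rw [← e, ← integral_const_mul, ← Real.norm_eq_abs]
  refine norm_integral_le_of_norm_le (integrable_norm_cube_gauss.const_mul _)
    (ae_of_all _ fun x => ?_)
  refine (hT (r • x)).trans (le_of_eq ?_)
  rw [norm_smul, Real.norm_of_nonneg hr]
  ring

/-- Both laws are convolutions with the same `gauss U`. Conditionally on that component `w`, the
Taylor polynomials at `w` agree except for their second order terms, which differ by `Q` paired with
`S - T`. -/
lemma gauss_comparison_step (hS : S.PosSemidef) (hT : T.PosSemidef)
    {U : Matrix (Fin p) (Fin p) ℝ} (hU : U.PosSemidef) (V : Finset (Vec p)) {h : Vec p → ℝ}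
    (hm : Measurable h) (hb : ∀ x, |h x| ≤ 1) {K₂ K₃ Δ : ℝ}
    (hΔ : ∀ v ∈ V, ∀ u ∈ V, |bil S v u - bil T v u| ≤ Δ) (hΔ0 : 0 ≤ Δ)
    (hh : ∀ w, ∃ (d : Vec p → ℝ) (Q : Vec p → Vec p → ℝ), ∑ v ∈ V, ∑ u ∈ V, |Q v u| ≤ K₂ ∧
      ∀ x, |h (w + x) - h w - ∑ v ∈ V, d v * ⟪v, x⟫
        - 1 / 2 * ∑ v ∈ V, ∑ u ∈ V, Q v u * (⟪v, x⟫ * ⟪u, x⟫)| ≤ K₃ * ‖x‖ ^ 3)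
    {r : ℝ} (hr : 0 ≤ r) :
    |∫ x, h x ∂gauss (U + r ^ 2 • S) - ∫ x, h x ∂gauss (U + r ^ 2 • T)| ≤
      r ^ 2 * (1 / 2 * (K₂ * Δ))
        + r ^ 3 * (K₃ * (∫ x, ‖x‖ ^ 3 ∂gauss S + ∫ x, ‖x‖ ^ 3 ∂gauss T)) := by
  have hint : ∀ μ : Measure (Vec p), ∀ [IsProbabilityMeasure μ], Integrable h μ := fun μ _ =>
    Integrable.of_bound (C := 1) hm.aestronglyMeasurable (ae_of_all _ fun x => hb _)
  have conv : ∀ {R : Matrix (Fin p) (Fin p) ℝ}, R.PosSemidef →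
      ∫ x, h x ∂gauss (U + r ^ 2 • R) = ∫ w, ∫ x, h (w + x) ∂gauss (r ^ 2 • R) ∂gauss U ∧
      Integrable (fun w => ∫ x, h (w + x) ∂gauss (r ^ 2 • R)) (gauss U) := by
    intro R hR
    have hp := hR.smul (sq_nonneg r)
    have hi : Integrable (fun z : Vec p × Vec p => h (z.1 + z.2))
        ((gauss U).prod (gauss (r ^ 2 • R))) :=
      Integrable.of_bound (C := 1) (hm.comp (by fun_prop)).aestronglyMeasurable
        (ae_of_all _ fun x => hb _)
    refine ⟨?_, hi.integral_prod_left⟩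
    rw [← gauss_conv hU hp, Measure.conv, integral_map (by fun_prop) hm.aestronglyMeasurable,
      integral_prod _ hi]
  rw [(conv hS).1, (conv hT).1, ← integral_sub (conv hS).2 (conv hT).2, ← Real.norm_eq_abs]
  refine (norm_integral_le_of_norm_le_const (C := r ^ 2 * (1 / 2 * (K₂ * Δ))
        + r ^ 3 * (K₃ * (∫ x, ‖x‖ ^ 3 ∂gauss S + ∫ x, ‖x‖ ^ 3 ∂gauss T)))
        (ae_of_all _ fun w => ?_)).trans (by simp)
  obtain ⟨d, Q, hQ, hx⟩ := hh w
  have h1 := integral_taylor_gauss hS V hm hb hx hr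
  have h2 := integral_taylor_gauss hT V hm hb hx hr
  have h3 : |∑ v ∈ V, ∑ u ∈ V, Q v u * bil S v u - ∑ v ∈ V, ∑ u ∈ V, Q v u * bil T v u|
      ≤ K₂ * Δ := by
    rw [← Finset.sum_sub_distrib]
    simp_rw [← Finset.sum_sub_distrib, ← mul_sub]
    calc _ ≤ ∑ v ∈ V, ∑ u ∈ V, |Q v u * (bil S v u - bil T v u)| :=
          (Finset.abs_sum_le_sum_abs _ _).trans
            (Finset.sum_le_sum fun v _ => Finset.abs_sum_le_sum_abs _ _)
      _ ≤ ∑ v ∈ V, ∑ u ∈ V, |Q v u| * Δ := by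
          refine Finset.sum_le_sum fun v hv => Finset.sum_le_sum fun u hu => ?_
          rw [abs_mul]
          exact mul_le_mul_of_nonneg_left (hΔ v hv u hu) (abs_nonneg _)
      _ = (∑ v ∈ V, ∑ u ∈ V, |Q v u|) * Δ := by simp [Finset.sum_mul]
      _ ≤ _ := mul_le_mul_of_nonneg_right hQ hΔ0
  have h4 := mul_le_mul_of_nonneg_left h3 (show 0 ≤ r ^ 2 * (1 / 2) by positivity)
  rw [Real.norm_eq_abs]
  set A := ∑ v ∈ V, ∑ u ∈ V, Q v u * bil S v u
  set B := ∑ v ∈ V, ∑ u ∈ V, Q v u * bil T v u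
  rw [← abs_of_nonneg (show 0 ≤ r ^ 2 * (1 / 2 : ℝ) by positivity), ← abs_mul] at h4
  rw [abs_of_nonneg (show 0 ≤ r ^ 2 * (1 / 2 : ℝ) by positivity)] at h4
  rw [abs_le] at h1 h2 h4 ⊢
  constructor <;> nlinarith [h1.1, h1.2, h2.1, h2.2, h4.1, h4.2]

/-- A discrete interpolation in `N` steps. The remainders total a multiple of `N ^ (-1/2)` and
disappear in the limit, so `K₃` may be arbitrarily large and is absent from the bound. -/
lemma gauss_comparison (hS : S.PosSemidef) (hT : T.PosSemidef)
    (V : Finset (Vec p)) {h : Vec p → ℝ}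
    (hm : Measurable h) (hb : ∀ x, |h x| ≤ 1) {K₂ K₃ Δ : ℝ}
    (hΔ : ∀ v ∈ V, ∀ u ∈ V, |bil S v u - bil T v u| ≤ Δ) (hΔ0 : 0 ≤ Δ)
    (hh : ∀ w, ∃ (d : Vec p → ℝ) (Q : Vec p → Vec p → ℝ), ∑ v ∈ V, ∑ u ∈ V, |Q v u| ≤ K₂ ∧
      ∀ x, |h (w + x) - h w - ∑ v ∈ V, d v * ⟪v, x⟫
        - 1 / 2 * ∑ v ∈ V, ∑ u ∈ V, Q v u * (⟪v, x⟫ * ⟪u, x⟫)| ≤ K₃ * ‖x‖ ^ 3) :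
    |∫ x, h x ∂gauss S - ∫ x, h x ∂gauss T| ≤ 1 / 2 * (K₂ * Δ) := by
  set M := K₃ * (∫ x, ‖x‖ ^ 3 ∂gauss S + ∫ x, ‖x‖ ^ 3 ∂gauss T) with hM
  have key : ∀ N : ℕ, 0 < N → |∫ x, h x ∂gauss S - ∫ x, h x ∂gauss T| ≤
      1 / 2 * (K₂ * Δ) + (Real.sqrt N)⁻¹ * M := by
    intro N hN
    have hN' : (0 : ℝ) < N := Nat.cast_pos.2 hN
    set r : ℝ := (Real.sqrt N)⁻¹ with hr
    have hr2 : r ^ 2 = (N : ℝ)⁻¹ := by rw [hr, inv_pow, Real.sq_sqrt hN'.le]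
    let R : ℕ → Matrix (Fin p) (Fin p) ℝ := fun k => (k * r ^ 2) • S + ((N - k) * r ^ 2) • T
    let E : ℕ → ℝ := fun k => ∫ x, h x ∂gauss (R k)
    have hstep : ∀ k ∈ Finset.range N, |E (k + 1) - E k| ≤ r ^ 2 * (1 / 2 * (K₂ * Δ))
        + r ^ 3 * M := by
      intro k hk
      have hk' : ((k : ℝ)) + 1 ≤ N := by exact_mod_cast Finset.mem_range.1 hk
      have hU : ((k * r ^ 2) • S + ((N - k - 1) * r ^ 2) • T).PosSemidef :=
        (hS.smul (by positivity)).add (hT.smul (mul_nonneg (by linarith) (sq_nonneg _)))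
      have := gauss_comparison_step hS hT hU V hm hb hΔ hΔ0 hh (r := r) (by positivity)
      convert this using 5
      · simp only [R]
        push_cast
        module
      · simp only [R]
        module
    have h0 : E 0 = ∫ x, h x ∂gauss T := by
      change ∫ x, h x ∂gauss (R 0) = _
      congr 2
      simp [R, hr2, hN'.ne']
    have h1 : E N = ∫ x, h x ∂gauss S := by
      change ∫ x, h x ∂gauss (R N) = _
      congr 2
      simp [R, hr2, hN'.ne']
    rw [← h0, ← h1, ← Finset.sum_range_sub]
    calc _ ≤ ∑ k ∈ Finset.range N, |E (k + 1) - E k| := Finset.abs_sum_le_sum_abs _ _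
      _ ≤ ∑ k ∈ Finset.range N, (r ^ 2 * (1 / 2 * (K₂ * Δ)) + r ^ 3 * M) :=
          Finset.sum_le_sum hstep
      _ = (N * r ^ 2) * (1 / 2 * (K₂ * Δ)) + (N * r ^ 2) * r * M := by
          simp
          ring
      _ = _ := by rw [hr2, mul_inv_cancel₀ hN'.ne']; ring
  have hlim : Filter.Tendsto (fun N : ℕ => 1 / 2 * (K₂ * Δ) + (Real.sqrt N)⁻¹ * M)
      Filter.atTop (nhds (1 / 2 * (K₂ * Δ) + 0 * M)) := by
    refine Filter.Tendsto.const_add _ (Filter.Tendsto.mul_const _ ?_)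
    exact tendsto_inv_atTop_zero.comp
      (Real.tendsto_sqrt_atTop.comp tendsto_natCast_atTop_atTop)
  have := ge_of_tendsto hlim (Filter.eventually_atTop.2 ⟨1, fun N hN => key N hN⟩)
  simpa using this

end

/-! ### A smooth approximation of the indicator of an intersection of half-spaces -/

/-- A smooth step function together with bounds for its first three derivatives. -/
lemma exists_smooth_step : ∃ (C : ℝ) (g g₁ g₂ g₃ : ℝ → ℝ), 0 < C ∧
    (∀ x, HasDerivAt g (g₁ x) x) ∧ (∀ x, HasDerivAt g₁ (g₂ x) x) ∧
    (∀ x, HasDerivAt g₂ (g₃ x) x) ∧ (∀ x, |g₁ x| ≤ C) ∧ (∀ x, |g₂ x| ≤ C) ∧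
    (∀ x, |g₃ x| ≤ C) ∧ (∀ x, x ≤ 0 → g x = 1) ∧ (∀ x, 1 ≤ x → g x = 0) ∧
    (∀ x, 0 ≤ g x) ∧ ∀ x, g x ≤ 1 := by
  let g : ℝ → ℝ := fun x => 1 - Real.smoothTransition x
  have hg : ContDiff ℝ (⊤ : ℕ∞) g := contDiff_const.sub Real.smoothTransition.contDiff
  have h0 : ∀ x, x ≤ 0 → g x = 1 := fun x hx => by
    simp [g, Real.smoothTransition.zero_of_nonpos hx]
  have h1 : ∀ x, 1 ≤ x → g x = 0 := fun x hx => by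
    simp [g, Real.smoothTransition.one_of_one_le hx]
  have hd : ∀ (k : ℕ) x, HasDerivAt (iteratedDeriv k g) (iteratedDeriv (k + 1) g x) x := by
    intro k x
    rw [iteratedDeriv_succ]
    exact ((hg.differentiable_iteratedDeriv k (by exact_mod_cast WithTop.coe_lt_top _)) x).hasDerivAt
  have hb : ∀ k : ℕ, ∃ C, ∀ x, |iteratedDeriv (k + 1) g x| ≤ C := by
    intro k
    obtain ⟨C, hC⟩ := isCompact_Icc.exists_bound_of_continuousOn (s := Set.Icc (0 : ℝ) 1)
      (hg.continuous_iteratedDeriv (k + 1) (by exact_mod_cast le_top)).continuousOn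
    refine ⟨C, fun x => ?_⟩
    have hC0 : 0 ≤ C := (norm_nonneg _).trans (hC 0 (by simp))
    by_cases hx : x ∈ Set.Icc (0 : ℝ) 1
    · exact hC x hx
    -- Outside `[0, 1]` the function is locally constant, so its derivatives vanish there; on `[0,
    -- 1]` compactness bounds them.
    have : ∃ c, g =ᶠ[nhds x] fun _ => c := by
      rcases lt_or_ge x 0 with h | h
      · exact ⟨1, Filter.eventually_of_mem (Iio_mem_nhds h) fun y hy => h0 y (le_of_lt hy)⟩
      · refine ⟨0, Filter.eventually_of_mem (Ioi_mem_nhds (a := 1) ?_) fun y hy => h1 y (le_of_lt hy)⟩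
        by_contra hcon
        exact hx ⟨h, not_lt.1 hcon⟩
    obtain ⟨c, hc⟩ := this
    rw [hc.iteratedDeriv_eq]
    simpa [iteratedDeriv_const] using hC0
  obtain ⟨C1, hC1⟩ := hb 0
  obtain ⟨C2, hC2⟩ := hb 1
  obtain ⟨C3, hC3⟩ := hb 2
  have p1 : 0 ≤ C1 := (abs_nonneg _).trans (hC1 0)
  have p2 : 0 ≤ C2 := (abs_nonneg _).trans (hC2 0)
  have p3 : 0 ≤ C3 := (abs_nonneg _).trans (hC3 0)
  refine ⟨1 + C1 + C2 + C3, g, iteratedDeriv 1 g, iteratedDeriv 2 g, iteratedDeriv 3 g,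
    by positivity, fun x => by simpa using hd 0 x, hd 1, hd 2, fun x => ?_, fun x => ?_,
    fun x => ?_, h0, h1, fun x => ?_, fun x => ?_⟩
  · linarith [hC1 x]
  · linarith [hC2 x]
  · linarith [hC3 x]
  · simpa [g] using Real.smoothTransition.le_one x
  · simpa [g] using Real.smoothTransition.nonneg x

/-- The mean value inequality on `[0, 1]`, applied three times. The constant `M` in place of `M / 6`
is harmless. -/
lemma abs_taylor_two_le {ψ ψ₁ ψ₂ ψ₃ : ℝ → ℝ} {M : ℝ} (h₁ : ∀ t, HasDerivAt ψ (ψ₁ t) t)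
    (h₂ : ∀ t, HasDerivAt ψ₁ (ψ₂ t) t) (h₃ : ∀ t, HasDerivAt ψ₂ (ψ₃ t) t)
    (hM : ∀ t, |ψ₃ t| ≤ M) : |ψ 1 - ψ 0 - ψ₁ 0 - 1 / 2 * ψ₂ 0| ≤ M := by
  have hM0 : 0 ≤ M := (abs_nonneg _).trans (hM 0)
  have mv : ∀ {f f' : ℝ → ℝ}, (∀ t, HasDerivAt f (f' t) t) →
      (∀ t ∈ Set.Icc (0 : ℝ) 1, |f' t| ≤ M) → ∀ t ∈ Set.Icc (0 : ℝ) 1, |f t - f 0| ≤ M := by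
    intro f f' hf hb t ht
    have := (convex_Icc (0 : ℝ) 1).norm_image_sub_le_of_norm_hasDerivWithin_le
      (fun x _ => (hf x).hasDerivWithinAt) hb (show (0 : ℝ) ∈ Set.Icc 0 1 by simp) ht
    refine this.trans ?_
    rw [sub_zero, Real.norm_of_nonneg ht.1]
    nlinarith [ht.1, ht.2]
  have e2 := mv h₃ fun t _ => hM t
  have e1 := mv (f := fun t => ψ₁ t - t * ψ₂ 0) (f' := fun t => ψ₂ t - ψ₂ 0)
    (fun t => ((h₂ t).fun_sub ((hasDerivAt_id t).mul_const (ψ₂ 0))).congr_deriv (by simp)) e2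
  have e0 := mv (f := fun t => ψ t - t * ψ₁ 0 - 1 / 2 * t ^ 2 * ψ₂ 0)
    (f' := fun t => ψ₁ t - t * ψ₂ 0 - ψ₁ 0)
    (fun t => by
      refine (((h₁ t).fun_sub ((hasDerivAt_id t).mul_const (ψ₁ 0))).fun_sub
        (((hasDerivAt_pow 2 t).const_mul (1 / 2)).mul_const (ψ₂ 0))).congr_deriv ?_
      simp
      ring)
    (fun t ht => by simpa using e1 t ht) 1 (by simp)
  convert e0 using 2
  ring

/-! ### Derivatives of the log-sum-exp function along a line -/

section LogSumExp

variable {ι : Type*} (V : Finset ι) (a y : ι → ℝ)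

/-- `∑ y_v^k exp(a_v + t y_v)`. -/
noncomputable def expMoment (k : ℕ) (t : ℝ) : ℝ := ∑ v ∈ V, y v ^ k * Real.exp (a v + t * y v)

variable {V}

lemma hasDerivAt_expMoment (k : ℕ) (t : ℝ) :
    HasDerivAt (expMoment V a y k) (expMoment V a y (k + 1) t) t := by
  unfold expMoment
  refine HasDerivAt.fun_sum fun v _ => ?_
  refine ((((hasDerivAt_id t).mul_const (y v)).const_add (a v)).exp.const_mul
    (y v ^ k)).congr_deriv ?_
  simp
  ring

lemma expMoment_zero_pos (hV : V.Nonempty) (t : ℝ) : 0 < expMoment V a y 0 t := by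
  unfold expMoment
  exact Finset.sum_pos (fun v _ => by positivity) hV

/-- The moments of `y` under the tilted weights. -/
noncomputable def tiltMoment (V : Finset ι) (a y : ι → ℝ) (k : ℕ) (t : ℝ) : ℝ :=
  expMoment V a y k t / expMoment V a y 0 t

lemma hasDerivAt_tiltMoment (hV : V.Nonempty) (k : ℕ) (t : ℝ) :
    HasDerivAt (tiltMoment V a y k)
      (tiltMoment V a y (k + 1) t - tiltMoment V a y k t * tiltMoment V a y 1 t) t := by
  have h0 := (expMoment_zero_pos a y hV t).ne'
  refine ((hasDerivAt_expMoment (V := V) a y k t).fun_div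
    (hasDerivAt_expMoment a y 0 t) h0).congr_deriv ?_
  unfold tiltMoment
  field_simp

lemma hasDerivAt_log_expMoment (hV : V.Nonempty) (t : ℝ) :
    HasDerivAt (fun t => Real.log (expMoment V a y 0 t)) (tiltMoment V a y 1 t) t :=
  (hasDerivAt_expMoment a y 0 t).log (expMoment_zero_pos a y hV t).ne'

lemma abs_tiltMoment_le (hV : V.Nonempty) {Y : ℝ} (hY : ∀ v ∈ V, |y v| ≤ Y) (k : ℕ) (t : ℝ) :
    |tiltMoment V a y k t| ≤ Y ^ k := by
  have h0 := expMoment_zero_pos a y hV t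
  rw [tiltMoment, abs_div, abs_of_pos h0, div_le_iff₀ h0]
  unfold expMoment
  rw [Finset.mul_sum]
  refine (Finset.abs_sum_le_sum_abs _ _).trans (Finset.sum_le_sum fun v hv => ?_)
  rw [abs_mul, abs_pow, Real.abs_exp, pow_zero, one_mul]
  gcongr
  exact hY v hv

/-- Along the line, log-sum-exp is a cumulant generating function: its derivatives are cumulants of
`y` under the tilted weights, whose moments are at most `Y ^ k`. The third derivative of the
composition has three parts, bounded by `c * Y ^ 3` times 1, 6 and 6, which gives 13. -/
lemma abs_taylor_comp_logSumExp_le (hV : V.Nonempty) {Y : ℝ} (hY : ∀ v ∈ V, |y v| ≤ Y)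
    {f f₁ f₂ f₃ : ℝ → ℝ} {c : ℝ} (h₁ : ∀ t, HasDerivAt f (f₁ t) t)
    (h₂ : ∀ t, HasDerivAt f₁ (f₂ t) t) (h₃ : ∀ t, HasDerivAt f₂ (f₃ t) t)
    (b₁ : ∀ t, |f₁ t| ≤ c) (b₂ : ∀ t, |f₂ t| ≤ c) (b₃ : ∀ t, |f₃ t| ≤ c) :
    |f (Real.log (expMoment V a y 0 1)) - f (Real.log (expMoment V a y 0 0))
      - f₁ (Real.log (expMoment V a y 0 0)) * tiltMoment V a y 1 0
      - 1 / 2 * (f₂ (Real.log (expMoment V a y 0 0)) * tiltMoment V a y 1 0 ^ 2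
        + f₁ (Real.log (expMoment V a y 0 0)) *
          (tiltMoment V a y 2 0 - tiltMoment V a y 1 0 ^ 2))| ≤ 13 * c * Y ^ 3 := by
  set κ : ℝ → ℝ := fun t => Real.log (expMoment V a y 0 t) with hκ
  set M : ℕ → ℝ → ℝ := tiltMoment V a y with hM
  have dκ : ∀ t, HasDerivAt κ (M 1 t) t := hasDerivAt_log_expMoment a y hV
  have dM : ∀ k t, HasDerivAt (M k) (M (k + 1) t - M k t * M 1 t) t :=
    hasDerivAt_tiltMoment a y hV
  have bM : ∀ k t, |M k t| ≤ Y ^ k := abs_tiltMoment_le a y hV hY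
  have hY0 : 0 ≤ Y := by
    obtain ⟨v, hv⟩ := hV
    exact (abs_nonneg _).trans (hY v hv)
  have hc : 0 ≤ c := (abs_nonneg _).trans (b₁ 0)
  have d1 : ∀ t, HasDerivAt (fun t => f (κ t)) (f₁ (κ t) * M 1 t) t := fun t =>
    (h₁ (κ t)).comp t (dκ t)
  have d2 : ∀ t, HasDerivAt (fun t => f₁ (κ t) * M 1 t)
      (f₂ (κ t) * M 1 t ^ 2 + f₁ (κ t) * (M 2 t - M 1 t ^ 2)) t := fun t => by
    refine (((h₂ (κ t)).comp t (dκ t)).fun_mul (dM 1 t)).congr_deriv ?_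
    simp only [Function.comp]
    ring
  have d3 : ∀ t, HasDerivAt (fun t => f₂ (κ t) * M 1 t ^ 2 + f₁ (κ t) * (M 2 t - M 1 t ^ 2))
      (f₃ (κ t) * M 1 t ^ 3 + f₂ (κ t) * (3 * (M 1 t * M 2 t) - 3 * M 1 t ^ 3)
        + f₁ (κ t) * (M 3 t - 3 * (M 1 t * M 2 t) + 2 * M 1 t ^ 3)) t := fun t => by
    refine ((((h₃ (κ t)).comp t (dκ t)).fun_mul ((dM 1 t).fun_pow 2)).fun_add
      (((h₂ (κ t)).comp t (dκ t)).fun_mul ((dM 2 t).fun_sub ((dM 1 t).fun_pow 2)))).congr_deriv ?_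
    simp only [Function.comp]
    push_cast
    ring
  have hbound : ∀ t, |f₃ (κ t) * M 1 t ^ 3 + f₂ (κ t) * (3 * (M 1 t * M 2 t) - 3 * M 1 t ^ 3)
        + f₁ (κ t) * (M 3 t - 3 * (M 1 t * M 2 t) + 2 * M 1 t ^ 3)| ≤ 13 * c * Y ^ 3 := by
    intro t
    have m1 : |M 1 t ^ 3| ≤ Y ^ 3 := by
      rw [abs_pow]
      have := bM 1 t
      rw [pow_one] at this
      gcongr
    have m2 : |M 1 t * M 2 t| ≤ Y ^ 3 := by
      rw [abs_mul]
      calc _ ≤ Y ^ 1 * Y ^ 2 := mul_le_mul (bM 1 t) (bM 2 t) (abs_nonneg _) (by positivity)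
        _ = Y ^ 3 := by ring
    have m3 := bM 3 t
    have t1 : |f₃ (κ t) * M 1 t ^ 3| ≤ c * Y ^ 3 := by
      rw [abs_mul]; exact mul_le_mul (b₃ _) m1 (abs_nonneg _) hc
    have t2 : |f₂ (κ t) * (3 * (M 1 t * M 2 t) - 3 * M 1 t ^ 3)| ≤ c * (6 * Y ^ 3) := by
      rw [abs_mul]
      refine mul_le_mul (b₂ _) ?_ (abs_nonneg _) hc
      rw [abs_le] at m1 m2 ⊢
      constructor <;> linarith [m1.1, m1.2, m2.1, m2.2]
    have t3 : |f₁ (κ t) * (M 3 t - 3 * (M 1 t * M 2 t) + 2 * M 1 t ^ 3)| ≤ c * (6 * Y ^ 3) := by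
      rw [abs_mul]
      refine mul_le_mul (b₁ _) ?_ (abs_nonneg _) hc
      rw [abs_le] at m1 m2 m3 ⊢
      constructor <;> linarith [m1.1, m1.2, m2.1, m2.2, m3.1, m3.2]
    refine (abs_add_le _ _).trans ?_
    linarith [abs_add_le (f₃ (κ t) * M 1 t ^ 3)
      (f₂ (κ t) * (3 * (M 1 t * M 2 t) - 3 * M 1 t ^ 3))]
  exact abs_taylor_two_le d1 d2 d3 hbound

end LogSumExp

/-! ### Taylor expansion of a function of the soft maximum -/

section

variable {p : ℕ} {S T : Matrix (Fin p) (Fin p) ℝ}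

/-- The softmax weights `π` are nonnegative and sum to 1. This is why the second order coefficients
have absolute sum at most `3 * β ^ 2 * C`, whatever the number of elements of `V`. -/
lemma taylor_softmax (V : Finset (Vec p)) (hV : V.Nonempty) (c : Vec p → ℝ) {β : ℝ} (hβ : 0 ≤ β)
    {f f₁ f₂ f₃ : ℝ → ℝ} {C : ℝ} (h₁ : ∀ t, HasDerivAt f (f₁ t) t)
    (h₂ : ∀ t, HasDerivAt f₁ (f₂ t) t) (h₃ : ∀ t, HasDerivAt f₂ (f₃ t) t)
    (b₁ : ∀ t, |f₁ t| ≤ C) (b₂ : ∀ t, |f₂ t| ≤ C) (b₃ : ∀ t, |f₃ t| ≤ C) (w : Vec p) :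
    ∃ (d : Vec p → ℝ) (Q : Vec p → Vec p → ℝ), ∑ v ∈ V, ∑ u ∈ V, |Q v u| ≤ 3 * β ^ 2 * C ∧
      ∀ x, |f (Real.log (∑ v ∈ V, Real.exp (β * (⟪v, w + x⟫ - c v))))
        - f (Real.log (∑ v ∈ V, Real.exp (β * (⟪v, w⟫ - c v)))) - ∑ v ∈ V, d v * ⟪v, x⟫
        - 1 / 2 * ∑ v ∈ V, ∑ u ∈ V, Q v u * (⟪v, x⟫ * ⟪u, x⟫)|
        ≤ 13 * C * (β * ∑ v ∈ V, ‖v‖) ^ 3 * ‖x‖ ^ 3 := by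
  classical
  set a : Vec p → ℝ := fun v => β * (⟪v, w⟫ - c v) with ha
  set Z := ∑ v ∈ V, Real.exp (a v) with hZ
  have hZ0 : 0 < Z := Finset.sum_pos (fun v _ => Real.exp_pos _) hV
  set π : Vec p → ℝ := fun v => Real.exp (a v) / Z with hπ
  have hπ0 : ∀ v, 0 ≤ π v := fun v => by positivity
  have hπ1 : ∑ v ∈ V, π v = 1 := by
    rw [← Finset.sum_div, div_self hZ0.ne']
  set F₁ := f₁ (Real.log Z)
  set F₂ := f₂ (Real.log Z)
  have hC : 0 ≤ C := (abs_nonneg _).trans (b₁ 0)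
  -- Gradient and Hessian of the composition at `w`, in coordinates along `V`: the Hessian collects
  -- `F₂ π π'` and `F₁` times the covariance matrix of the weights.
  refine ⟨fun v => F₁ * (π v * β), fun v u => β ^ 2 * ((F₂ - F₁) * (π v * π u)
    + F₁ * (if v = u then π v else 0)), ?_, fun x => ?_⟩
  · have hF : |F₂ - F₁| ≤ 2 * C := by
      have := abs_sub F₂ F₁
      linarith [b₁ (Real.log Z), b₂ (Real.log Z)]
    calc _ ≤ ∑ v ∈ V, ∑ u ∈ V, (β ^ 2 * (2 * C * (π v * π u)
          + C * (if v = u then π v else 0))) := by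
          refine Finset.sum_le_sum fun v _ => Finset.sum_le_sum fun u _ => ?_
          rw [abs_mul, abs_of_nonneg (sq_nonneg β)]
          refine mul_le_mul_of_nonneg_left ?_ (sq_nonneg β)
          refine (abs_add_le _ _).trans (add_le_add ?_ ?_)
          · rw [abs_mul, abs_of_nonneg (mul_nonneg (hπ0 v) (hπ0 u))]
            exact mul_le_mul_of_nonneg_right hF (mul_nonneg (hπ0 v) (hπ0 u))
          · have : 0 ≤ (if v = u then π v else 0) := by split_ifs <;> simp [hπ0]
            rw [abs_mul, abs_of_nonneg this]
            exact mul_le_mul_of_nonneg_right (b₁ _) this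
      _ = β ^ 2 * (2 * C * ((∑ v ∈ V, π v) * ∑ u ∈ V, π u) + C * ∑ v ∈ V, π v) := by
          rw [Finset.sum_mul_sum]
          simp only [Finset.mul_sum, Finset.sum_add_distrib, mul_add]
          congr 1
          refine Finset.sum_congr rfl fun v hv => ?_
          simp [hv]
      _ = _ := by rw [hπ1]; ring
  -- Bounding every norm by the sum of all norms is wasteful, but it affects only the cubic
  -- remainder.
  · have hY : ∀ v ∈ V, |β * ⟪v, x⟫| ≤ (β * ∑ v ∈ V, ‖v‖) * ‖x‖ := by
      intro v hv
      rw [abs_mul, abs_of_nonneg hβ, mul_assoc]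
      refine mul_le_mul_of_nonneg_left ((abs_real_inner_le_norm v x).trans ?_) hβ
      refine mul_le_mul_of_nonneg_right ?_ (norm_nonneg x)
      exact Finset.single_le_sum (f := fun v => ‖v‖) (fun u _ => norm_nonneg u) hv
    have h := abs_taylor_comp_logSumExp_le a (fun v => β * ⟪v, x⟫) hV hY h₁ h₂ h₃ b₁ b₂ b₃
    have e0 : expMoment V a (fun v => β * ⟪v, x⟫) 0 0 = Z := by simp [expMoment, hZ]
    have e1 : expMoment V a (fun v => β * ⟪v, x⟫) 0 1
        = ∑ v ∈ V, Real.exp (β * (⟪v, w + x⟫ - c v)) := by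
      simp only [expMoment, ha, pow_zero, one_mul, inner_add_right]
      exact Finset.sum_congr rfl fun v _ => by ring_nf
    have e2 : tiltMoment V a (fun v => β * ⟪v, x⟫) 1 0 = ∑ v ∈ V, π v * β * ⟪v, x⟫ := by
      rw [tiltMoment, e0, expMoment, Finset.sum_div]
      refine Finset.sum_congr rfl fun v _ => ?_
      simp [hπ]
      ring
    have e3 : tiltMoment V a (fun v => β * ⟪v, x⟫) 2 0
        = ∑ v ∈ V, π v * (β ^ 2 * (⟪v, x⟫ * ⟪v, x⟫)) := by
      rw [tiltMoment, e0, expMoment, Finset.sum_div]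
      refine Finset.sum_congr rfl fun v _ => ?_
      simp [hπ]
      ring
    rw [e0, e1, e2, e3] at h
    have q1 : ∑ v ∈ V, F₁ * (π v * β) * ⟪v, x⟫ = F₁ * ∑ v ∈ V, π v * β * ⟪v, x⟫ := by
      rw [Finset.mul_sum]
      exact Finset.sum_congr rfl fun v _ => by ring
    have q2 : ∑ v ∈ V, ∑ u ∈ V, (β ^ 2 * ((F₂ - F₁) * (π v * π u)
        + F₁ * (if v = u then π v else 0))) * (⟪v, x⟫ * ⟪u, x⟫)
        = F₂ * (∑ v ∈ V, π v * β * ⟪v, x⟫) ^ 2 + F₁ * (∑ v ∈ V, π v * (β ^ 2 * (⟪v, x⟫ * ⟪v, x⟫))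
          - (∑ v ∈ V, π v * β * ⟪v, x⟫) ^ 2) := by
      have r1 : (∑ v ∈ V, π v * β * ⟪v, x⟫) ^ 2
          = ∑ v ∈ V, ∑ u ∈ V, (π v * β * ⟪v, x⟫) * (π u * β * ⟪u, x⟫) := by
        rw [sq, Finset.sum_mul_sum]
      have r2 : ∑ v ∈ V, π v * (β ^ 2 * (⟪v, x⟫ * ⟪v, x⟫))
          = ∑ v ∈ V, ∑ u ∈ V, if v = u then π v * (β ^ 2 * (⟪v, x⟫ * ⟪u, x⟫)) else 0 := by
        refine Finset.sum_congr rfl fun v hv => ?_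
        simp [hv]
      rw [mul_sub, r1, r2]
      simp only [Finset.mul_sum, ← Finset.sum_sub_distrib, ← Finset.sum_add_distrib]
      refine Finset.sum_congr rfl fun v _ => Finset.sum_congr rfl fun u _ => ?_
      split_ifs <;> ring
    rw [q1, q2]
    rw [mul_pow _ ‖x‖, ← mul_assoc] at h
    exact h

lemma setOf_inner_le_measurable (V : Finset (Vec p)) (c : Vec p → ℝ) :
    MeasurableSet {x : Vec p | ∀ v ∈ V, ⟪v, x⟫ ≤ c v} := by
  have : {x : Vec p | ∀ v ∈ V, ⟪v, x⟫ ≤ c v} = ⋂ v ∈ V, {x : Vec p | ⟪v, x⟫ ≤ c v} := by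
    ext x
    simp
  rw [this]
  exact V.measurableSet_biInter fun v _ => measurableSet_le (by fun_prop) (by fun_prop)

end

/-- Comparison of the probabilities of intersections of half-spaces under two centered Gaussian
measures, up to an enlargement. -/
lemma exists_gauss_halfspaces_comparison : ∃ C : ℝ, 0 < C ∧ ∀ {p : ℕ}
    {S T : Matrix (Fin p) (Fin p) ℝ}, S.PosSemidef → T.PosSemidef → ∀ (V : Finset (Vec p))
    (c : Vec p → ℝ) {L d ε Δ : ℝ}, 1 ≤ L → (V.card : ℝ) ≤ Real.exp (d * L) → 0 < ε → 0 ≤ Δ →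
    (∀ v ∈ V, ∀ u ∈ V, |bil S v u - bil T v u| ≤ Δ) →
    (gauss S).real {x | ∀ v ∈ V, ⟪v, x⟫ ≤ c v - d * ε} ≤
      (gauss T).real {x | ∀ v ∈ V, ⟪v, x⟫ ≤ c v + ε} + C * (Δ * L / ε ^ 2) := by
  obtain ⟨C, g, g₁, g₂, g₃, hC, h₁, h₂, h₃, b₁, b₂, b₃, hz, ho, hnn, hle⟩ := exists_smooth_step
  refine ⟨3 / 2 * C, by positivity, fun {p S T} hS hT V c {L d ε Δ} hL hm hε hΔ hΔV => ?_⟩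
  rcases V.eq_empty_or_nonempty with rfl | hV
  · simp
    positivity
  have hL0 : 0 < L := by linarith
  have hLi : L⁻¹ ≤ 1 := inv_le_one_of_one_le₀ hL
  have hLi0 : 0 ≤ L⁻¹ := by positivity
  -- The outer function is `g (t / L)`, with derivatives at most `C / L`. The second order constant
  -- is thus `3 (L / ε)² C / L = 3 C L / ε ^ 2`.
  set β := L / ε with hβ
  have hβ0 : 0 < β := by positivity
  have hder : ∀ {q q₁ : ℝ → ℝ}, (∀ x, HasDerivAt q (q₁ x) x) → ∀ t,
      HasDerivAt (fun t => q (t * L⁻¹)) (q₁ (t * L⁻¹) * L⁻¹) t := fun hq t =>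
    (hq (t * L⁻¹)).comp t (by simpa using (hasDerivAt_id t).mul_const L⁻¹)
  have bb : ∀ {q : ℝ → ℝ}, (∀ x, |q x| ≤ C) → ∀ t k, |q (t * L⁻¹) * L⁻¹ * L⁻¹ ^ k| ≤ C * L⁻¹ := by
    intro q hq t k
    rw [mul_assoc, abs_mul, abs_of_nonneg (show 0 ≤ L⁻¹ * L⁻¹ ^ k by positivity)]
    have : L⁻¹ * L⁻¹ ^ k ≤ L⁻¹ := mul_le_of_le_one_right hLi0 (pow_le_one₀ hLi0 hLi)
    exact mul_le_mul (hq _) this (by positivity) hC.le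
  set h : Vec p → ℝ := fun w => g (Real.log (∑ v ∈ V, Real.exp (β * (⟪v, w⟫ - c v))) * L⁻¹)
    with hh
  have hgc : Continuous g := continuous_iff_continuousAt.2 fun x => (h₁ x).continuousAt
  have hmeas : Measurable h := by
    refine hgc.measurable.comp ?_
    fun_prop
  have key := gauss_comparison hS hT V (h := h) hmeas
    (fun x => abs_le.2 ⟨by linarith [hnn (Real.log (∑ v ∈ V, Real.exp (β * (⟪v, x⟫ - c v))) * L⁻¹)],
      hle _⟩)
    (K₂ := 3 * β ^ 2 * (C * L⁻¹)) (K₃ := 13 * (C * L⁻¹) * (β * ∑ v ∈ V, ‖v‖) ^ 3) hΔV hΔ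
    (fun w => taylor_softmax V hV c hβ0.le (f := fun t => g (t * L⁻¹))
      (hder h₁) (fun t => (hder h₂ t).mul_const L⁻¹)
      (fun t => ((hder h₃ t).mul_const L⁻¹).mul_const L⁻¹)
      (fun t => by simpa using bb b₁ t 0) (fun t => by simpa using bb b₂ t 1)
      (fun t => by simpa [pow_two, mul_assoc] using bb b₃ t 2) w)
  have hint : ∀ R : Matrix (Fin p) (Fin p) ℝ, Integrable h (gauss R) := fun R =>
    Integrable.of_bound (C := 1) hmeas.aestronglyMeasurable (ae_of_all _ fun x => by
      rw [Real.norm_eq_abs, abs_of_nonneg (hnn _)]; exact hle _)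
  have low : (gauss S).real {x | ∀ v ∈ V, ⟪v, x⟫ ≤ c v - d * ε} ≤ ∫ x, h x ∂gauss S := by
    rw [← integral_indicator_one (setOf_inner_le_measurable V _)]
    refine integral_mono ((integrable_const 1).indicator (setOf_inner_le_measurable V _))
      (hint S) fun x => ?_
    by_cases hx : ∀ v ∈ V, ⟪v, x⟫ ≤ c v - d * ε
    · rw [Set.indicator_of_mem (by exact hx)]
      refine (hz _ ?_).ge
      refine mul_nonpos_of_nonpos_of_nonneg ?_ hLi0
      refine Real.log_nonpos (Finset.sum_nonneg fun v _ => (Real.exp_pos _).le) ?_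
      -- The margin `d * ε` compensates for the number of terms: each is at most `exp (-(d * L))`,
      -- so the sum is at most 1 and the step function is still 1.
      calc ∑ v ∈ V, Real.exp (β * (⟪v, x⟫ - c v)) ≤ ∑ v ∈ V, Real.exp (-(d * L)) := by
            refine Finset.sum_le_sum fun v hv => Real.exp_le_exp.2 ?_
            calc β * (⟪v, x⟫ - c v) ≤ β * (-(d * ε)) :=
                  mul_le_mul_of_nonneg_left (by linarith [hx v hv]) hβ0.le
              _ = -(d * L) := by rw [hβ]; field_simp
        _ = V.card * Real.exp (-(d * L)) := by simp
        _ ≤ Real.exp (d * L) * Real.exp (-(d * L)) := by gcongr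
        _ = 1 := by rw [← Real.exp_add]; simp
    · rw [Set.indicator_of_notMem (by exact hx)]
      exact hnn _
  have upp : ∫ x, h x ∂gauss T ≤ (gauss T).real {x | ∀ v ∈ V, ⟪v, x⟫ ≤ c v + ε} := by
    rw [← integral_indicator_one (setOf_inner_le_measurable V _)]
    refine integral_mono (hint T)
      ((integrable_const 1).indicator (setOf_inner_le_measurable V _)) fun x => ?_
    by_cases hx : ∀ v ∈ V, ⟪v, x⟫ ≤ c v + ε
    · rw [Set.indicator_of_mem (by exact hx)]
      exact hle _
    · rw [Set.indicator_of_notMem (by exact hx)]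
      push Not at hx
      obtain ⟨v, hv, hx⟩ := hx
      refine (ho _ ?_).le
      rw [← div_eq_mul_inv, le_div_iff₀ hL0, one_mul]
      have h1 : Real.exp (β * (⟪v, x⟫ - c v)) ≤ ∑ v ∈ V, Real.exp (β * (⟪v, x⟫ - c v)) :=
        Finset.single_le_sum (f := fun v => Real.exp (β * (⟪v, x⟫ - c v)))
          (fun u _ => (Real.exp_pos _).le) hv
      calc L = β * ε := by rw [hβ]; field_simp
        _ ≤ β * (⟪v, x⟫ - c v) := mul_le_mul_of_nonneg_left (by linarith) hβ0.le
        _ = Real.log (Real.exp (β * (⟪v, x⟫ - c v))) := (Real.log_exp _).symm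
        _ ≤ _ := Real.log_le_log (Real.exp_pos _) h1
  have e : 1 / 2 * (3 * β ^ 2 * (C * L⁻¹) * Δ) = 3 / 2 * C * (Δ * L / ε ^ 2) := by
    rw [hβ]
    field_simp
  rw [e] at key
  linarith [(abs_le.1 key).2]

/-! ### Simple convex sets under two Gaussian measures -/

/-- Normals with infinite support value impose no constraint and are dropped; nonemptiness of `P`
excludes the value `⊥`. What remains has real bounds. -/
lemma enlarge_eq_halfspaces {p : ℕ} {P : Set (Vec p)} (hP : P.Nonempty) (V : Finset (Vec p))
    (ε : ℝ) : enlarge P V ε = {x | ∀ v ∈ V.filter (fun v => supportFun P v ≠ ⊤),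
      ⟪v, x⟫ ≤ (supportFun P v).toReal + ε} := by
  have hbot : ∀ v, supportFun P v ≠ ⊥ := by
    intro v
    obtain ⟨x, hx⟩ := hP
    have : ((inner ℝ x v : ℝ) : EReal) ≤ supportFun P v := le_iSup₂_of_le x hx le_rfl
    exact fun h => EReal.coe_ne_bot _ (le_bot_iff.1 (h ▸ this))
  ext x
  simp only [enlarge, Set.mem_ofPred_eq, Finset.mem_filter, and_imp]
  refine forall₂_congr fun v hv => ?_
  by_cases ht : supportFun P v = ⊤
  · simp [ht]
  · rw [← EReal.coe_toReal ht (hbot v), ← EReal.coe_add, EReal.coe_le_coe_iff,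
      real_inner_comm]
    simp

/-- The error bound for a single simple convex set. -/
lemma exists_gauss_simple_comparison (b d : ℝ) (hb : 0 < b) (hd : 0 < d) :
    ∃ K : ℝ, 0 < K ∧ ∀ {p n : ℕ} {a : ℝ} {S T : Matrix (Fin p) (Fin p) ℝ} {A P : Set (Vec p)}
      {V : Finset (Vec p)} {ε u : ℝ}, 0 ≤ a → S.PosSemidef → T.PosSemidef → CondC n a d A P V →
      1 ≤ Real.log ((p : ℝ) * n) → (∀ v ∈ V, b ≤ bil S v v) → 0 < ε → 0 ≤ u →
      (∀ v ∈ V, ∀ w ∈ V, |bil T v w - bil S v w| ≤ u) →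
      |(gauss T).real A - (gauss S).real A| ≤ K * (a / n * Real.sqrt (Real.log ((p : ℝ) * n))
        + ε * Real.sqrt (Real.log ((p : ℝ) * n)) + u * Real.log ((p : ℝ) * n) / ε ^ 2) := by
  obtain ⟨C, hC, hcomp⟩ := exists_gauss_halfspaces_comparison
  refine ⟨8 * (d + 1) * Real.sqrt (d + 1) / Real.sqrt b + C, by positivity, ?_⟩
  intro p n a S T A P V ε u ha hS hT hA hL hV hε hu hTS
  set L := Real.log ((p : ℝ) * n) with hLd
  have hL0 : 0 < L := by linarith
  have hη : 0 ≤ a / n := by positivity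
  have hpn : 0 < (p : ℝ) * n := by
    rcases (show 0 ≤ (p : ℝ) * n by positivity).eq_or_lt with h | h
    · rw [hLd, ← h] at hL0
      simp at hL0
    · exact h
  have hcard : (V.card : ℝ) ≤ Real.exp (d * L) := by
    refine hA.card_le.trans (le_of_eq ?_)
    rw [Real.rpow_def_of_pos hpn, mul_comm]
  -- For empty `P` all support values are `⊥`, and `⊥` plus a real is `⊥`; hence the enlargement,
  -- and with it `A`, is empty. `V` cannot be empty here, since it would generate the whole space.
  rcases P.eq_empty_or_nonempty with hP | hP
  · have hA0 : A = ∅ := by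
      rcases V.eq_empty_or_nonempty with h | ⟨v, hv⟩
      · have := hA.generated.eq_inter
        rw [hP, h] at this
        simp only [Finset.notMem_empty, IsEmpty.forall_iff, implies_true] at this
        have h0 : (0 : Vec p) ∈ (∅ : Set (Vec p)) := by rw [this]; trivial
        simp at h0
      · refine Set.eq_empty_of_forall_notMem fun x hx => ?_
        have := hA.subset_enlarge hx v hv
        simp [hP, supportFun] at this
    rw [hA0]
    simp
    positivity
  set W := V.filter (fun v => supportFun P v ≠ ⊤)
  set c : Vec p → ℝ := fun v => (supportFun P v).toReal
  have hWV : ∀ v ∈ W, v ∈ V := fun v hv => (Finset.mem_filter.1 hv).1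
  have hWc : (W.card : ℝ) ≤ Real.exp (d * L) :=
    le_trans (by exact_mod_cast Finset.card_filter_le _ _) hcard
  have hPe : P = {x | ∀ v ∈ W, ⟪v, x⟫ ≤ c v} := by
    have := enlarge_eq_halfspaces hP V 0
    simp only [add_zero] at this
    rw [← this]
    conv_lhs => rw [hA.generated.eq_inter]
    simp [enlarge]
  have hEe : enlarge P V (a / n) = {x | ∀ v ∈ W, ⟪v, x⟫ ≤ c v + a / n} :=
    enlarge_eq_halfspaces hP V _
  have nz : ∀ (c' : Vec p → ℝ) (δ : ℝ), 0 ≤ δ → (gauss S).real {x | ∀ v ∈ W, ⟪v, x⟫ ≤ c' v + δ} ≤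
      (gauss S).real {x | ∀ v ∈ W, ⟪v, x⟫ ≤ c' v}
        + 8 * Real.sqrt (d + 1) / Real.sqrt b * (δ * Real.sqrt L) := by
    intro c' δ hδ
    -- The level `(d + 1) * L` is used because `d * L` may be smaller than 1.
    have := nazarov hS W c' hb (fun v hv => hV v (hWV v hv)) (L := (d + 1) * L) (by nlinarith)
      (hWc.trans (Real.exp_le_exp.2 (by nlinarith))) hδ
    rw [Real.sqrt_mul (by linarith)] at this
    refine this.trans (le_of_eq ?_)
    ring
  have hfinal : 8 * Real.sqrt (d + 1) / Real.sqrt b * ((a / n + (d + 1) * ε) * Real.sqrt L)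
      + C * (u * L / ε ^ 2) ≤ (8 * (d + 1) * Real.sqrt (d + 1) / Real.sqrt b + C) *
        (a / n * Real.sqrt L + ε * Real.sqrt L + u * L / ε ^ 2) := by
    have h1 : 0 ≤ a / n * Real.sqrt L := by positivity
    have h2 : 0 ≤ ε * Real.sqrt L := by positivity
    have h3 : 0 ≤ u * L / ε ^ 2 := by positivity
    have h4 : 0 ≤ 8 * Real.sqrt (d + 1) / Real.sqrt b := by positivity
    have e : 8 * (d + 1) * Real.sqrt (d + 1) / Real.sqrt b
        = 8 * Real.sqrt (d + 1) / Real.sqrt b * (d + 1) := by ring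
    rw [e]
    generalize 8 * Real.sqrt (d + 1) / Real.sqrt b = k at h4
    generalize u * L / ε ^ 2 = z at h3
    nlinarith [mul_nonneg h4 (mul_nonneg hd.le h1), mul_nonneg h4 (mul_nonneg hd.le h3),
      mul_nonneg h4 h3, mul_nonneg hC.le h1, mul_nonneg hC.le h2]
  have hδ : 0 ≤ a / n + (d + 1) * ε := by positivity
  rw [abs_le]
  constructor
  -- Shrink first under `S`, from `c + a/n` to `c - (d + 1) ε`, and then pass to `T`, which gives
  -- back all but nothing of `P`: the bound becomes `c`.
  · have s1 : (gauss S).real A ≤ (gauss S).real {x | ∀ v ∈ W, ⟪v, x⟫ ≤ c v + a / n} :=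
      measureReal_mono (hEe ▸ hA.subset_enlarge)
    have s2 := nz (fun v => c v - ε - d * ε) (a / n + (d + 1) * ε) hδ
    have s3 := hcomp hS hT W (fun v => c v - ε) hL hWc hε hu
      (fun v hv w hw => by rw [abs_sub_comm]; exact hTS v (hWV v hv) w (hWV w hw))
    have s4 : (gauss T).real {x | ∀ v ∈ W, ⟪v, x⟫ ≤ c v - ε + ε} ≤ (gauss T).real A := by
      refine measureReal_mono ?_
      simp only [sub_add_cancel]
      rw [← hPe]
      exact hA.subset
    have e : ∀ v, c v - ε - d * ε + (a / n + (d + 1) * ε) = c v + a / n := fun v => by ring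
    simp only [e] at s2
    linarith
  -- Pass first from `T` to `S`, enlarging to `c + a/n + (d + 1) ε`, and shrink afterwards. In both
  -- directions anti-concentration is used under `S` only.
  · have s1 : (gauss T).real A ≤ (gauss T).real {x | ∀ v ∈ W, ⟪v, x⟫ ≤ c v + a / n} :=
      measureReal_mono (hEe ▸ hA.subset_enlarge)
    have s2 := nz c (a / n + (d + 1) * ε) hδ
    have s3 := hcomp hT hS W (fun v => c v + a / n + d * ε) hL hWc hε hu
      (fun v hv w hw => hTS v (hWV v hv) w (hWV w hw))
    have s4 : (gauss S).real {x | ∀ v ∈ W, ⟪v, x⟫ ≤ c v} ≤ (gauss S).real A := by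
      refine measureReal_mono ?_
      rw [← hPe]
      exact hA.subset
    have e : ∀ v, c v + a / n + d * ε - d * ε = c v + a / n := fun v => by ring
    have e' : ∀ v, c v + a / n + d * ε + ε = c v + (a / n + (d + 1) * ε) := fun v => by ring
    simp only [e, e'] at s3
    linarith

/-! ### Concentration of the empirical covariance matrix -/

lemma exp_le_one_add_add_sq_mul_exp_abs (y : ℝ) :
    Real.exp y ≤ 1 + y + y ^ 2 * Real.exp |y| := by
  have h := Complex.norm_exp_sub_sum_le_norm_mul_exp (y : ℂ) 2
  rw [Complex.norm_real, Real.norm_eq_abs, sq_abs] at h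
  have e : Complex.exp y - ∑ m ∈ Finset.range 2, (y : ℂ) ^ m / (m.factorial : ℂ)
      = ((Real.exp y - (1 + y) : ℝ) : ℂ) := by
    simp [Finset.sum_range_succ]
  rw [e, Complex.norm_real, Real.norm_eq_abs] at h
  linarith [(abs_le.1 h).2]

/-! ### Exponential inequalities for sums of bounded variables -/

section Bernstein

variable {Ω : Type*} [MeasurableSpace Ω] {μ : Measure Ω} [IsProbabilityMeasure μ]

/-- The bound `τ` serves integrability only. The estimate keeps the exponentially weighted second
moment, which can be far smaller than what `τ` would give. -/
lemma mgf_le_exp_of_bounded {W : Ω → ℝ} (hW : Measurable W) {τ : ℝ} (hb : ∀ ω, |W ω| ≤ τ)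
    (t : ℝ) : mgf W μ t ≤
      Real.exp (t * ∫ ω, W ω ∂μ + t ^ 2 * ∫ ω, W ω ^ 2 * Real.exp (|t| * |W ω|) ∂μ) := by
  have i1 : Integrable W μ := Integrable.of_bound (C := τ) hW.aestronglyMeasurable (ae_of_all _ hb)
  have i2 : Integrable (fun ω => W ω ^ 2 * Real.exp (|t| * |W ω|)) μ := by
    refine Integrable.of_bound (C := τ ^ 2 * Real.exp (|t| * τ))
      (Measurable.aestronglyMeasurable (by fun_prop)) (ae_of_all _ fun ω => ?_)
    rw [Real.norm_eq_abs, abs_mul, abs_pow, Real.abs_exp]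
    have := hb ω
    gcongr
  have i3 : Integrable (fun ω => Real.exp (t * W ω)) μ := by
    refine Integrable.of_bound (C := Real.exp (|t| * τ))
      (Measurable.aestronglyMeasurable (by fun_prop)) (ae_of_all _ fun ω => ?_)
    rw [Real.norm_eq_abs, Real.abs_exp, Real.exp_le_exp]
    calc t * W ω ≤ |t * W ω| := le_abs_self _
      _ = |t| * |W ω| := abs_mul _ _
      _ ≤ |t| * τ := mul_le_mul_of_nonneg_left (hb ω) (abs_nonneg _)
  have i4 : Integrable (fun ω => 1 + t * W ω) μ := (integrable_const 1).add (i1.const_mul t)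
  calc mgf W μ t ≤ ∫ ω, ((1 + t * W ω) + t ^ 2 * (W ω ^ 2 * Real.exp (|t| * |W ω|))) ∂μ := by
        refine integral_mono i3 (i4.add (i2.const_mul _)) fun ω => ?_
        have := exp_le_one_add_add_sq_mul_exp_abs (t * W ω)
        rw [abs_mul] at this
        refine this.trans (le_of_eq ?_)
        ring
    _ = t * ∫ ω, W ω ∂μ + t ^ 2 * ∫ ω, W ω ^ 2 * Real.exp (|t| * |W ω|) ∂μ + 1 := by
        rw [integral_add i4 (i2.const_mul _), integral_add (integrable_const 1) (i1.const_mul t),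
          integral_const_mul, integral_const_mul]
        simp
        ring
    _ ≤ _ := Real.add_one_le_exp _

lemma bernstein_upper {n : ℕ} {W : Fin n → Ω → ℝ} (hW : ∀ i, Measurable (W i))
    (hind : iIndepFun W μ) {τ : ℝ} (hb : ∀ i ω, |W i ω| ≤ τ) {t : ℝ} (ht : 0 ≤ t) {K : ℝ}
    (hK : ∑ i, ∫ ω, W i ω ^ 2 * Real.exp (t * |W i ω|) ∂μ ≤ K) (x : ℝ) :
    μ.real {ω | x ≤ ∑ i, W i ω - ∑ i, ∫ ω, W i ω ∂μ} ≤ Real.exp (-(t * x) + t ^ 2 * K) := by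
  have hint : Integrable (fun ω => Real.exp (t * (∑ i, W i) ω)) μ := by
    refine Integrable.of_bound (C := Real.exp (t * (n * τ)))
      (Measurable.aestronglyMeasurable (by fun_prop)) (ae_of_all _ fun ω => ?_)
    rw [Real.norm_eq_abs, Real.abs_exp, Real.exp_le_exp, Finset.sum_apply]
    refine mul_le_mul_of_nonneg_left ?_ ht
    calc ∑ i, W i ω ≤ ∑ i : Fin n, τ := Finset.sum_le_sum fun i _ => (le_abs_self _).trans (hb i ω)
      _ = n * τ := by simp
  have h := measure_ge_le_exp_mul_mgf (μ := μ) (X := ∑ i, W i) (x + ∑ i, ∫ ω, W i ω ∂μ) ht hint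
  rw [hind.mgf_sum hW] at h
  have hset : {ω | x ≤ ∑ i, W i ω - ∑ i, ∫ ω, W i ω ∂μ}
      = {ω | x + ∑ i, ∫ ω, W i ω ∂μ ≤ (∑ i, W i) ω} := by
    ext ω
    simp only [Set.mem_ofPred_eq, Finset.sum_apply]
    exact le_sub_iff_add_le
  rw [hset]
  refine h.trans ?_
  have hp : ∏ i, mgf (W i) μ t ≤ ∏ i, Real.exp (t * ∫ ω, W i ω ∂μ
      + t ^ 2 * ∫ ω, W i ω ^ 2 * Real.exp (t * |W i ω|) ∂μ) := by
    refine Finset.prod_le_prod (fun i _ => mgf_nonneg) fun i _ => ?_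
    have := mgf_le_exp_of_bounded (μ := μ) (hW i) (hb i) t
    rwa [abs_of_nonneg ht] at this
  rw [← Real.exp_sum, Finset.sum_add_distrib, ← Finset.mul_sum, ← Finset.mul_sum] at hp
  calc _ ≤ Real.exp (-t * (x + ∑ i, ∫ ω, W i ω ∂μ)) * Real.exp (t * ∑ i, ∫ ω, W i ω ∂μ
      + t ^ 2 * ∑ i, ∫ ω, W i ω ^ 2 * Real.exp (t * |W i ω|) ∂μ) := by gcongr
    _ = Real.exp (-(t * x) + t ^ 2 * ∑ i, ∫ ω, W i ω ^ 2 * Real.exp (t * |W i ω|) ∂μ) := by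
        rw [← Real.exp_add]
        congr 1
        ring
    _ ≤ _ := by gcongr

/-- A Bernstein type inequality for sums of bounded independent random variables. -/
lemma bernstein {n : ℕ} {W : Fin n → Ω → ℝ} (hW : ∀ i, Measurable (W i))
    (hind : iIndepFun W μ) {τ : ℝ} (hb : ∀ i ω, |W i ω| ≤ τ) {t : ℝ} (ht : 0 ≤ t) {K : ℝ}
    (hK : ∑ i, ∫ ω, W i ω ^ 2 * Real.exp (t * |W i ω|) ∂μ ≤ K) (x : ℝ) :
    μ.real {ω | x ≤ |∑ i, W i ω - ∑ i, ∫ ω, W i ω ∂μ|} ≤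
      2 * Real.exp (-(t * x) + t ^ 2 * K) := by
  have h1 := bernstein_upper hW hind hb ht hK x
  have h2 := bernstein_upper (W := fun i ω => -W i ω) (μ := μ) (fun i => (hW i).neg)
    (hind.comp (fun _ y => -y) fun _ => measurable_neg) (τ := τ) (by simpa using hb) ht
    (K := K) (by simpa using hK) x
  have hsub : {ω | x ≤ |∑ i, W i ω - ∑ i, ∫ ω, W i ω ∂μ|} ⊆
      {ω | x ≤ ∑ i, W i ω - ∑ i, ∫ ω, W i ω ∂μ} ∪
      {ω | x ≤ ∑ i, -W i ω - ∑ i, ∫ ω, -W i ω ∂μ} := by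
    intro ω hω
    simp only [Set.mem_ofPred_eq, Set.mem_union] at hω ⊢
    rcases le_abs.1 hω with h | h
    · exact Or.inl h
    · refine Or.inr (h.trans (le_of_eq ?_))
      simp only [integral_neg, Finset.sum_neg_distrib]
      ring
  refine (measureReal_mono hsub).trans ((measureReal_union_le _ _).trans ?_)
  linarith

end Bernstein

/-! ### Truncated coordinates and the union bound -/

/-- The truncation of `y` at level `T`. -/
noncomputable def trunc (T y : ℝ) : ℝ := if |y| ≤ T then y else 0

lemma abs_trunc_le {T : ℝ} (hT : 0 ≤ T) (y : ℝ) : |trunc T y| ≤ T := by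
  unfold trunc
  split_ifs with h
  · exact h
  · simpa using hT

lemma measurable_trunc (T : ℝ) : Measurable (trunc T) :=
  Measurable.ite (measurableSet_le (by fun_prop) (by fun_prop)) measurable_id measurable_const

/-- The coordinates of `x` together with the constant `1`. -/
def extCoord {p : ℕ} (x : Vec p) (o : Option (Fin p)) : ℝ := o.elim 1 fun j => x j

lemma measurable_extCoord {p : ℕ} (o : Option (Fin p)) :
    Measurable fun x : Vec p => extCoord x o := by
  cases o with
  | none => exact measurable_const
  | some j => change Measurable fun x : Vec p => x j; fun_prop

lemma sampleCov_apply {n p : ℕ} (hn : 0 < n) (x : Fin n → Vec p) (j k : Fin p) :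
    sampleCov x j k = (n : ℝ)⁻¹ * ∑ i, x i j * x i k
      - ((n : ℝ)⁻¹ * ∑ i, x i j) * ((n : ℝ)⁻¹ * ∑ i, x i k) := by
  have hn' : (n : ℝ) ≠ 0 := by positivity
  have e : ∀ j, ((n : ℝ)⁻¹ • ∑ i, x i) j = (n : ℝ)⁻¹ * ∑ i, x i j := by
    intro j
    simp
  simp only [sampleCov, gram, Matrix.of_apply, PiLp.smul_apply, PiLp.sub_apply, e, smul_eq_mul]
  set a := (n : ℝ)⁻¹ * ∑ i, x i j with ha
  set b := (n : ℝ)⁻¹ * ∑ i, x i k with hb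
  have hs : (Real.sqrt (n : ℝ))⁻¹ * (Real.sqrt (n : ℝ))⁻¹ = (n : ℝ)⁻¹ := by
    rw [← mul_inv, Real.mul_self_sqrt (by positivity)]
  have ea : ∑ i, x i j = n * a := by rw [ha]; field_simp
  have eb : ∑ i, x i k = n * b := by rw [hb]; field_simp
  calc _ = ∑ i, (n : ℝ)⁻¹ * (x i j * x i k - b * x i j - a * x i k + a * b) := by
        refine Finset.sum_congr rfl fun i _ => ?_
        rw [← hs]
        ring
    _ = (n : ℝ)⁻¹ * (∑ i, x i j * x i k - b * ∑ i, x i j - a * ∑ i, x i k + n * (a * b)) := by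
        rw [← Finset.mul_sum, Finset.sum_add_distrib, Finset.sum_sub_distrib,
          Finset.sum_sub_distrib, ← Finset.mul_sum, ← Finset.mul_sum]
        simp
    _ = _ := by
        rw [ea, eb]
        field_simp
        ring

section

variable {Ω : Type*} [MeasurableSpace Ω] {μ : Measure Ω} [IsProbabilityMeasure μ]

/-- Adjoining the constant coordinate 1 turns sample means into further products of coordinates, so
one deviation bound covers both terms of the empirical covariance; the product of two means gives `u
^ 2`. The allowed deviation `n * u` is divided equally between truncation bias and fluctuation, and
`α` equally between truncation and the exponential inequality. -/
lemma sampleCov_concentration {n p : ℕ} (hn : 0 < n) (hp : 3 ≤ p) {X : Fin n → Ω → Vec p}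
    (hX : IsCenteredSample X μ) {T t K u α : ℝ} (hT : 1 ≤ T) (ht : 0 ≤ t)
    (htail : ∀ i, μ.real {ω | ∃ j, T < |X i ω j|} ≤ α / (2 * n))
    (hbias : ∀ o o', |∑ i, ∫ ω, trunc T (extCoord (X i ω) o) * trunc T (extCoord (X i ω) o') ∂μ
      - ∑ i, ∫ ω, extCoord (X i ω) o * extCoord (X i ω) o' ∂μ| ≤ n * u / 2)
    (hsec : ∀ o o', ∑ i, ∫ ω, (trunc T (extCoord (X i ω) o) * trunc T (extCoord (X i ω) o')) ^ 2
      * Real.exp (t * |trunc T (extCoord (X i ω) o) * trunc T (extCoord (X i ω) o')|) ∂μ ≤ K)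
    (hexp : 8 * (p : ℝ) ^ 2 * Real.exp (-(t * (n * u / 2)) + t ^ 2 * K) ≤ α) :
    ∃ G : Set Ω, MeasurableSet G ∧ 1 - α ≤ μ.real G ∧ ∀ ω ∈ G, ∀ j k,
      |(sampleCov fun i => X i ω) j k - avgCov X μ j k| ≤ u + u ^ 2 := by
  have hn' : (0 : ℝ) < n := by exact_mod_cast hn
  have hXm := hX.measurable
  let W : Option (Fin p) → Option (Fin p) → Fin n → Ω → ℝ := fun o o' i ω =>
    trunc T (extCoord (X i ω) o) * trunc T (extCoord (X i ω) o')
  have hφ : ∀ o o', Measurable fun x : Vec p => trunc T (extCoord x o) * trunc T (extCoord x o') :=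
    fun o o' => ((measurable_trunc T).comp (measurable_extCoord o)).mul
      ((measurable_trunc T).comp (measurable_extCoord o'))
  have hW : ∀ o o' i, Measurable (W o o' i) := fun o o' i => (hφ o o').comp (hXm i)
  have hWb : ∀ o o' i ω, |W o o' i ω| ≤ T * T := fun o o' i ω => by
    rw [abs_mul]
    exact mul_le_mul (abs_trunc_le (by linarith) _) (abs_trunc_le (by linarith) _)
      (abs_nonneg _) (by linarith)
  have hWi : ∀ o o', iIndepFun (W o o') μ := fun o o' => hX.indep.comp (fun _ x =>
    trunc T (extCoord x o) * trunc T (extCoord x o')) fun _ => hφ o o'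
  let D : Option (Fin p) × Option (Fin p) → Set Ω := fun z =>
    {ω | n * u / 2 ≤ |∑ i, W z.1 z.2 i ω - ∑ i, ∫ ω, W z.1 z.2 i ω ∂μ|}
  have hDm : ∀ z, MeasurableSet (D z) := fun z =>
    measurableSet_le measurable_const (((Finset.measurable_sum _ fun i _ => hW _ _ i).sub
      measurable_const).norm)
  let R : Fin n → Set Ω := fun i => {ω | ∃ j, T < |X i ω j|}
  have hRm : ∀ i, MeasurableSet (R i) := fun i => by
    have : R i = ⋃ j, {ω | T < |X i ω j|} := by ext ω; simp [R]
    rw [this]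
    refine MeasurableSet.iUnion fun j => measurableSet_lt measurable_const ?_
    have : Measurable fun ω => X i ω j := by fun_prop
    exact this.norm
  let Bad : Set Ω := (⋃ i, R i) ∪ ⋃ z, D z
  have hBm : MeasurableSet Bad :=
    (MeasurableSet.iUnion fun i => hRm i).union (MeasurableSet.iUnion fun z => hDm z)
  have hBad : μ.real Bad ≤ α := by
    have h1 : μ.real (⋃ i, R i) ≤ α / 2 := by
      calc _ ≤ ∑ i, μ.real (R i) := measureReal_iUnion_fintype_le _
        _ ≤ ∑ i : Fin n, α / (2 * n) := Finset.sum_le_sum fun i _ => htail i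
        _ = α / 2 := by simp; field_simp
    have h2 : μ.real (⋃ z, D z) ≤ α / 2 := by
      set E := Real.exp (-(t * (n * u / 2)) + t ^ 2 * K) with hE
      have hE0 : 0 ≤ E := (Real.exp_pos _).le
      calc _ ≤ ∑ z, μ.real (D z) := measureReal_iUnion_fintype_le _
        _ ≤ ∑ z : Option (Fin p) × Option (Fin p), 2 * E := Finset.sum_le_sum fun z _ =>
            bernstein (hW z.1 z.2) (hWi z.1 z.2) (hWb z.1 z.2) ht (hsec z.1 z.2) _
        _ = ((p : ℝ) + 1) ^ 2 * (2 * E) := by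
            rw [Finset.sum_const, Finset.card_univ, Fintype.card_prod, Fintype.card_option,
              Fintype.card_fin, nsmul_eq_mul]
            push_cast
            ring
        -- `(p + 1) ^ 2 ≤ 2 * p ^ 2` since `3 ≤ p`.
        _ ≤ (2 * (p : ℝ) ^ 2) * (2 * E) := by
            refine mul_le_mul_of_nonneg_right ?_ (by positivity)
            have : (3 : ℝ) ≤ p := by exact_mod_cast hp
            nlinarith
        _ = 8 * (p : ℝ) ^ 2 * E / 2 := by ring
        _ ≤ α / 2 := by linarith
    refine (measureReal_union_le _ _).trans ?_
    linarith
  refine ⟨Badᶜ, hBm.compl, ?_, fun ω hω j k => ?_⟩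
  · rw [probReal_compl_eq_one_sub hBm]
    linarith
  have hR : ∀ i j, |X i ω j| ≤ T := fun i j => by
    by_contra hcon
    exact hω (Or.inl (Set.mem_iUnion.2 ⟨i, j, not_le.1 hcon⟩))
  have htr : ∀ i o, trunc T (extCoord (X i ω) o) = extCoord (X i ω) o := fun i o => by
    unfold trunc
    rw [if_pos]
    cases o with
    | none => simpa [extCoord] using hT
    | some j => exact hR i j
  have hdev : ∀ o o', |∑ i, extCoord (X i ω) o * extCoord (X i ω) o'
      - ∑ i, ∫ ω, extCoord (X i ω) o * extCoord (X i ω) o' ∂μ| ≤ n * u := fun o o' => by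
    have h1 : ¬ (n * u / 2 ≤ |∑ i, W o o' i ω - ∑ i, ∫ ω, W o o' i ω ∂μ|) := fun h =>
      hω (Or.inr (Set.mem_iUnion.2 ⟨(o, o'), h⟩))
    have h2 := hbias o o'
    simp only [W, htr] at h1
    push Not at h1
    rw [abs_le] at h2 ⊢
    rw [abs_lt] at h1
    constructor <;> linarith [h1.1, h1.2, h2.1, h2.2]
  have hmean : ∀ j, |(n : ℝ)⁻¹ * ∑ i, X i ω j| ≤ u := fun j => by
    have := hdev (some j) none
    simp only [extCoord, Option.elim_some, Option.elim_none, mul_one, hX.centered,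
      Finset.sum_const_zero, sub_zero] at this
    rw [abs_mul, abs_of_pos (inv_pos.2 hn'), inv_mul_le_iff₀ hn']
    exact this
  have hprod : |(n : ℝ)⁻¹ * ∑ i, X i ω j * X i ω k - avgCov X μ j k| ≤ u := by
    have := hdev (some j) (some k)
    simp only [extCoord, Option.elim_some] at this
    have e : avgCov X μ j k = (n : ℝ)⁻¹ * ∑ i, ∫ ω, X i ω j * X i ω k ∂μ := by
      simp [avgCov, secondMoment, Matrix.sum_apply]
    rw [e, ← mul_sub, abs_mul, abs_of_pos (inv_pos.2 hn'), inv_mul_le_iff₀ hn']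
    exact this
  rw [sampleCov_apply hn]
  have h3 : |((n : ℝ)⁻¹ * ∑ i, X i ω j) * ((n : ℝ)⁻¹ * ∑ i, X i ω k)| ≤ u ^ 2 := by
    rw [abs_mul, sq]
    exact mul_le_mul (hmean j) (hmean k) (abs_nonneg _) ((abs_nonneg _).trans (hmean j))
  rw [abs_le] at hprod h3 ⊢
  constructor <;> linarith [hprod.1, hprod.2, h3.1, h3.2]

end

/-! ### Truncation bounds -/

lemma abs_trunc_le_abs (T y : ℝ) : |trunc T y| ≤ |y| := by
  unfold trunc
  split_ifs
  · exact le_rfl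
  · simp

/-- Half of the exponent `m / B` dominates the square and the other half yields the decay in `T`. -/
lemma sq_le_exp_tail {B T m : ℝ} (hB : 0 < B) (hm : 0 ≤ m) (hTm : T ≤ m) :
    m ^ 2 ≤ 8 * B ^ 2 * Real.exp (-(T / (2 * B))) * Real.exp (m / B) := by
  have h1 := Real.pow_div_factorial_le_exp (m / (2 * B)) (by positivity) 2
  have h2 : m ^ 2 ≤ 8 * B ^ 2 * Real.exp (m / (2 * B)) := by
    have e : (m / (2 * B)) ^ 2 / (Nat.factorial 2 : ℝ) = m ^ 2 / (8 * B ^ 2) := by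
      simp [Nat.factorial]
      field_simp
      norm_num
    rw [e, div_le_iff₀ (by positivity)] at h1
    linarith
  refine h2.trans ?_
  rw [mul_assoc _ (Real.exp _) (Real.exp _), ← Real.exp_add]
  refine mul_le_mul_of_nonneg_left (Real.exp_le_exp.2 ?_) (by positivity)
  have : T / (2 * B) ≤ m / (2 * B) := by gcongr
  have e : m / B = m / (2 * B) + m / (2 * B) := by field_simp; norm_num
  linarith

/-- If truncation changes the product, the product becomes 0 and the error `|f * g|` is at most the
square of the larger factor, which is at least `T`. Moment bounds then need only one variable at a
time. -/
lemma trunc_mul_trunc_cases (T f g : ℝ) :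
    trunc T f * trunc T g = f * g ∨
      ∃ m, (m = |f| ∨ m = |g|) ∧ T ≤ m ∧ |trunc T f * trunc T g - f * g| ≤ m ^ 2 := by
  by_cases hf : |f| ≤ T
  · by_cases hg : |g| ≤ T
    · left
      simp [trunc, hf, hg]
    · right
      have hg' := not_le.1 hg
      refine ⟨|g|, Or.inr rfl, hg'.le, ?_⟩
      simp only [trunc, hg, if_false, mul_zero, zero_sub, abs_neg, abs_mul, sq]
      exact mul_le_mul_of_nonneg_right (hf.trans hg'.le) (abs_nonneg _)
  · right
    have hf' := not_le.1 hf
    simp only [trunc, hf, if_false, zero_mul, zero_sub, abs_neg, abs_mul, sq]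
    rcases le_total |f| |g| with h | h
    · exact ⟨|g|, Or.inr rfl, hf'.le.trans h, mul_le_mul_of_nonneg_right h (abs_nonneg _)⟩
    · exact ⟨|f|, Or.inl rfl, hf'.le, mul_le_mul_of_nonneg_left h (abs_nonneg _)⟩

lemma abs_trunc_mul_sub_le_exp {B : ℝ} (hB : 0 < B) (T f g : ℝ) :
    |trunc T f * trunc T g - f * g| ≤ 8 * B ^ 2 * Real.exp (-(T / (2 * B))) *
      (Real.exp (|f| / B) + Real.exp (|g| / B)) := by
  rcases trunc_mul_trunc_cases T f g with h | ⟨m, hm, hTm, h⟩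
  · rw [h, sub_self, abs_zero]
    positivity
  · have hm0 : 0 ≤ m := by rcases hm with rfl | rfl <;> exact abs_nonneg _
    refine h.trans ((sq_le_exp_tail hB hm0 hTm).trans ?_)
    refine mul_le_mul_of_nonneg_left ?_ (by positivity)
    rcases hm with rfl | rfl
    · linarith [Real.exp_pos (|g| / B)]
    · linarith [Real.exp_pos (|f| / B)]

lemma abs_trunc_mul_sub_le_rpow {T q : ℝ} (hT : 0 < T) (hq : 2 ≤ q) (f g : ℝ) :
    |trunc T f * trunc T g - f * g| ≤ T ^ (2 - q) * (|f| ^ q + |g| ^ q) := by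
  rcases trunc_mul_trunc_cases T f g with h | ⟨m, hm, hTm, h⟩
  · rw [h, sub_self, abs_zero]
    positivity
  · have hm0 : 0 < m := hT.trans_le hTm
    have h2 : m ^ 2 ≤ T ^ (2 - q) * m ^ q := by
      calc m ^ 2 = m ^ (2 - q) * m ^ q := by
            rw [← Real.rpow_add hm0, sub_add_cancel]
            norm_num
        _ ≤ T ^ (2 - q) * m ^ q := by
            refine mul_le_mul_of_nonneg_right ?_ (by positivity)
            exact Real.rpow_le_rpow_of_nonpos hT hTm (by linarith)
    refine h.trans (h2.trans ?_)
    refine mul_le_mul_of_nonneg_left ?_ (by positivity)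
    rcases hm with rfl | rfl
    · linarith [Real.rpow_nonneg (abs_nonneg g) q]
    · linarith [Real.rpow_nonneg (abs_nonneg f) q]

lemma sq_trunc_mul_le (T f g : ℝ) :
    (trunc T f * trunc T g) ^ 2 ≤ 1 / 2 * (f ^ 4 + g ^ 4) := by
  have h : ∀ y, trunc T y ^ 2 ≤ y ^ 2 := fun y => sq_le_sq.2 (abs_trunc_le_abs T y)
  calc (trunc T f * trunc T g) ^ 2 = trunc T f ^ 2 * trunc T g ^ 2 := by ring
    _ ≤ f ^ 2 * g ^ 2 := mul_le_mul (h f) (h g) (sq_nonneg _) (sq_nonneg _)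
    _ ≤ _ := by nlinarith [sq_nonneg (f ^ 2 - g ^ 2)]

lemma sq_trunc_mul_exp_le_of_le {T t c : ℝ} {f g : ℝ}
    (h : t * |trunc T f * trunc T g| ≤ c) :
    (trunc T f * trunc T g) ^ 2 * Real.exp (t * |trunc T f * trunc T g|)
      ≤ Real.exp c / 2 * (f ^ 4 + g ^ 4) := by
  calc _ ≤ (1 / 2 * (f ^ 4 + g ^ 4)) * Real.exp c :=
        mul_le_mul (sq_trunc_mul_le T f g) (Real.exp_le_exp.2 h) (Real.exp_pos _).le
          (by positivity)
    _ = _ := by ring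

/-- Let `m` be the larger truncated factor; then `t * |product| ≤ m / (B * L)`. For `m ≤ 4 * B * L`
the exponential is at most `exp 4`. For larger `m`, a quarter of `m / B` absorbs `m ^ 4` (with `4! *
4 ^ 4 = 6144`), half absorbs the exponential weight as `2 ≤ L`, and the last quarter exceeds `L`. -/
lemma sq_trunc_mul_exp_le {B T t L : ℝ} (hB : 0 < B) (hT : 0 ≤ T) (ht : 0 ≤ t) (hL : 2 ≤ L)
    (htT : t * T * B * L ≤ 1) (f g : ℝ) :
    (trunc T f * trunc T g) ^ 2 * Real.exp (t * |trunc T f * trunc T g|)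
      ≤ Real.exp 4 / 2 * (f ^ 4 + g ^ 4) + 6144 * B ^ 4 * Real.exp (-L) *
        (Real.exp (|f| / B) + Real.exp (|g| / B)) := by
  set m := max |trunc T f| |trunc T g| with hm
  have hm0 : 0 ≤ m := (abs_nonneg _).trans (le_max_left _ _)
  have hmT : m ≤ T := max_le (abs_trunc_le hT f) (abs_trunc_le hT g)
  have hab : |trunc T f * trunc T g| ≤ m * m := by
    rw [abs_mul]
    exact mul_le_mul (le_max_left _ _) (le_max_right _ _) (abs_nonneg _) hm0
  have hL0 : 0 < L := by linarith
  have htm : t * |trunc T f * trunc T g| ≤ m / (B * L) := by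
    rw [le_div_iff₀ (by positivity)]
    calc t * |trunc T f * trunc T g| * (B * L) ≤ t * (m * T) * (B * L) := by
          refine mul_le_mul_of_nonneg_right (mul_le_mul_of_nonneg_left ?_ ht) (by positivity)
          exact hab.trans (mul_le_mul_of_nonneg_left hmT hm0)
      _ = (t * T * B * L) * m := by ring
      _ ≤ 1 * m := mul_le_mul_of_nonneg_right htT hm0
      _ = m := one_mul m
  rcases le_or_gt m (4 * (B * L)) with h | h
  · have h4 : t * |trunc T f * trunc T g| ≤ 4 :=
      htm.trans ((div_le_iff₀ (by positivity)).2 h)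
    have := sq_trunc_mul_exp_le_of_le h4
    have h0 : 0 ≤ 6144 * B ^ 4 * Real.exp (-L) *
        (Real.exp (|f| / B) + Real.exp (|g| / B)) := by positivity
    linarith
  · have h1 := Real.pow_div_factorial_le_exp (m / (4 * B)) (by positivity) 4
    have h2 : m ^ 4 ≤ 6144 * B ^ 4 * Real.exp (m / (4 * B)) := by
      have e : (m / (4 * B)) ^ 4 / (Nat.factorial 4 : ℝ) = m ^ 4 / (6144 * B ^ 4) := by
        simp [Nat.factorial]
        field_simp
        ring
      rw [e, div_le_iff₀ (by positivity)] at h1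
      linarith
    have h3 : (trunc T f * trunc T g) ^ 2 ≤ m ^ 4 := by
      rw [← sq_abs]
      calc _ ≤ (m * m) ^ 2 := by gcongr
        _ = m ^ 4 := by ring
    have h4 : m / (B * L) ≤ m / (2 * B) := by
      refine div_le_div_of_nonneg_left hm0 (by positivity) ?_
      nlinarith
    have h5 : m / (4 * B) + m / (2 * B) ≤ -L + m / B := by
      have : L ≤ m / (4 * B) := by
        rw [le_div_iff₀ (by positivity)]
        linarith
      have e : m / B = m / (4 * B) + m / (4 * B) + m / (2 * B) := by field_simp; ring
      linarith
    have h6 : Real.exp (m / B) ≤ Real.exp (|f| / B) + Real.exp (|g| / B) := by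
      rcases max_choice |trunc T f| |trunc T g| with hc | hc
      · have : Real.exp (m / B) ≤ Real.exp (|f| / B) := by
          rw [hm, hc]
          exact Real.exp_le_exp.2 (div_le_div_of_nonneg_right (abs_trunc_le_abs T f) hB.le)
        linarith [Real.exp_pos (|g| / B)]
      · have : Real.exp (m / B) ≤ Real.exp (|g| / B) := by
          rw [hm, hc]
          exact Real.exp_le_exp.2 (div_le_div_of_nonneg_right (abs_trunc_le_abs T g) hB.le)
        linarith [Real.exp_pos (|f| / B)]
    have h0 : 0 ≤ Real.exp 4 / 2 * (f ^ 4 + g ^ 4) := by positivity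
    calc _ ≤ (6144 * B ^ 4 * Real.exp (m / (4 * B))) * Real.exp (m / (2 * B)) :=
          mul_le_mul (h3.trans h2) (Real.exp_le_exp.2 (htm.trans h4)) (Real.exp_pos _).le
            (by positivity)
      _ = 6144 * B ^ 4 * Real.exp (m / (4 * B) + m / (2 * B)) := by
          rw [Real.exp_add]; ring
      _ ≤ 6144 * B ^ 4 * (Real.exp (-L) * Real.exp (m / B)) := by
          rw [← Real.exp_add]
          gcongr
      _ ≤ 6144 * B ^ 4 * (Real.exp (-L) * (Real.exp (|f| / B) + Real.exp (|g| / B))) := by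
          gcongr
      _ ≤ _ := by linarith

/-! ### Moments of the extended coordinates -/

section

variable {Ω : Type*} [MeasurableSpace Ω]

lemma integrable_of_lintegral_ofReal_le {μ : Measure Ω} {h : Ω → ℝ} (hm : Measurable h) (h0 : ∀ ω, 0 ≤ h ω)
    {c : ℝ} (hc : 0 ≤ c) (hl : ∫⁻ ω, ENNReal.ofReal (h ω) ∂μ ≤ ENNReal.ofReal c) :
    Integrable h μ ∧ ∫ ω, h ω ∂μ ≤ c := by
  refine ⟨⟨hm.aestronglyMeasurable, ?_⟩, ?_⟩
  · rw [hasFiniteIntegral_iff_ofReal (ae_of_all _ h0)]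
    exact hl.trans_lt ENNReal.ofReal_lt_top
  · rw [integral_eq_lintegral_of_nonneg_ae (ae_of_all _ h0) hm.aestronglyMeasurable]
    exact ENNReal.toReal_le_of_le_ofReal hc hl

variable {μ : Measure Ω} [IsProbabilityMeasure μ] {n p : ℕ} {X : Fin n → Ω → Vec p}

lemma measurable_extCoord_comp (hX : ∀ i, Measurable (X i)) (i : Fin n) (o : Option (Fin p)) :
    Measurable fun ω => extCoord (X i ω) o := (measurable_extCoord o).comp (hX i)

lemma fourth_moment_extCoord (hn : 0 < n) (hX : ∀ i, Measurable (X i)) {B : ℝ} (hB : 1 ≤ B)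
    (h : CondM2 B X μ) (o : Option (Fin p)) :
    (∀ i, Integrable (fun ω => extCoord (X i ω) o ^ 4) μ) ∧
      ∑ i, ∫ ω, extCoord (X i ω) o ^ 4 ∂μ ≤ n * B ^ 2 := by
  have hn' : (0 : ℝ) < n := by exact_mod_cast hn
  cases o with
  | none =>
    simp only [extCoord, Option.elim_none, one_pow]
    refine ⟨fun i => integrable_const 1, ?_⟩
    simp only [integral_const, probReal_univ, smul_eq_mul, mul_one, Finset.sum_const,
      Finset.card_univ, Fintype.card_fin, nsmul_eq_mul]
    exact le_mul_of_one_le_right hn'.le (one_le_pow₀ hB)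
  | some j =>
    have h2 := h j 2 (by simp)
    have hXj : ∀ i, Measurable fun ω => |X i ω j| ^ (2 + 2) := fun i => by
      have : Measurable fun ω => X i ω j := by fun_prop
      exact this.norm.pow_const _
    have hs : ∑ i, ∫⁻ ω, ENNReal.ofReal (|X i ω j| ^ (2 + 2)) ∂μ ≤
        ENNReal.ofReal (n * B ^ 2) := by
      rw [ENNReal.ofReal_mul hn'.le, ENNReal.ofReal_natCast]
      exact (ENNReal.inv_mul_le_iff (by simpa using hn.ne') (by simp)).1 h2
    have hi : ∀ i, Integrable (fun ω => |X i ω j| ^ (2 + 2)) μ := fun i =>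
      (integrable_of_lintegral_ofReal_le (hXj i) (fun ω => by positivity) (by positivity)
        ((Finset.single_le_sum (f := fun i => ∫⁻ ω, ENNReal.ofReal (|X i ω j| ^ (2 + 2)) ∂μ)
          (fun _ _ => zero_le) (Finset.mem_univ i)).trans hs)).1
    have e : ∀ i, (fun ω => extCoord (X i ω) (some j) ^ 4) = fun ω => |X i ω j| ^ (2 + 2) :=
      fun i => by
        ext ω
        simp only [extCoord, Option.elim_some]
        rw [show (2 + 2 : ℕ) = 4 from rfl, Even.pow_abs (by decide)]
    simp_rw [e]
    refine ⟨hi, ?_⟩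
    rw [← ENNReal.ofReal_le_ofReal_iff (by positivity),
      ENNReal.ofReal_sum_of_nonneg fun i _ => integral_nonneg fun ω => by positivity]
    rw [Finset.sum_congr rfl fun i _ =>
      ofReal_integral_eq_lintegral_ofReal (hi i) (ae_of_all _ fun ω => by positivity)]
    exact hs

lemma exp_moment_extCoord (hX : ∀ i, Measurable (X i)) {B : ℝ} (hB : 1 ≤ B)
    (h : CondE1 B X μ) (i : Fin n) (o : Option (Fin p)) :
    Integrable (fun ω => Real.exp (|extCoord (X i ω) o| / B)) μ ∧
      ∫ ω, Real.exp (|extCoord (X i ω) o| / B) ∂μ ≤ 3 := by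
  cases o with
  | none =>
    simp only [extCoord, Option.elim_none, abs_one]
    refine ⟨integrable_const _, ?_⟩
    simp only [integral_const, probReal_univ, smul_eq_mul, one_mul]
    calc Real.exp (1 / B) ≤ Real.exp 1 :=
          Real.exp_le_exp.2 (by rw [div_le_one (by linarith)]; exact hB)
      _ ≤ 3 := Real.exp_one_lt_d9.le.trans (by norm_num)
  | some j =>
    have hXj : Measurable fun ω => X i ω j := by have := hX i; fun_prop
    refine integrable_of_lintegral_ofReal_le ?_ (fun ω => (Real.exp_pos _).le) (by norm_num) ?_
    · exact (hXj.norm.div_const B).exp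
    · refine (h i j).trans ?_
      rw [show (2 : ℝ≥0∞) = ENNReal.ofReal 2 by simp]
      exact ENNReal.ofReal_le_ofReal (by norm_num)

lemma rpow_moment_extCoord (hX : ∀ i, Measurable (X i)) {B q : ℝ} (hB : 1 ≤ B) (hq : 0 < q)
    (h : CondE2 B q X μ) (i : Fin n) (o : Option (Fin p)) :
    Integrable (fun ω => |extCoord (X i ω) o| ^ q) μ ∧
      ∫ ω, |extCoord (X i ω) o| ^ q ∂μ ≤ 3 * B ^ q := by
  have hB0 : 0 < B := by linarith
  cases o with
  | none =>
    simp only [extCoord, Option.elim_none, abs_one, Real.one_rpow]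
    refine ⟨integrable_const _, ?_⟩
    simp
    linarith [Real.one_le_rpow hB hq.le]
  | some j =>
    have hXj : Measurable fun ω => X i ω j := by have := hX i; fun_prop
    have hm : Measurable fun ω => |extCoord (X i ω) (some j)| ^ q := hXj.norm.pow_const q
    refine integrable_of_lintegral_ofReal_le hm (fun ω => by positivity) (by positivity) ?_
    calc ∫⁻ ω, ENNReal.ofReal (|extCoord (X i ω) (some j)| ^ q) ∂μ
        ≤ ∫⁻ ω, ENNReal.ofReal (B ^ q) * ENNReal.ofReal (((⨆ j, |X i ω j|) / B) ^ q) ∂μ := by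
          refine lintegral_mono fun ω => ?_
          rw [← ENNReal.ofReal_mul (by positivity)]
          refine ENNReal.ofReal_le_ofReal ?_
          have hs : |X i ω j| ≤ ⨆ j, |X i ω j| :=
            le_ciSup (f := fun j => |X i ω j|) (Set.finite_range _).bddAbove j
          have hs0 : 0 ≤ ⨆ j, |X i ω j| := (abs_nonneg _).trans hs
          rw [← Real.mul_rpow hB0.le (by positivity), mul_div_cancel₀ _ hB0.ne']
          exact Real.rpow_le_rpow (abs_nonneg _) hs hq.le
      _ = ENNReal.ofReal (B ^ q) * ∫⁻ ω, ENNReal.ofReal (((⨆ j, |X i ω j|) / B) ^ q) ∂μ :=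
          lintegral_const_mul' _ _ ENNReal.ofReal_ne_top
      _ ≤ ENNReal.ofReal (B ^ q) * ENNReal.ofReal 3 := by
          gcongr
          refine (h i).trans ?_
          rw [show (2 : ℝ≥0∞) = ENNReal.ofReal 2 by simp]
          exact ENNReal.ofReal_le_ofReal (by norm_num)
      _ = ENNReal.ofReal (3 * B ^ q) := by
          rw [← ENNReal.ofReal_mul (by positivity), mul_comm]

lemma integrable_trunc_mul (hX : ∀ i, Measurable (X i)) {T : ℝ} (hT : 0 ≤ T) (i : Fin n)
    (o o' : Option (Fin p)) :
    Integrable (fun ω => trunc T (extCoord (X i ω) o) * trunc T (extCoord (X i ω) o')) μ := by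
  refine Integrable.of_bound (C := T * T) ?_ (ae_of_all _ fun ω => ?_)
  · exact (((measurable_trunc T).comp (measurable_extCoord_comp hX i o)).mul
      ((measurable_trunc T).comp (measurable_extCoord_comp hX i o'))).aestronglyMeasurable
  · rw [Real.norm_eq_abs, abs_mul]
    exact mul_le_mul (abs_trunc_le hT _) (abs_trunc_le hT _) (abs_nonneg _) hT

lemma memLp_extCoord (hX : IsCenteredSample X μ) (i : Fin n) (o : Option (Fin p)) :
    MemLp (fun ω => extCoord (X i ω) o) 2 μ := by
  cases o with
  | none => exact memLp_const 1
  | some j => exact hX.memLp i j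

/-- The function `φ` stands for whichever moment is available: the exponential under `CondE1`, the
`q`-th power under `CondE2`. -/
lemma bias_le (hX : IsCenteredSample X μ) {T : ℝ} (hT : 0 ≤ T) (o o' : Option (Fin p))
    {c k : ℝ} {φ : ℝ → ℝ} (hc : 0 ≤ c)
    (hφ : ∀ i o, Integrable (fun ω => φ (extCoord (X i ω) o)) μ ∧
      ∫ ω, φ (extCoord (X i ω) o) ∂μ ≤ k)
    (h : ∀ f g, |trunc T f * trunc T g - f * g| ≤ c * (φ f + φ g)) :
    |∑ i, ∫ ω, trunc T (extCoord (X i ω) o) * trunc T (extCoord (X i ω) o') ∂μ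
      - ∑ i, ∫ ω, extCoord (X i ω) o * extCoord (X i ω) o' ∂μ| ≤ n * (c * (2 * k)) := by
  rw [← Finset.sum_sub_distrib]
  refine (Finset.abs_sum_le_sum_abs _ _).trans ?_
  calc _ ≤ ∑ i : Fin n, c * (2 * k) := by
        refine Finset.sum_le_sum fun i _ => ?_
        have hi : Integrable (fun ω => extCoord (X i ω) o * extCoord (X i ω) o') μ :=
          (memLp_extCoord hX i o).integrable_mul (memLp_extCoord hX i o')
        rw [← integral_sub (integrable_trunc_mul hX.measurable hT i o o') hi,
          ← Real.norm_eq_abs]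
        refine (norm_integral_le_of_norm_le (((hφ i o).1.add (hφ i o').1).const_mul c)
          (ae_of_all _ fun ω => h _ _)).trans ?_
        rw [integral_const_mul]
        simp only [Pi.add_apply]
        rw [integral_add (hφ i o).1 (hφ i o').1]
        refine mul_le_mul_of_nonneg_left ?_ hc
        linarith [(hφ i o).2, (hφ i o').2]
    _ = _ := by simp

lemma second_moment_le (hX : ∀ i, Measurable (X i)) (hn : 0 < n) {B : ℝ} (hB : 1 ≤ B)
    (hM2 : CondM2 B X μ) {T t : ℝ} (hT : 0 ≤ T) (ht : 0 ≤ t) (o o' : Option (Fin p))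
    {c₁ c k : ℝ} {φ : ℝ → ℝ} (hc₁ : 0 ≤ c₁) (hc : 0 ≤ c)
    (hφ : ∀ i o, Integrable (fun ω => φ (extCoord (X i ω) o)) μ ∧
      ∫ ω, φ (extCoord (X i ω) o) ∂μ ≤ k)
    (h : ∀ f g, (trunc T f * trunc T g) ^ 2 * Real.exp (t * |trunc T f * trunc T g|)
      ≤ c₁ * (f ^ 4 + g ^ 4) + c * (φ f + φ g)) :
    ∑ i, ∫ ω, (trunc T (extCoord (X i ω) o) * trunc T (extCoord (X i ω) o')) ^ 2
      * Real.exp (t * |trunc T (extCoord (X i ω) o) * trunc T (extCoord (X i ω) o')|) ∂μ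
      ≤ c₁ * (2 * (n * B ^ 2)) + n * (c * (2 * k)) := by
  obtain ⟨i4, s4⟩ := fourth_moment_extCoord hn hX hB hM2 o
  obtain ⟨i4', s4'⟩ := fourth_moment_extCoord hn hX hB hM2 o'
  have hm : ∀ i, Measurable fun ω =>
      trunc T (extCoord (X i ω) o) * trunc T (extCoord (X i ω) o') := fun i =>
    ((measurable_trunc T).comp (measurable_extCoord_comp hX i o)).mul
      ((measurable_trunc T).comp (measurable_extCoord_comp hX i o'))
  have hb : ∀ i ω, |trunc T (extCoord (X i ω) o) * trunc T (extCoord (X i ω) o')| ≤ T * T :=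
    fun i ω => by
      rw [abs_mul]
      exact mul_le_mul (abs_trunc_le hT _) (abs_trunc_le hT _) (abs_nonneg _) hT
  calc _ ≤ ∑ i, (c₁ * (∫ ω, extCoord (X i ω) o ^ 4 ∂μ + ∫ ω, extCoord (X i ω) o' ^ 4 ∂μ)
          + c * (2 * k)) := by
        refine Finset.sum_le_sum fun i _ => ?_
        have j1 : Integrable (fun ω => c₁ * (extCoord (X i ω) o ^ 4 + extCoord (X i ω) o' ^ 4)) μ :=
          ((i4 i).add (i4' i)).const_mul c₁
        have j2 : Integrable (fun ω => c * (φ (extCoord (X i ω) o) + φ (extCoord (X i ω) o'))) μ :=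
          ((hφ i o).1.add (hφ i o').1).const_mul c
        have j0 : Integrable (fun ω => (trunc T (extCoord (X i ω) o) *
            trunc T (extCoord (X i ω) o')) ^ 2 * Real.exp (t * |trunc T (extCoord (X i ω) o) *
            trunc T (extCoord (X i ω) o')|)) μ := by
          refine Integrable.of_bound (C := (T * T) ^ 2 * Real.exp (t * (T * T)))
            (((hm i).pow_const 2).mul ((hm i).norm.const_mul t).exp).aestronglyMeasurable
            (ae_of_all _ fun ω => ?_)
          rw [Real.norm_eq_abs, abs_mul, abs_pow, Real.abs_exp]
          have := hb i ω
          gcongr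
        refine (integral_mono j0 (j1.add j2) fun ω => h _ _).trans ?_
        simp only [Pi.add_apply]
        rw [integral_add j1 j2, integral_const_mul, integral_const_mul,
          integral_add (i4 i) (i4' i), integral_add (hφ i o).1 (hφ i o').1]
        gcongr
        linarith [(hφ i o).2, (hφ i o').2]
    _ = c₁ * (∑ i, ∫ ω, extCoord (X i ω) o ^ 4 ∂μ + ∑ i, ∫ ω, extCoord (X i ω) o' ^ 4 ∂μ)
        + n * (c * (2 * k)) := by
        rw [Finset.sum_add_distrib, ← Finset.mul_sum, Finset.sum_add_distrib]
        simp
    _ ≤ _ := by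
        have : c₁ * (∑ i, ∫ ω, extCoord (X i ω) o ^ 4 ∂μ + ∑ i, ∫ ω, extCoord (X i ω) o' ^ 4 ∂μ)
          ≤ c₁ * (2 * (n * B ^ 2)) := mul_le_mul_of_nonneg_left (by linarith) hc₁
        linarith

end

/-! ### Concentration under the moment conditions -/

/-- For use with `exp (-3 L) * α`, where `exp (-L) = (p * n)⁻¹`: three such factors absorb the union
bound over pairs of coordinates. -/
lemma eight_mul_sq_mul_le {p n α E : ℝ} (hp : 3 ≤ p) (hn : 4 ≤ n) (hα : 0 ≤ α)
    (hE : E ≤ (p * n)⁻¹ * (p * n)⁻¹ * (p * n)⁻¹ * α) : 8 * p ^ 2 * E ≤ α := by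
  have hp0 : p ≠ 0 := by linarith
  have hn0 : n ≠ 0 := by linarith
  calc _ ≤ 8 * p ^ 2 * ((p * n)⁻¹ * (p * n)⁻¹ * (p * n)⁻¹ * α) := by gcongr
    _ = (8 / (p * n)) * (1 / (n * n)) * α := by field_simp
    _ ≤ 1 * 1 * α := by
        gcongr
        · rw [div_le_one (by nlinarith)]
          nlinarith
        · rw [div_le_one (by nlinarith)]
          nlinarith
    _ = α := by ring

section

variable {Ω : Type*} [MeasurableSpace Ω] {μ : Measure Ω} [IsProbabilityMeasure μ] {n p : ℕ}
  {X : Fin n → Ω → Vec p}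

lemma tail_le_of_exp_moment (hX : ∀ i, Measurable (X i)) {B : ℝ} (hB : 1 ≤ B)
    (h : CondE1 B X μ) (i : Fin n) (T : ℝ) :
    μ.real {ω | ∃ j, T < |X i ω j|} ≤ p * (3 * Real.exp (-(T / B))) := by
  have hB0 : 0 < B := by linarith
  have hsub : {ω | ∃ j, T < |X i ω j|} ⊆ ⋃ j, {ω | Real.exp (T / B) ≤
      Real.exp (|extCoord (X i ω) (some j)| / B)} := by
    rintro ω ⟨j, hj⟩
    refine Set.mem_iUnion.2 ⟨j, Real.exp_le_exp.2 ?_⟩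
    exact div_le_div_of_nonneg_right hj.le hB0.le
  refine (measureReal_mono hsub).trans ((measureReal_iUnion_fintype_le _).trans ?_)
  calc _ ≤ ∑ j : Fin p, 3 * Real.exp (-(T / B)) := by
        refine Finset.sum_le_sum fun j _ => ?_
        obtain ⟨hi, hl⟩ := exp_moment_extCoord hX hB h i (some j)
        have := mul_meas_ge_le_integral_of_nonneg (ae_of_all _ fun ω => (Real.exp_pos _).le) hi
          (Real.exp (T / B))
        rw [Real.exp_neg, ← div_eq_mul_inv, le_div_iff₀ (Real.exp_pos _), mul_comm]
        exact this.trans hl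
    _ = _ := by simp

lemma tail_le_of_rpow_moment (hX : ∀ i, Measurable (X i)) {B q : ℝ} (hB : 1 ≤ B) (hq : 0 < q)
    (h : CondE2 B q X μ) (i : Fin n) {Y : ℝ} (hY : 0 < Y) :
    μ.real {ω | ∃ j, B * Y < |X i ω j|} ≤ 2 / Y ^ q := by
  have hB0 : 0 < B := by linarith
  have hm : Measurable fun ω => ((⨆ j, |X i ω j|) / B) ^ q := by
    refine (Measurable.div_const (Measurable.iSup fun j => ?_) B).pow_const q
    have : Measurable fun ω => X i ω j := by have := hX i; fun_prop
    exact this.norm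
  have hs0 : ∀ ω, 0 ≤ ⨆ j, |X i ω j| := fun ω => Real.iSup_nonneg fun j => abs_nonneg _
  have h0 : ∀ ω, 0 ≤ ((⨆ j, |X i ω j|) / B) ^ q := fun ω =>
    Real.rpow_nonneg (div_nonneg (hs0 ω) hB0.le) q
  obtain ⟨hi, hl⟩ := integrable_of_lintegral_ofReal_le hm h0 (c := 2) (by norm_num)
    (by simpa using h i)
  have hsub : {ω | ∃ j, B * Y < |X i ω j|} ⊆
      {ω | Y ^ q ≤ ((⨆ j, |X i ω j|) / B) ^ q} := by
    rintro ω ⟨j, hj⟩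
    refine Real.rpow_le_rpow hY.le ?_ hq.le
    rw [le_div_iff₀ hB0, mul_comm]
    exact hj.le.trans (le_ciSup (f := fun j => |X i ω j|) (Set.finite_range _).bddAbove j)
  refine (measureReal_mono hsub).trans ?_
  rw [le_div_iff₀ (by positivity), mul_comm]
  exact (mul_meas_ge_le_integral_of_nonneg (ae_of_all _ h0) hi (Y ^ q)).trans hl

lemma sampleCov_concentration_exp (hn : 4 ≤ n) (hp : 3 ≤ p) (hX : IsCenteredSample X μ)
    {B α s l r : ℝ} (hB : 1 ≤ B) (hM2 : CondM2 B X μ) (hE : CondE1 B X μ)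
    (hs : 0 ≤ s) (hL : 2 ≤ s ^ 2) (hexpL : Real.exp (s ^ 2) = p * n) (hl : 1 ≤ l)
    (hexpl : Real.exp (-l) = α) (hr : 0 < r) (hr2 : r ^ 2 = n) (hsmall : B * l * s ^ 5 ≤ r) :
    ∃ G : Set Ω, MeasurableSet G ∧ 1 - α ≤ μ.real G ∧ ∀ ω ∈ G, ∀ j k,
      |(sampleCov fun i => X i ω) j k - avgCov X μ j k|
        ≤ 20100 * (B * l * s / r) + (20100 * (B * l * s / r)) ^ 2 := by
  have hB0 : 0 < B := by linarith
  have hl0 : 0 < l := by linarith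
  have hn4 : (4 : ℝ) ≤ n := by exact_mod_cast hn
  have hp3 : (3 : ℝ) ≤ p := by exact_mod_cast hp
  have hpn : (12 : ℝ) ≤ p * n := by nlinarith
  have hs1 : 1 ≤ s := by nlinarith
  have hs0 : 0 < s := by linarith
  set L := s ^ 2 with hLd
  have hL0 : 0 < L := by positivity
  have hLl : L ≤ L * l := le_mul_of_one_le_right hL0.le hl
  have hlL : 2 * l ≤ L * l := mul_le_mul_of_nonneg_right hL hl0.le
  have hBr : B ≤ r := by
    refine le_trans ?_ hsmall
    have : 1 ≤ l * s ^ 5 := one_le_mul_of_one_le_of_one_le hl (one_le_pow₀ hs1)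
    nlinarith
  have hexpnL : Real.exp (-L) = (p * n : ℝ)⁻¹ := by rw [Real.exp_neg, hexpL]
  have hexpn : n * Real.exp (-L) ≤ 1 := by
    rw [hexpnL, ← div_eq_mul_inv, div_le_one (by linarith)]
    nlinarith
  have hBn : B ^ 2 ≤ n := by rw [← hr2]; gcongr
  -- Large enough that `exp (-T / B) ≤ (p n)⁻² α`, which pays for the union over coordinates and
  -- observations.
  set T := 4 * B * (L * l) with hT
  have hT1 : 1 ≤ T := by nlinarith
  have hTB : T / B = 4 * (L * l) := by rw [hT]; field_simp
  have hTB2 : T / (2 * B) = 2 * (L * l) := by rw [hT]; field_simp; ring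
  -- With this `t`, the product `t * T * B * L` equals `B * l * s ^ 5 / r`, the cube of the first
  -- rate, so `hsmall` is precisely what the weighted second moment bound requires.
  set t := s / (4 * (r * B)) with ht
  have ht0 : 0 ≤ t := by positivity
  set u := 20100 * (B * l * s / r) with hu
  refine sampleCov_concentration (by omega) hp hX hT1 ht0 (K := 40000 * (n * B ^ 2))
    (fun i => ?_) (fun o o' => ?_) (fun o o' => ?_) ?_
  · refine (tail_le_of_exp_moment hX.measurable hB hE i T).trans ?_
    rw [hTB, le_div_iff₀ (by positivity)]
    have h1 : Real.exp (-(4 * (L * l))) ≤ Real.exp (-L) * (Real.exp (-L) * Real.exp (-l)) := by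
      rw [← Real.exp_add, ← Real.exp_add]
      exact Real.exp_le_exp.2 (by linarith)
    rw [hexpnL, hexpl] at h1
    have hα : 0 ≤ α := by rw [← hexpl]; positivity
    calc (p : ℝ) * (3 * Real.exp (-(4 * (L * l)))) * (2 * n)
        ≤ p * (3 * ((p * n : ℝ)⁻¹ * ((p * n : ℝ)⁻¹ * α))) * (2 * n) := by gcongr
      _ = (6 / (p * n)) * α := by
          have : (p : ℝ) ≠ 0 := by linarith
          have : (n : ℝ) ≠ 0 := by linarith
          field_simp
          ring
      _ ≤ 1 * α := by
          gcongr
          rw [div_le_one (by linarith)]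
          linarith
      _ = α := one_mul α
  · refine (bias_le hX (by linarith) o o' (c := 8 * B ^ 2 * Real.exp (-(T / (2 * B))))
      (φ := fun f => Real.exp (|f| / B)) (by positivity)
      (fun i o => exp_moment_extCoord hX.measurable hB hE i o)
      (fun f g => abs_trunc_mul_sub_le_exp hB0 T f g)).trans ?_
    rw [hTB2]
    have h1 : Real.exp (-(2 * (L * l))) ≤ Real.exp (-L) := Real.exp_le_exp.2 (by nlinarith)
    calc (n : ℝ) * (8 * B ^ 2 * Real.exp (-(2 * (L * l))) * (2 * 3))
        ≤ n * (8 * B ^ 2 * Real.exp (-L) * (2 * 3)) := by gcongr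
      _ = 48 * B ^ 2 * (n * Real.exp (-L)) := by ring
      _ ≤ 48 * B ^ 2 * 1 := by gcongr
      _ ≤ 10050 * (r * B) := by nlinarith
      _ ≤ 10050 * (r * B) * (l * s) :=
          le_mul_of_one_le_right (by positivity) (one_le_mul_of_one_le_of_one_le hl hs1)
      _ = n * u / 2 := by rw [hu, ← hr2]; field_simp; ring
  · refine (second_moment_le hX.measurable (by omega) hB hM2 (by linarith) ht0 o o'
      (φ := fun f => Real.exp (|f| / B)) (by positivity) (by positivity)
      (fun i o => exp_moment_extCoord hX.measurable hB hE i o)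
      (fun f g => sq_trunc_mul_exp_le hB0 (by linarith) ht0 hL ?_ f g)).trans ?_
    · calc t * T * B * L = B * l * s ^ 5 / r := by
            rw [ht, hT, hLd]; field_simp
        _ ≤ 1 := (div_le_one hr).2 hsmall
    · have e4 : Real.exp 4 ≤ 55 := by
        have : Real.exp 4 = Real.exp 1 ^ 4 := by rw [← Real.exp_nat_mul]; norm_num
        rw [this]
        calc Real.exp 1 ^ 4 ≤ 2.7182818286 ^ 4 := by gcongr; exact Real.exp_one_lt_d9.le
          _ ≤ 55 := by norm_num
      have h4 : B ^ 4 ≤ n * B ^ 2 := by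
        calc B ^ 4 = B ^ 2 * B ^ 2 := by ring
          _ ≤ n * B ^ 2 := by gcongr
      have hnB : 0 ≤ n * B ^ 2 := by positivity
      calc Real.exp 4 / 2 * (2 * (n * B ^ 2)) + n * (6144 * B ^ 4 * Real.exp (-L) * (2 * 3))
          = Real.exp 4 * (n * B ^ 2) + 36864 * B ^ 4 * (n * Real.exp (-L)) := by ring
        _ ≤ 55 * (n * B ^ 2) + 36864 * (n * B ^ 2) * 1 := by gcongr
        _ ≤ _ := by linarith
  -- The exponent is `-2512.5 * L * l + 2500 * L`. The surplus `12.5 * L * l` is enough for `3 * L +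
  -- l`, which explains the value 20100.
  · have e1 : t * (n * u / 2) = 2512.5 * (L * l) / 2 * 1 * 1 + 2512.5 * (L * l) / 2 := by
      rw [ht, hu, ← hr2, hLd]; field_simp; ring
    have e2 : t ^ 2 * (40000 * (n * B ^ 2)) = 2500 * L := by
      rw [ht, ← hr2, hLd]; field_simp; norm_num
    rw [e1, e2]
    have h1 : Real.exp (-(2512.5 * (L * l) / 2 * 1 * 1 + 2512.5 * (L * l) / 2) + 2500 * L)
        ≤ Real.exp (-L) * Real.exp (-L) * Real.exp (-L) * Real.exp (-l) := by
      rw [← Real.exp_add, ← Real.exp_add, ← Real.exp_add]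
      refine Real.exp_le_exp.2 ?_
      linarith
    rw [hexpnL, hexpl] at h1
    exact eight_mul_sq_mul_le hp3 hn4 (by rw [← hexpl]; positivity) h1

lemma sampleCov_concentration_poly (hn : 4 ≤ n) (hp : 3 ≤ p) (hX : IsCenteredSample X μ)
    {B α s l r q Y : ℝ} (hB : 1 ≤ B) (hM2 : CondM2 B X μ) (hq : 2 ≤ q) (hE : CondE2 B q X μ)
    (hs : 0 ≤ s) (hL : 2 ≤ s ^ 2) (hexpL : Real.exp (s ^ 2) = p * n) (hl : 1 ≤ l)
    (hexpl : Real.exp (-l) = α) (hr : 0 < r) (hr2 : r ^ 2 = n) (hlq : l ≤ q / 2 * s ^ 2)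
    (hY : 1 ≤ Y) (hYq : Y ^ q = 8 * n / α) :
    ∃ G : Set Ω, MeasurableSet G ∧ 1 - α ≤ μ.real G ∧ ∀ ω ∈ G, ∀ j k,
      |(sampleCov fun i => X i ω) j k - avgCov X μ j k|
        ≤ (16 + q) * (B * l * s / r + B ^ 2 * Y ^ 2 * s ^ 2 / n)
          + ((16 + q) * (B * l * s / r + B ^ 2 * Y ^ 2 * s ^ 2 / n)) ^ 2 := by
  have hB0 : 0 < B := by linarith
  have hl0 : 0 < l := by linarith
  have hY0 : 0 < Y := by linarith
  have hn4 : (4 : ℝ) ≤ n := by exact_mod_cast hn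
  have hp3 : (3 : ℝ) ≤ p := by exact_mod_cast hp
  have hn0 : (n : ℝ) ≠ 0 := by linarith
  have hpn : (12 : ℝ) ≤ p * n := by nlinarith
  have hs1 : 1 ≤ s := by nlinarith
  have hs0 : 0 < s := by linarith
  have hα : 0 < α := by rw [← hexpl]; positivity
  have hα1 : α ≤ 1 := by rw [← hexpl]; exact Real.exp_le_one_iff.2 (by linarith)
  set L := s ^ 2 with hLd
  have hL0 : 0 < L := by positivity
  have hexpnL : Real.exp (-L) = (p * n : ℝ)⁻¹ := by rw [Real.exp_neg, hexpL]
  set T := B * Y with hT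
  have hT1 : 1 ≤ T := one_le_mul_of_one_le_of_one_le hB hY
  have hT0 : 0 < T := by linarith
  set θ := B * l * s / r with hθ
  have hθ0 : 0 ≤ θ := by positivity
  set η := B ^ 2 * Y ^ 2 * L / n with hη
  have hη0 : 0 ≤ η := by positivity
  -- The first entry keeps the variance term at most `3 * L`, the second keeps the exponential
  -- weight bounded by `exp 1`.
  set t := min (s / (r * B)) (1 / T ^ 2) with ht
  have ht0 : 0 ≤ t := le_min (by positivity) (by positivity)
  have htT : t * T ^ 2 ≤ 1 := by
    calc t * T ^ 2 ≤ 1 / T ^ 2 * T ^ 2 := by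
          gcongr
          exact min_le_right _ _
      _ = 1 := by field_simp
  -- Whichever entry attains the minimum, `θ` or `η` is sized to make its own product with `t * n`
  -- at least `L`.
  have htn : L ≤ t * (n * (θ + η)) := by
    have hLl : L ≤ L * l := le_mul_of_one_le_right hL0.le hl
    rcases min_choice (s / (r * B)) (1 / T ^ 2) with h | h
    · rw [ht, h]
      have e : s / (r * B) * (n * θ) = L * l := by
        rw [hθ, ← hr2, hLd]; field_simp
      have : 0 ≤ s / (r * B) * (n * η) := by positivity
      rw [mul_add, mul_add]
      linarith
    · rw [ht, h]
      have e : 1 / T ^ 2 * (n * η) = L := by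
        rw [hη, hT]; field_simp
      have : 0 ≤ 1 / T ^ 2 * (n * θ) := by positivity
      rw [mul_add, mul_add]
      linarith
  refine sampleCov_concentration (by omega) hp hX hT1 ht0 (K := 3 * (n * B ^ 2))
    (fun i => ?_) (fun o o' => ?_) (fun o o' => ?_) ?_
  · refine (tail_le_of_rpow_moment hX.measurable hB (by linarith) hE i hY0).trans ?_
    rw [hYq, div_div_eq_mul_div, div_le_div_iff₀ (by positivity) (by positivity)]
    nlinarith [mul_nonneg hα.le (show (0 : ℝ) ≤ n by positivity)]
  · refine (bias_le hX hT0.le o o' (c := T ^ (2 - q))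
      (φ := fun f => |f| ^ q) (by positivity)
      (fun i o => rpow_moment_extCoord hX.measurable hB (by linarith) hE i o)
      (fun f g => abs_trunc_mul_sub_le_rpow hT0 hq f g)).trans ?_
    have e : T ^ (2 - q) * B ^ q = B ^ 2 * (Y ^ 2 * (α / (8 * n))) := by
      have hYq' : Y ^ (2 - q) = Y ^ 2 * (α / (8 * n)) := by
        rw [Real.rpow_sub hY0, hYq]
        norm_num
        field_simp
      rw [hT, Real.mul_rpow hB0.le hY0.le, hYq', Real.rpow_sub hB0]
      norm_num
      field_simp
    calc (n : ℝ) * (T ^ (2 - q) * (2 * (3 * B ^ q))) = 6 * n * (T ^ (2 - q) * B ^ q) := by ring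
      _ = 3 / 4 * (B ^ 2 * Y ^ 2) * α := by rw [e]; field_simp; norm_num
      _ ≤ 3 / 4 * (B ^ 2 * Y ^ 2) * 1 := by gcongr
      _ ≤ 8 * (B ^ 2 * Y ^ 2 * L) := by
          have : 0 ≤ B ^ 2 * Y ^ 2 := by positivity
          nlinarith
      _ = n * (16 * η) / 2 := by rw [hη]; field_simp; ring
      _ ≤ n * ((16 + q) * (θ + η)) / 2 := by
          gcongr <;> linarith
  · refine (second_moment_le hX.measurable (by omega) hB hM2 hT0.le ht0 o o'
      (c₁ := Real.exp 1 / 2) (c := 0) (k := 0)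
      (φ := fun _ => 0) (by positivity) le_rfl (fun i o => ⟨integrable_zero _ _ _, by simp⟩)
      (fun f g => ?_)).trans ?_
    · refine (sq_trunc_mul_exp_le_of_le (c := 1) ?_).trans (by simp)
      refine le_trans (mul_le_mul_of_nonneg_left ?_ ht0) htT
      rw [abs_mul, sq]
      exact mul_le_mul (abs_trunc_le hT0.le _) (abs_trunc_le hT0.le _) (abs_nonneg _) hT0.le
    · have : Real.exp 1 ≤ 3 := Real.exp_one_lt_d9.le.trans (by norm_num)
      have h0 : 0 ≤ n * B ^ 2 := by positivity
      nlinarith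
  -- The gain is `(8 + q/2) * L` and the variance costs `3 * L`. The remaining `(5 + q/2) * L`
  -- covers `3 * L + l` because `l ≤ q / 2 * L`.
  · have h2 : t ^ 2 * (3 * (n * B ^ 2)) ≤ 3 * L := by
      have : t ≤ s / (r * B) := min_le_left _ _
      calc t ^ 2 * (3 * (n * B ^ 2)) ≤ (s / (r * B)) ^ 2 * (3 * (n * B ^ 2)) := by gcongr
        _ = 3 * L := by rw [← hr2, hLd]; field_simp
    have h3 : (8 + q / 2) * L ≤ t * (n * ((16 + q) * (θ + η)) / 2) := by
      calc (8 + q / 2) * L ≤ (8 + q / 2) * (t * (n * (θ + η))) := by gcongr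
        _ = _ := by ring
    have h1 : Real.exp (-(t * (n * ((16 + q) * (θ + η)) / 2)) + t ^ 2 * (3 * (n * B ^ 2)))
        ≤ Real.exp (-L) * Real.exp (-L) * Real.exp (-L) * Real.exp (-l) := by
      rw [← Real.exp_add, ← Real.exp_add, ← Real.exp_add]
      refine Real.exp_le_exp.2 ?_
      linarith
    rw [hexpnL, hexpl] at h1
    exact eight_mul_sq_mul_le hp3 hn4 hα.le h1

end

/-! ### The bootstrap error -/

lemma sum_abs_le_of_l0norm {p s : ℕ} {v : Vec p} (hv : ‖v‖ = 1) (hs : l0norm v ≤ s) :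
    ∑ j, |v j| ≤ s := by
  have h1 : ∀ j, |v j| ≤ 1 := fun j => by
    have := PiLp.norm_apply_le v j
    rwa [hv] at this
  calc ∑ j, |v j| = ∑ j ∈ Finset.univ.filter fun j => v j ≠ 0, |v j| := by
        refine (Finset.sum_subset (Finset.filter_subset _ _) fun j _ hj => ?_).symm
        simpa using hj
    _ ≤ ∑ j ∈ Finset.univ.filter fun j => v j ≠ 0, (1 : ℝ) := Finset.sum_le_sum fun j _ => h1 j
    _ = l0norm v := by simp [l0norm]
    _ ≤ s := by exact_mod_cast hs

lemma abs_bil_le_of_sparse {p s : ℕ} {M : Matrix (Fin p) (Fin p) ℝ} {u : ℝ} (hu : 0 ≤ u)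
    (hM : ∀ j k, |M j k| ≤ u) {v w : Vec p} (hv : ‖v‖ = 1) (hw : ‖w‖ = 1)
    (hvs : l0norm v ≤ s) (hws : l0norm w ≤ s) : |bil M v w| ≤ (s : ℝ) ^ 2 * u := by
  rw [bil_eq_sum]
  calc |∑ j, ∑ k, v j * (M j k * w k)| ≤ ∑ j, ∑ k, |v j * (M j k * w k)| :=
        (Finset.abs_sum_le_sum_abs _ _).trans
          (Finset.sum_le_sum fun j _ => Finset.abs_sum_le_sum_abs _ _)
    _ ≤ ∑ j, ∑ k, |v j| * |w k| * u := by
        refine Finset.sum_le_sum fun j _ => Finset.sum_le_sum fun k _ => ?_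
        rw [abs_mul, abs_mul]
        have := mul_le_mul_of_nonneg_left (hM j k) (mul_nonneg (abs_nonneg (v j))
          (abs_nonneg (w k)))
        linarith
    _ = (∑ j, |v j|) * (∑ k, |w k|) * u := by
        rw [Finset.sum_mul_sum, Finset.sum_mul]
        simp_rw [Finset.sum_mul]
    _ ≤ (s * s) * u := by
        refine mul_le_mul_of_nonneg_right ?_ hu
        exact mul_le_mul (sum_abs_le_of_l0norm hv hvs) (sum_abs_le_of_l0norm hw hws)
          (Finset.sum_nonneg fun _ _ => abs_nonneg _) (Nat.cast_nonneg s)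
    _ = _ := by ring

section

variable {Ω : Type*} [MeasurableSpace Ω] {μ : Measure Ω} [IsProbabilityMeasure μ]
  {Ω' : Type*} [MeasurableSpace Ω'] {ν : Measure Ω'} [IsProbabilityMeasure ν] {n p : ℕ}
  {X : Fin n → Ω → Vec p} {e : Fin n → Ω → ℝ} {Y : Fin n → Ω' → Vec p}

lemma bootstrapError_le_one (𝒜 : Set (Set (Vec p))) (ω : Ω) :
    bootstrapError e X μ Y ν 𝒜 ω ≤ 1 := by
  refine Real.iSup_le (fun A => ?_) zero_le_one
  have h : (ν.map (normalizedSum Y)).real A.1 ≤ 1 := by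
    by_cases hm : AEMeasurable (normalizedSum Y) ν
    · have := Measure.isProbabilityMeasure_map hm
      exact measureReal_le_one
    · rw [Measure.map_of_not_aemeasurable hm]
      simp
  rw [abs_le]
  constructor <;> linarith [measureReal_nonneg (μ := ν.map (normalizedSum Y)) (s := A.1),
    measureReal_nonneg (μ := condDistrib (bootstrapSum e X) (fun ω i => X i ω) μ
      (fun i => X i ω)) (s := A.1),
    measureReal_le_one (μ := condDistrib (bootstrapSum e X) (fun ω i => X i ω) μ
      (fun i => X i ω)) (s := A.1)]

omit [IsProbabilityMeasure μ] in
lemma bil_avgCov_self (h : ∀ i j, MemLp (fun ω => X i ω j) 2 μ) (v : Vec p) :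
    bil (avgCov X μ) v v = (n : ℝ)⁻¹ * ∑ i, ∫ ω, (inner ℝ v (X i ω) : ℝ) ^ 2 ∂μ := by
  rw [avgCov, bil_smul, bil_finsetSum]
  simp_rw [secondMoment_bil (h _), sq]

omit [IsProbabilityMeasure μ] in
-- Makes the almost sure identification of the conditional law hold everywhere on an event of
-- unchanged probability.
lemma exists_measurableSet_of_ae {P : Ω → Prop} (hP : ∀ᵐ ω ∂μ, P ω) {G : Set Ω}
    (hG : MeasurableSet G) : ∃ G' ⊆ G, MeasurableSet G' ∧ μ.real G' = μ.real G ∧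
      ∀ ω ∈ G', P ω := by
  refine ⟨G \ toMeasurable μ {ω | ¬ P ω}, Set.sdiff_subset, hG.diff (measurableSet_toMeasurable _ _),
    ?_, fun ω hω => ?_⟩
  · rw [measureReal_def, measure_sdiff_null, measureReal_def]
    rw [measure_toMeasurable]
    exact hP
  · by_contra hcon
    exact hω.2 (subset_toMeasurable _ _ hcon)

end

/-- Reduction of the bootstrap error bound to a deviation bound for the empirical covariance. -/
lemma exists_bootstrapError_le (a b d : ℝ) (ha : 0 ≤ a) (hb : 0 < b) (hd : 0 < d) (s : ℕ) :
    ∃ K : ℝ, 0 < K ∧ ∀ {n p : ℕ}, 4 ≤ n → 3 ≤ p →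
      ∀ {Ω : Type*} [MeasurableSpace Ω] {μ : Measure Ω} [IsProbabilityMeasure μ]
        {Ω' : Type*} [MeasurableSpace Ω'] {ν : Measure Ω'} [IsProbabilityMeasure ν]
        {X : Fin n → Ω → Vec p} {e : Fin n → Ω → ℝ} {Y : Fin n → Ω' → Vec p},
        IsCenteredSample X μ → IsMultiplier e X μ → IsGaussianAnalogue X μ Y ν →
      ∀ {𝒜 : Set (Set (Vec p))} {Am : Set (Vec p) → Set (Vec p)}
        {V : Set (Vec p) → Finset (Vec p)},
        (∀ A ∈ 𝒜, CondC n a d A (Am A) (V A)) →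
        (∀ A ∈ 𝒜, CondS s (V A)) →
        (∀ A ∈ 𝒜, CondM1' b X μ (V A)) →
      ∀ {u D κ α : ℝ}, 0 ≤ u → 0 < D → 0 ≤ κ →
        Real.sqrt (Real.log ((p : ℝ) * n)) / n ≤ D →
        u * Real.log ((p : ℝ) * n) ^ 2 ≤ κ * D ^ 3 →
        (∃ G : Set Ω, MeasurableSet G ∧ 1 - α ≤ μ.real G ∧ ∀ ω ∈ G, ∀ j k,
          |(sampleCov fun i => X i ω) j k - avgCov X μ j k| ≤ u) →
        ∃ G : Set Ω, MeasurableSet G ∧ 1 - α ≤ μ.real G ∧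
          ∀ ω ∈ G, bootstrapError e X μ Y ν 𝒜 ω ≤ K * (1 + κ) * D := by
  obtain ⟨K, hK, hcomp⟩ := exists_gauss_simple_comparison b d hb hd
  refine ⟨K * ((a + 1) * ((s : ℝ) ^ 2 + 1)), by positivity, ?_⟩
  intro n p hn hp Ω _ μ _ Ω' _ ν _ X e Y hX he hY 𝒜 Am V hC hS hM1 u D κ α hu hD hκ hnD huD
  rintro ⟨G, hG, hGα, hcov⟩
  obtain ⟨G', hsub, hG', hGG', hcond⟩ :=
    exists_measurableSet_of_ae (condDistrib_bootstrapSum hX.measurable he) hG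
  refine ⟨G', hG', hGG' ▸ hGα, fun ω hω => ?_⟩
  have hn4 : (4 : ℝ) ≤ n := by exact_mod_cast hn
  have hp3 : (3 : ℝ) ≤ p := by exact_mod_cast hp
  set L := Real.log ((p : ℝ) * n) with hL
  have hL1 : 1 ≤ L := by
    rw [hL, Real.le_log_iff_exp_le (by positivity)]
    nlinarith [Real.exp_one_lt_d9]
  have hL0 : 0 < L := by linarith
  have hsL : 0 < Real.sqrt L := Real.sqrt_pos.2 hL0
  -- The nonnegativity side goal covers an empty class, where the real supremum is 0.
  refine Real.iSup_le (fun A => ?_) (by positivity)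
  obtain ⟨A, hA⟩ := A
  have hbil : ∀ v ∈ V A, ∀ w ∈ V A,
      |bil (sampleCov fun i => X i ω) v w - bil (avgCov X μ) v w| ≤ (s : ℝ) ^ 2 * u := by
    intro v hv w hw
    rw [← bil_sub]
    exact abs_bil_le_of_sparse hu (fun j k => hcov ω (hsub hω) j k)
      ((hC A hA).generated.norm_eq_one v hv) ((hC A hA).generated.norm_eq_one w hw)
      (hS A hA v hv) (hS A hA w hw)
  -- With `ε = D / √L` the smoothing shift costs `D`, and the comparison term becomes `s² * u * L ^
  -- 2 / D ^ 2 ≤ s² * κ * D`.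
  have h := hcomp ha (posSemidef_avgCov hX.memLp) (posSemidef_gram _) (hC A hA) hL1
    (fun v hv => by
      rw [bil_avgCov_self hX.memLp]
      exact hM1 A hA v hv) (ε := D / Real.sqrt L) (by positivity)
    (show 0 ≤ (s : ℝ) ^ 2 * u by positivity) hbil
  simp only
  rw [hcond ω hω, map_normalizedSum hX.memLp hY]
  refine h.trans ?_
  have e1 : a / n * Real.sqrt L ≤ a * D := by
    calc a / n * Real.sqrt L = a * (Real.sqrt L / n) := by ring
      _ ≤ a * D := by gcongr
  have e2 : D / Real.sqrt L * Real.sqrt L = D := by field_simp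
  have e3 : (s : ℝ) ^ 2 * u * L / (D / Real.sqrt L) ^ 2 ≤ (s : ℝ) ^ 2 * (κ * D) := by
    rw [div_pow, Real.sq_sqrt hL0.le, div_div_eq_mul_div, div_le_iff₀ (by positivity)]
    calc (s : ℝ) ^ 2 * u * L * L = (s : ℝ) ^ 2 * (u * L ^ 2) := by ring
      _ ≤ (s : ℝ) ^ 2 * (κ * D ^ 3) := by gcongr
      _ = _ := by ring
  calc K * (a / n * Real.sqrt L + D / Real.sqrt L * Real.sqrt L
        + (s : ℝ) ^ 2 * u * L / (D / Real.sqrt L) ^ 2)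
      ≤ K * (a * D + D + (s : ℝ) ^ 2 * (κ * D)) := by gcongr; exact e2.le
    _ = K * ((a + 1) + (s : ℝ) ^ 2 * κ) * D := by ring
    _ ≤ K * ((a + 1) * ((s : ℝ) ^ 2 + 1) * (1 + κ)) * D := by
        gcongr
        have h1 : 0 ≤ (s : ℝ) ^ 2 := by positivity
        nlinarith [mul_nonneg ha h1, mul_nonneg (mul_nonneg ha h1) hκ, mul_nonneg h1 hκ,
          mul_nonneg ha hκ]
    _ = _ := by ring

/-! ### The rates -/

lemma rateD1_cube {n p : ℕ} {B α s r : ℝ} (hB : 0 ≤ B) (hl : 0 ≤ Real.log (1 / α))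
    (hs : 0 ≤ s) (hs2 : s ^ 2 = Real.log ((p : ℝ) * n)) (hr : 0 < r) (hr2 : r ^ 2 = n) :
    rateD1 n p B α ^ 3 = B * Real.log (1 / α) * s ^ 5 / r := by
  have h0 : 0 ≤ B * Real.log (1 / α) * s ^ 5 / r := by positivity
  have e : B ^ 2 * Real.log ((p : ℝ) * n) ^ 5 * Real.log (1 / α) ^ 2 / n
      = (B * Real.log (1 / α) * s ^ 5 / r) ^ 2 := by
    rw [← hs2, ← hr2]
    ring
  rw [rateD1, e, ← Real.rpow_natCast, ← Real.rpow_natCast, ← Real.rpow_mul (by positivity),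
    ← Real.rpow_mul (by positivity)]
  norm_num

lemma rateD2_cube {n p : ℕ} {B q α : ℝ} (hα : 0 ≤ α) (hL : 0 ≤ Real.log ((p : ℝ) * n)) :
    rateD2 n p B q α ^ 3 =
      B ^ 2 * Real.log ((p : ℝ) * n) ^ 3 / (α ^ (2 / q) * (n : ℝ) ^ (1 - 2 / q)) := by
  have h0 : 0 ≤ B ^ 2 * Real.log ((p : ℝ) * n) ^ 3 / (α ^ (2 / q) * (n : ℝ) ^ (1 - 2 / q)) := by
    positivity
  rw [rateD2, ← Real.rpow_natCast, ← Real.rpow_mul h0]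
  norm_num

/-- Lets the polytope precision `a / n` be absorbed in the rate; the inequality is checked after
cubing. -/
lemma sqrt_log_div_le {L l B s r n D : ℝ} (hL : 1 ≤ L) (hs : 0 ≤ s) (hs2 : s ^ 2 = L)
    (hB : 1 ≤ B) (hl : 1 ≤ l) (hr : 1 ≤ r) (hr2 : r ^ 2 = n) (hD : 0 ≤ D)
    (hD3 : B * l * s ^ 5 / r ≤ D ^ 3) : s / n ≤ D := by
  have hs1 : 1 ≤ s := by nlinarith
  have hBl : 1 ≤ B * l := one_le_mul_of_one_le_of_one_le hB hl
  refine le_of_pow_le_pow_left₀ three_ne_zero hD (le_trans ?_ hD3)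
  rw [← hr2, div_pow]
  have h1 : s ^ 3 ≤ s ^ 5 := pow_le_pow_right₀ hs1 (by norm_num)
  have h2 : r ≤ (r ^ 2) ^ 3 := by
    rw [← pow_mul]
    calc r = r ^ 1 := (pow_one r).symm
      _ ≤ r ^ (2 * 3) := pow_le_pow_right₀ hr (by norm_num)
  have h3 : s ^ 5 ≤ B * l * s ^ 5 := le_mul_of_one_le_left (by positivity) hBl
  exact div_le_div₀ (by positivity) (h1.trans h3) (by linarith) h2

/-! ### The two moment conditions -/

/-- Elementary facts on `√log(pn)`, `log(1/α)` and `√n`. -/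
lemma log_facts {n p : ℕ} (hn : 4 ≤ n) (hp : 3 ≤ p) {α : ℝ} (hα : 0 < α)
    (hα1 : α < Real.exp (-1)) :
    2 ≤ Real.log ((p : ℝ) * n) ∧ Real.exp (Real.log ((p : ℝ) * n)) = p * n ∧
      1 ≤ Real.log (1 / α) ∧ Real.exp (-Real.log (1 / α)) = α := by
  have hn4 : (4 : ℝ) ≤ n := by exact_mod_cast hn
  have hp3 : (3 : ℝ) ≤ p := by exact_mod_cast hp
  have hpn : (12 : ℝ) ≤ p * n := by nlinarith
  refine ⟨?_, Real.exp_log (by linarith), ?_, ?_⟩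
  · rw [Real.le_log_iff_exp_le (by linarith)]
    have : Real.exp 2 = Real.exp 1 ^ 2 := by rw [← Real.exp_nat_mul]; norm_num
    rw [this]
    calc Real.exp 1 ^ 2 ≤ 2.7182818286 ^ 2 := by gcongr; exact Real.exp_one_lt_d9.le
      _ ≤ _ := by linarith
  · rw [one_div, Real.log_inv]
    have := Real.log_lt_log hα hα1
    rw [Real.log_exp] at this
    linarith
  · rw [one_div, Real.log_inv, neg_neg, Real.exp_log hα]

section

variable {Ω : Type*} [MeasurableSpace Ω] {μ : Measure Ω} [IsProbabilityMeasure μ] {n p : ℕ}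
  {X : Fin n → Ω → Vec p}

lemma exists_event_exp (hn : 4 ≤ n) (hp : 3 ≤ p) (hX : IsCenteredSample X μ) {B α : ℝ}
    (hB : 1 ≤ B) (hα : 0 < α) (hα1 : α < Real.exp (-1)) (hM2 : CondM2 B X μ)
    (hE : CondE1 B X μ) (hD : rateD1 n p B α ≤ 1) :
    ∃ u : ℝ, 0 ≤ u ∧
      u * Real.log ((p : ℝ) * n) ^ 2 ≤ 20100 * 20101 * rateD1 n p B α ^ 3 ∧
      ∃ G : Set Ω, MeasurableSet G ∧ 1 - α ≤ μ.real G ∧ ∀ ω ∈ G, ∀ j k,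
        |(sampleCov fun i => X i ω) j k - avgCov X μ j k| ≤ u := by
  obtain ⟨hL, heL, hl, hel⟩ := log_facts hn hp hα hα1
  set L := Real.log ((p : ℝ) * n) with hLd
  set l := Real.log (1 / α) with hld
  have hs2 : Real.sqrt L ^ 2 = L := Real.sq_sqrt (by linarith)
  have hs0 := Real.sqrt_nonneg L
  set s := Real.sqrt L
  have hn0 : (0 : ℝ) < n := by exact_mod_cast (by omega : 0 < n)
  have hr : 0 < Real.sqrt (n : ℝ) := Real.sqrt_pos.2 hn0
  have hr2 : Real.sqrt (n : ℝ) ^ 2 = n := Real.sq_sqrt hn0.le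
  set r := Real.sqrt (n : ℝ)
  have hcube := rateD1_cube (n := n) (p := p) (B := B) (α := α) (by linarith)
    (by linarith) hs0 hs2 hr hr2
  have hD0 : 0 ≤ rateD1 n p B α := Real.rpow_nonneg (by positivity) _
  have hsmall : B * l * s ^ 5 ≤ r := by
    have : rateD1 n p B α ^ 3 ≤ 1 := pow_le_one₀ hD0 hD
    rwa [hcube, div_le_one hr] at this
  have hs1 : 1 ≤ s := by nlinarith
  have hB0 : 0 ≤ B := by linarith
  have hθ0 : 0 ≤ B * l * s / r := by positivity
  have hθ1 : B * l * s / r ≤ 1 := by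
    rw [div_le_one hr]
    refine le_trans ?_ hsmall
    have : s ≤ s ^ 5 := le_self_pow₀ hs1 (by norm_num)
    have h0 : 0 ≤ B * l := by positivity
    gcongr
  -- For `θ = B * l * s / r ≤ 1`, the bound `20100 θ + (20100 θ) ^ 2` is at most `20100 * 20101 *
  -- θ`.
  refine ⟨20100 * 20101 * (B * l * s / r), by positivity, ?_, ?_⟩
  · rw [hcube, ← hs2]
    refine le_of_eq ?_
    ring
  · obtain ⟨G, hG, hGα, h⟩ := sampleCov_concentration_exp hn hp hX hB hM2 hE hs0
      (by rw [hs2]; exact hL) (by rw [hs2]; exact heL) hl hel hr hr2 hsmall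
    refine ⟨G, hG, hGα, fun ω hω j k => (h ω hω j k).trans ?_⟩
    nlinarith

set_option maxHeartbeats 1000000 in
lemma exists_event_poly (hn : 4 ≤ n) (hp : 3 ≤ p) (hX : IsCenteredSample X μ) {B α q : ℝ}
    (hB : 1 ≤ B) (hα : 0 < α) (hα1 : α < Real.exp (-1)) (hq : 0 < q) (hM2 : CondM2 B X μ)
    (hE : CondE2 B q X μ) (hD1 : rateD1 n p B α ≤ 1) (hD2 : rateD2 n p B q α < 1) :
    ∃ u : ℝ, 0 ≤ u ∧
      u * Real.log ((p : ℝ) * n) ^ 2 ≤ 8 * (16 + q) * (1 + 9 * (16 + q)) *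
        (rateD1 n p B α + rateD2 n p B q α) ^ 3 ∧
      ∃ G : Set Ω, MeasurableSet G ∧ 1 - α ≤ μ.real G ∧ ∀ ω ∈ G, ∀ j k,
        |(sampleCov fun i => X i ω) j k - avgCov X μ j k| ≤ u := by
  obtain ⟨hL, heL, hl, hel⟩ := log_facts hn hp hα hα1
  set L := Real.log ((p : ℝ) * n) with hLd
  set l := Real.log (1 / α) with hld
  have hs2 : Real.sqrt L ^ 2 = L := Real.sq_sqrt (by linarith)
  have hs0 := Real.sqrt_nonneg L
  set s := Real.sqrt L
  have hn4 : (4 : ℝ) ≤ n := by exact_mod_cast hn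
  have hp3 : (3 : ℝ) ≤ p := by exact_mod_cast hp
  have hn0 : (0 : ℝ) < n := by linarith
  have hr : 0 < Real.sqrt (n : ℝ) := Real.sqrt_pos.2 hn0
  have hr2 : Real.sqrt (n : ℝ) ^ 2 = n := Real.sq_sqrt hn0.le
  set r := Real.sqrt (n : ℝ)
  have hB0 : 0 < B := by linarith
  have hL0 : 0 < L := by linarith
  have hl0 : 0 < l := by linarith
  have hαlt : α < 1 := hα1.trans (by rw [Real.exp_lt_one_iff]; norm_num)
  have hcube := rateD1_cube (n := n) (p := p) (B := B) (α := α) (by linarith)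
    (by linarith) hs0 hs2 hr hr2
  have hcube2 := rateD2_cube (n := n) (p := p) (B := B) (q := q) hα.le hL0.le
  rw [← hld] at hcube
  rw [← hLd] at hcube2
  have hD10 : 0 ≤ rateD1 n p B α := Real.rpow_nonneg (by positivity) _
  have hD20 : 0 ≤ rateD2 n p B q α := Real.rpow_nonneg (by positivity) _
  set D₁ := rateD1 n p B α
  set D₂ := rateD2 n p B q α
  set Q := α ^ (2 / q) * (n : ℝ) ^ (1 - 2 / q) with hQ
  have hQ0 : 0 < Q := by positivity
  have hD2c : D₂ ^ 3 < 1 := pow_lt_one₀ hD20 hD2 three_ne_zero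
  -- The assumption `D₂ < 1` forces `Q > 1`. Taking logarithms, `(1 - 2/q) * log n > (2/q) * l > 0`,
  -- which yields both `q > 2` and `l ≤ q / 2 * L`.
  have hQ1 : 1 < Q := by
    rw [hcube2, div_lt_one hQ0] at hD2c
    refine lt_of_le_of_lt ?_ hD2c
    exact one_le_mul_of_one_le_of_one_le (one_le_pow₀ hB) (one_le_pow₀ (by linarith))
  have hlogn : 0 < Real.log n := Real.log_pos (by linarith)
  have hlognL : Real.log n ≤ L := Real.log_le_log hn0 (by nlinarith)
  have hlogα : Real.log α = -l := by rw [hld, one_div, Real.log_inv, neg_neg]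
  have hlogQ : 0 < -(2 / q * l) + (1 - 2 / q) * Real.log n := by
    have := Real.log_pos hQ1
    rw [hQ, Real.log_mul (by positivity) (by positivity), Real.log_rpow hα, Real.log_rpow hn0,
      hlogα] at this
    linarith
  have hql : 0 < 2 / q * l := by positivity
  have h1q : 0 < 1 - 2 / q := by
    by_contra hcon
    have := mul_nonpos_of_nonpos_of_nonneg (not_lt.1 hcon) hlogn.le
    linarith
  have hq2 : 2 ≤ q := by
    rw [sub_pos, div_lt_one hq] at h1q
    exact h1q.le
  have hlq : l ≤ q / 2 * s ^ 2 := by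
    rw [hs2]
    have h1 : 2 / q * l ≤ L := by
      have : 0 < 2 / q := by positivity
      nlinarith
    calc l = q / 2 * (2 / q * l) := by field_simp
      _ ≤ q / 2 * L := by gcongr
  have hY1 : 1 ≤ 8 * (n : ℝ) / α := by
    rw [le_div_iff₀ hα]
    linarith
  have hY0 : 0 ≤ 8 * (n : ℝ) / α := by linarith
  -- The truncation level is `B * Y`. With `Y ^ q = 8 * n / α` Markov's inequality gives exceedance
  -- probability at most `α / (4 n)` per observation.
  set Y := (8 * (n : ℝ) / α) ^ (1 / q) with hY
  have hYq : Y ^ q = 8 * n / α := by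
    rw [hY, ← Real.rpow_mul hY0, one_div_mul_cancel hq.ne', Real.rpow_one]
  have hY2 : Y ^ 2 / n ≤ 8 / Q := by
    have e1 : Y ^ 2 = (8 : ℝ) ^ (2 / q) * ((n : ℝ) ^ (2 / q) / α ^ (2 / q)) := by
      rw [hY, ← Real.rpow_natCast, ← Real.rpow_mul hY0,
        ← Real.div_rpow hn0.le hα.le, ← Real.mul_rpow (by norm_num) (by positivity), mul_div_assoc]
      congr 1
      push_cast
      ring
    have e2 : Q = α ^ (2 / q) * (n / (n : ℝ) ^ (2 / q)) := by
      rw [hQ, Real.rpow_sub hn0, Real.rpow_one]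
    have e3 : (8 : ℝ) ^ (2 / q) ≤ 8 := by
      calc (8 : ℝ) ^ (2 / q) ≤ 8 ^ (1 : ℝ) :=
            Real.rpow_le_rpow_of_exponent_le (by norm_num) (by linarith)
        _ = 8 := Real.rpow_one 8
    have h0 : 0 < α ^ (2 / q) := by positivity
    have h0' : 0 < (n : ℝ) ^ (2 / q) := by positivity
    rw [e1, e2]
    calc _ ≤ 8 * ((n : ℝ) ^ (2 / q) / α ^ (2 / q)) / n := by gcongr
      _ = _ := by field_simp
  have hs1 : 1 ≤ s := by nlinarith
  have hsmall : B * l * s ^ 5 ≤ r := by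
    have : D₁ ^ 3 ≤ 1 := pow_le_one₀ hD10 hD1
    rwa [hcube, div_le_one hr] at this
  set θ := B * l * s / r with hθ
  have hθ0 : 0 ≤ θ := by positivity
  have hθ1 : θ ≤ 1 := by
    rw [hθ, div_le_one hr]
    refine le_trans ?_ hsmall
    have : s ≤ s ^ 5 := le_self_pow₀ hs1 (by norm_num)
    have h0 : 0 ≤ B * l := by positivity
    gcongr
  set η := B ^ 2 * Y ^ 2 * s ^ 2 / n with hη
  have hη0 : 0 ≤ η := by positivity
  have hηL : η * L ^ 2 ≤ 8 * D₂ ^ 3 := by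
    rw [hcube2, hη, hs2]
    calc B ^ 2 * Y ^ 2 * L / n * L ^ 2 = B ^ 2 * L ^ 3 * (Y ^ 2 / n) := by ring
      _ ≤ B ^ 2 * L ^ 3 * (8 / Q) := by gcongr
      _ = _ := by ring
  have hη8 : η ≤ 8 := by
    have : η * 1 ≤ η * L ^ 2 := mul_le_mul_of_nonneg_left (one_le_pow₀ (by linarith)) hη0
    linarith
  have hθL : θ * L ^ 2 = D₁ ^ 3 := by
    rw [hcube, hθ, ← hs2]
    ring
  -- Since `θ + η ≤ 9`, the square of `(16 + q) * (θ + η)` is at most `9 * (16 + q)` times itself.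
  refine ⟨(16 + q) * (θ + η) * (1 + 9 * (16 + q)), by positivity, ?_, ?_⟩
  · have h1 : D₁ ^ 3 + 8 * D₂ ^ 3 ≤ 8 * (D₁ + D₂) ^ 3 := by
      have : D₁ ^ 3 + D₂ ^ 3 ≤ (D₁ + D₂) ^ 3 := by
        have : 0 ≤ D₁ * D₂ * (D₁ + D₂) := by positivity
        nlinarith
      have : 0 ≤ D₁ ^ 3 := by positivity
      linarith
    calc _ = (16 + q) * (1 + 9 * (16 + q)) * (θ * L ^ 2 + η * L ^ 2) := by ring
      _ ≤ (16 + q) * (1 + 9 * (16 + q)) * (8 * (D₁ + D₂) ^ 3) := by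
          gcongr
          linarith
      _ = _ := by ring
  · obtain ⟨G, hG, hGα, h⟩ := sampleCov_concentration_poly hn hp hX hB hM2 hq2 hE hs0
      (by rw [hs2]; exact hL) (by rw [hs2]; exact heL) hl hel hr hr2 hlq
      (Real.one_le_rpow hY1 (by positivity)) hYq
    refine ⟨G, hG, hGα, fun ω hω j k => (h ω hω j k).trans ?_⟩
    have h9 : (16 + q) * (θ + η) ≤ (16 + q) * 9 :=
      mul_le_mul_of_nonneg_left (by linarith) (by linarith)
    have h0 : 0 ≤ (16 + q) * (θ + η) := by positivity
    nlinarith only [mul_le_mul_of_nonneg_left h9 h0]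

end

end HighDimBootstrap

/-! ### Assembly of the two bounds -/

theorem mainTheorem7 (a b d : ℝ) (ha : 0 ≤ a) (hb : 0 < b) (hd : 0 < d) (s : ℕ) :
    (∃ C : ℝ, 0 < C ∧
      ∀ (n p : ℕ), 4 ≤ n → 3 ≤ p →
      ∀ (B α : ℝ), 1 ≤ B → 0 < α → α < Real.exp (-1) →
      ∀ {Ω : Type*} [MeasurableSpace Ω] (μ : Measure Ω) [IsProbabilityMeasure μ]
        {Ω' : Type*} [MeasurableSpace Ω'] (ν : Measure Ω') [IsProbabilityMeasure ν]
        (X : Fin n → Ω → Vec p) (e : Fin n → Ω → ℝ) (Y : Fin n → Ω' → Vec p),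
        IsCenteredSample X μ → IsMultiplier e X μ → IsGaussianAnalogue X μ Y ν →
      ∀ (𝒜 : Set (Set (Vec p))) (Am : Set (Vec p) → Set (Vec p))
        (V : Set (Vec p) → Finset (Vec p)),
        𝒜 ⊆ simpleConvexSets p n a d →
        (∀ A ∈ 𝒜, CondC n a d A (Am A) (V A)) →
        (∀ A ∈ 𝒜, CondS s (V A)) →
        (∀ A ∈ 𝒜, CondM1' b X μ (V A)) →
        CondM2 B X μ →
        CondE1 B X μ →
        ∃ G : Set Ω, MeasurableSet G ∧ 1 - α ≤ μ.real G ∧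
          ∀ ω ∈ G, bootstrapError e X μ Y ν 𝒜 ω ≤ C * rateD1 n p B α) ∧
    (∀ q : ℝ, 0 < q → ∃ C : ℝ, 0 < C ∧
      ∀ (n p : ℕ), 4 ≤ n → 3 ≤ p →
      ∀ (B α : ℝ), 1 ≤ B → 0 < α → α < Real.exp (-1) →
      ∀ {Ω : Type*} [MeasurableSpace Ω] (μ : Measure Ω) [IsProbabilityMeasure μ]
        {Ω' : Type*} [MeasurableSpace Ω'] (ν : Measure Ω') [IsProbabilityMeasure ν]
        (X : Fin n → Ω → Vec p) (e : Fin n → Ω → ℝ) (Y : Fin n → Ω' → Vec p),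
        IsCenteredSample X μ → IsMultiplier e X μ → IsGaussianAnalogue X μ Y ν →
      ∀ (𝒜 : Set (Set (Vec p))) (Am : Set (Vec p) → Set (Vec p))
        (V : Set (Vec p) → Finset (Vec p)),
        𝒜 ⊆ simpleConvexSets p n a d →
        (∀ A ∈ 𝒜, CondC n a d A (Am A) (V A)) →
        (∀ A ∈ 𝒜, CondS s (V A)) →
        (∀ A ∈ 𝒜, CondM1' b X μ (V A)) →
        CondM2 B X μ →
        CondE2 B q X μ →
        ∃ G : Set Ω, MeasurableSet G ∧ 1 - α ≤ μ.real G ∧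
          ∀ ω ∈ G, bootstrapError e X μ Y ν 𝒜 ω ≤ C * (rateD1 n p B α + rateD2 n p B q α)) := by
  have hlog : ∀ {n p : ℕ} {α : ℝ}, 4 ≤ n → 3 ≤ p → 0 < α → α < Real.exp (-1) →
      (1 : ℝ) ≤ n ∧ 1 ≤ Real.log ((p : ℝ) * n) ∧ 1 ≤ Real.log (1 / α) := by
    intro n p α hn hp hα hα1
    obtain ⟨hL, -, hl, -⟩ := log_facts hn hp hα hα1
    exact ⟨by exact_mod_cast (by omega : 1 ≤ n), by linarith, by linarith⟩
  have hrate : ∀ {n p : ℕ} {B α : ℝ}, 4 ≤ n → 3 ≤ p → 1 ≤ B → 0 < α → α < Real.exp (-1) →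
      0 < rateD1 n p B α := by
    intro n p B α hn hp hB hα hα1
    obtain ⟨hn1, hL, hl⟩ := hlog hn hp hα hα1
    have hB0 : 0 < B := by linarith
    have hL0 := one_pos.trans_le hL
    have hl0 := one_pos.trans_le hl
    have hn0 := one_pos.trans_le hn1
    exact Real.rpow_pos_of_pos (by positivity) _
  refine ⟨?_, fun q hq => ?_⟩
  · obtain ⟨K, hK, h⟩ := exists_bootstrapError_le a b d ha hb hd s
    refine ⟨1 + K * (1 + 20100 * 20101), by positivity, ?_⟩
    intro n p hn hp B α hB hα hα1 Ω _ μ _ Ω' _ ν _ X e Y hX he hY 𝒜 Am V _ hC hS hM1 hM2 hE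
    obtain ⟨hn1, hL, hl⟩ := hlog hn hp hα hα1
    have hD : 0 < rateD1 n p B α := hrate hn hp hB hα hα1
    -- The concentration argument needs the rate to be at most 1. Beyond that the whole space is a
    -- valid event, the summand 1 in the constant making the right side at least 1.
    rcases le_or_gt (rateD1 n p B α) 1 with hD1 | hD1
    · obtain ⟨u, hu, huD, hG⟩ := exists_event_exp hn hp hX hB hα hα1 hM2 hE hD1
      obtain ⟨G, hG, hGα, hGe⟩ := h hn hp hX he hY hC hS hM1 hu hD (by norm_num)
        (sqrt_log_div_le (by linarith) (Real.sqrt_nonneg _) (Real.sq_sqrt (by linarith)) hB hl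
          (Real.one_le_sqrt.2 hn1) (Real.sq_sqrt (by linarith)) hD.le
          (rateD1_cube (by linarith) (by linarith) (Real.sqrt_nonneg _)
            (Real.sq_sqrt (by linarith)) (Real.sqrt_pos.2 (by linarith))
            (Real.sq_sqrt (by linarith))).ge) huD hG
      refine ⟨G, hG, hGα, fun ω hω => (hGe ω hω).trans ?_⟩
      gcongr
      linarith
    · refine ⟨Set.univ, MeasurableSet.univ, by simp [hα.le], fun ω _ => ?_⟩
      refine (bootstrapError_le_one 𝒜 ω).trans ?_
      exact one_le_mul_of_one_le_of_one_le (by linarith [mul_pos hK (by norm_num :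
        (0 : ℝ) < 1 + 20100 * 20101)]) hD1.le
  · obtain ⟨K, hK, h⟩ := exists_bootstrapError_le a b d ha hb hd s
    have hκ : 0 ≤ 8 * (16 + q) * (1 + 9 * (16 + q)) := by positivity
    refine ⟨1 + K * (1 + 8 * (16 + q) * (1 + 9 * (16 + q))), by positivity, ?_⟩
    intro n p hn hp B α hB hα hα1 Ω _ μ _ Ω' _ ν _ X e Y hX he hY 𝒜 Am V _ hC hS hM1 hM2 hE
    obtain ⟨hn1, hL, hl⟩ := hlog hn hp hα hα1
    have hD₁ : 0 < rateD1 n p B α := hrate hn hp hB hα hα1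
    have hD₂ : 0 < rateD2 n p B q α := by
      have hB0 : 0 < B := by linarith
      have hL0 := one_pos.trans_le hL
      have hn0 := one_pos.trans_le hn1
      exact Real.rpow_pos_of_pos (by positivity) _
    -- The same split for the sum of the rates; the strict inequality gives the `rateD2 < 1` from
    -- which `q > 2` follows.
    rcases lt_or_ge (rateD1 n p B α + rateD2 n p B q α) 1 with hD1 | hD1
    · obtain ⟨u, hu, huD, hG⟩ := exists_event_poly hn hp hX hB hα hα1 hq hM2 hE
        (by linarith) (by linarith)
      obtain ⟨G, hG, hGα, hGe⟩ := h hn hp hX he hY hC hS hM1 hu (add_pos hD₁ hD₂) hκ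
        ((sqrt_log_div_le (by linarith) (Real.sqrt_nonneg _) (Real.sq_sqrt (by linarith)) hB hl
          (Real.one_le_sqrt.2 hn1) (Real.sq_sqrt (by linarith)) hD₁.le
          (rateD1_cube (by linarith) (by linarith) (Real.sqrt_nonneg _)
            (Real.sq_sqrt (by linarith)) (Real.sqrt_pos.2 (by linarith))
            (Real.sq_sqrt (by linarith))).ge).trans (by linarith)) huD hG
      refine ⟨G, hG, hGα, fun ω hω => (hGe ω hω).trans ?_⟩
      gcongr
      linarith
    · refine ⟨Set.univ, MeasurableSet.univ, by simp [hα.le], fun ω _ => ?_⟩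
      refine (bootstrapError_le_one 𝒜 ω).trans ?_
      refine one_le_mul_of_one_le_of_one_le ?_ hD1
      have : 0 ≤ K * (1 + 8 * (16 + q) * (1 + 9 * (16 + q))) := by positivity
      linarith
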